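/- **Setting.** Work on $\mathbb{R}^4$ with $\hat f(\xi)=\int e^{-i x\cdot\xi}f(x)\,dx$. Fix an even $\eta_0\in C_c^\infty(\mathbb{R})$ with $0\le\eta_0\le1$, $\eta_0(x)=1$ for $|x|\le\frac54$ and $\eta_0(x)=0$ for $|x|\ge\frac85$. For $N\in2^{\mathbb{Z}}$ let $P_N$ and $P_{\le N}$ be the Fourier multipliers (acting on the space variable) with symbols $\eta_0(|\xi|/N)-\eta_0(2|\xi|/N)$ and $\eta_0(|\xi|/N)$. Put $\langle N\rangle=(1+N^2)^{1/2}$ and $$\|f\|_{\mathcal L^p_rL^\mu_\theta}=\Big(\int_0^\infty\Big(\int_{S^3}|f(r\theta)|^\mu\,d\theta\Big)^{p/\mu}r^3\,dr\Big)^{1/p}.$$ Let $0<\delta<1$, $\nu=\frac{16}{7}\delta$, and let $I\subseteq\mathbb{R}$ be an interval. All space-time norms are taken over $I\times\mathbb{R}^4$. For $N\in2^{\mathbb{Z}}$ define $$\|g\|_{X_N(I)}=N\|g\|_{L_t^{1/\delta}L_x^{2/(1-\delta)}}+N\|g\|_{L^2_tL^4_x},$$ $$\|g\|_{Y_N(I)}=N^{\frac47+\nu}\langle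 N\rangle^{4\delta}\Big(\|g\|_{L^2_t\mathcal L_r^{14/(5-\delta)}L_\theta^{4/\delta}}+\|g\|_{L^2_t\mathcal L_r^{28}L_\theta^{4/\delta}}\Big)+\langle N\rangle^{\frac17}\Big(\|g\|_{L_t^{1/\delta}L_x^{14/(5-\delta)}}+\|g\|_{L_t^{1/\delta}L_x^{28}}\Big),$$ $$\|g\|_{G_N(I)}=\inf\Big(N\|g^{(1)}\|_{L^1_tL^2_x}+N^{\frac47+\nu}\|g^{(2)}\|_{L_t^{2/(1+2\delta)}\mathcal L_r^{14/(9+\delta)}L^2_\theta}\Big),$$ where the infimum runs over all measurable $g^{(1)},g^{(2)}$ with $g=g^{(1)}+g^{(2)}$ such that, for almost every $t\in I$, the spatial Fourier transforms of $g^{(1)}(t)$ and $g^{(2)}(t)$ are supported in $\{N/2<|\xi|<2N\}$. For $Z\in\{X,Y,G\}$ let $$\|h\|_{Z(I)}=\Big(\sum_{N\in2^{\mathbb{Z}}}\|P_Nh\|_{Z_N(I)}^2\Big)^{1/2},$$ and let $Z(I)$ be the space of measurable $h\colon I\times\mathbb{R}^4\to\mathbb{C}$ with $\|h\|_{Z(I)}<\infty$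 such that for almost every $t\in I$ the function $h(t)$ is tempered, i.e. $(1+|x|)^{-n}h(t)\in L^1(\mathbb{R}^4)$ for some $n\in\mathbb{N}$, and $P_{\le N}h(t)\to0$ in $\mathcal S'(\mathbb{R}^4)$ as $N\to0$ (equivalently, $h(t)=\sum_NP_Nh(t)$ in $\mathcal S'(\mathbb{R}^4)$). **Statement.** There is $\delta_0>0$ such that for every $\delta\in(0,\delta_0]$ and every $\eta_0$ as above there is a constant $C>0$ such that for all intervals $I\subseteq\mathbb{R}$, all $u,v,v_1,v_2,w\in X(I)$ and all $F\in Y(I)$ the functions whose norms are taken on the left-hand sides below belong to $G(I)$, and $$\||v+F|^2(v+F)\|_{G(I)}\le C\big(\|v\|_{X(I)}^3+\|F\|_{Y(I)}^3\big),$$ $$\||v_1+F|^2(v_1+F)-|v_2+F|^2(v_2+F)\|_{G(I)}\le C\|v_1-v_2\|_{X(I)}\big(\|v_1\|_{X(I)}^2+\|v_2\|_{X(I)}^2+\|F\|_{Y(I)}^2\big),$$ $$\||u+w+F|^2(u+w+F)-|u|^2u\|_{G(I)}\le C\big(\|F\|_{Y(I)}^3+\|w\|_{X(I)}^3+\|F\|_{Y(I)}\|u\|_{X(I)}^2+\|w\|_{X(I)}\|u\|_{X(I)}^2\big).$$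 -/

import Mathlib

open MeasureTheory Set Filter
open scoped ENNReal NNReal Topology SchwartzMap ContDiff FourierTransform Convolution

noncomputable section

namespace ForcedNLS

/-- The physical space `ℝ⁴` with its Euclidean norm. -/
abbrev E4 : Type := EuclideanSpace ℝ (Fin 4)

/-! ### Littlewood-Paley theory

Mathlib's Fourier transform uses the phase `e^{-2πi⟨x,ξ⟩}`, the convention here is
`f̂(ξ) = ∫ e^{-i⟨x,ξ⟩} f(x) dx`. A symbol `m(ξ)` in the latter variable is the symbol `m(2πξ)` in
Mathlib's variable. The dyadic number `N = 2^k` is represented by its exponent `k : ℤ`. -/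

/-- Admissible profiles `η₀` of the Littlewood-Paley decomposition. -/
structure IsLPCutoff (η : ℝ → ℝ) : Prop where
  smooth : ContDiff ℝ ∞ η
  even : ∀ x, η (-x) = η x
  nonneg : ∀ x, 0 ≤ η x
  le_one : ∀ x, η x ≤ 1
  eq_one : ∀ x, |x| ≤ 5 / 4 → η x = 1
  eq_zero : ∀ x, 8 / 5 ≤ |x| → η x = 0

/-- The dyadic number `N = 2^k`. -/
def dyad (k : ℤ) : ℝ := (2 : ℝ) ^ k

/-- The symbol `χ_N(ξ) = η₀(|ξ|/N) - η₀(2|ξ|/N)`, `N = 2^k`. -/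
def lpSymbol (η : ℝ → ℝ) (k : ℤ) (ξ : E4) : ℝ := η (‖ξ‖ / dyad k) - η (2 * ‖ξ‖ / dyad k)

/-- The symbol `χ_{≤N}(ξ) = η₀(|ξ|/N)`, `N = 2^k`. -/
def lpSymbolLow (η : ℝ → ℝ) (k : ℤ) (ξ : E4) : ℝ := η (‖ξ‖ / dyad k)

/-- The Fourier multiplier `f ↦ 𝓕⁻¹(m f̂)` with (smooth, compactly supported) symbol `m`, acting on
tempered functions by convolution with the Schwartz kernel `𝓕⁻¹ m`. -/
def multiplier (m : E4 → ℝ) (f : E4 → ℂ) : E4 → ℂ :=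
  (𝓕⁻ (fun ξ : E4 => ((m ((2 * Real.pi) • ξ) : ℝ) : ℂ))) ⋆[ContinuousLinearMap.mul ℂ ℂ, volume] f

/-- The Littlewood-Paley projector `P_N`, `N = 2^k`. -/
def lpProj (η : ℝ → ℝ) (k : ℤ) : (E4 → ℂ) → E4 → ℂ := multiplier (lpSymbol η k)

/-- The low frequency projector `P_{≤N}`, `N = 2^k`. -/
def lpProjLow (η : ℝ → ℝ) (k : ℤ) : (E4 → ℂ) → E4 → ℂ := multiplier (lpSymbolLow η k)

/-- `f` is a tempered function: it is integrable against some negative power of `1 + |x|`. -/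
def IsTemperedFun (f : E4 → ℂ) : Prop :=
  ∃ n : ℕ, Integrable (fun x : E4 => (((1 + ‖x‖) ^ n)⁻¹ : ℝ) • f x)

/-- `f` is a tempered function with `P_{≤N} f → 0` in the sense of tempered distributions as
`N → 0`, i.e. without polynomial part. This is the usual realization of homogeneous spaces; it means
that `f = ∑_N P_N f` in the sense of tempered distributions. -/
def IsHomogeneous (η : ℝ → ℝ) (f : E4 → ℂ) : Prop :=
  IsTemperedFun f ∧
    ∀ φ : 𝓢(E4, ℂ), Tendsto (fun k : ℤ => ∫ x, lpProjLow η k f x * φ x) atBot (𝓝 0)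

/-- The Fourier transform of the tempered function `f`, as a functional on test functions (in
Mathlib's frequency variable). -/
def fourierDist (f : E4 → ℂ) (φ : 𝓢(E4, ℂ)) : ℂ := ∫ x, f x * (𝓕 φ) x

/-- `f` is a tempered function, the support of whose Fourier transform is contained in
`{ξ : N/2 < |ξ| < 2N}`, `N = 2^k`. -/
def HasFrequency (k : ℤ) (f : E4 → ℂ) : Prop :=
  IsTemperedFun f ∧
    Distribution.dsupport (fourierDist f) ⊆
      {ξ : E4 | dyad k / 2 < ‖(2 * Real.pi) • ξ‖ ∧ ‖(2 * Real.pi) • ξ‖ < 2 * dyad k}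

/-! ### Norms

Functions on `I × ℝ⁴` are represented by functions `ℝ → E4 → ℂ`, whose values at times outside of
`I` are irrelevant. -/

/-- `‖f‖_{𝓛^p_r L^μ_θ}` on `ℝ⁴`, with the measure `r³ dr` on `(0,∞)` and the surface measure on the
unit sphere. -/
def sphNorm (p μ : ℝ≥0∞) (f : E4 → ℂ) : ℝ≥0∞ :=
  eLpNorm (fun r : Ioi (0 : ℝ) =>
    eLpNorm (fun θ : Metric.sphere (0 : E4) 1 => f ((r : ℝ) • (θ : E4))) μ
      (volume : Measure E4).toSphere) p (Measure.volumeIoiPow 3)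

/-- `‖g‖_{L^q_t L^p_x}` on `I × ℝ⁴`. -/
def mixNorm (I : Set ℝ) (q p : ℝ) (g : ℝ → E4 → ℂ) : ℝ≥0∞ :=
  eLpNorm (fun t => eLpNorm (g t) (ENNReal.ofReal p) volume) (ENNReal.ofReal q) (volume.restrict I)

/-- `‖g‖_{L^q_t 𝓛^p_r L^μ_θ}` on `I × ℝ⁴`. -/
def mixSphNorm (I : Set ℝ) (q p μ : ℝ) (g : ℝ → E4 → ℂ) : ℝ≥0∞ :=
  eLpNorm (fun t => sphNorm (ENNReal.ofReal p) (ENNReal.ofReal μ) (g t)) (ENNReal.ofReal q)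
    (volume.restrict I)

/-- `⟨a⟩ = (1 + a²)^{1/2}`. -/
def jap (a : ℝ) : ℝ := Real.sqrt (1 + a ^ 2)

/-- The parameter `ν = 16δ/7`. -/
def nu (δ : ℝ) : ℝ := 16 / 7 * δ

/-- The norm of `X_N(I)`, `N = 2^k`. -/
def XN (δ : ℝ) (I : Set ℝ) (k : ℤ) (g : ℝ → E4 → ℂ) : ℝ≥0∞ :=
  ENNReal.ofReal (dyad k) * mixNorm I (1 / δ) (2 / (1 - δ)) g +
    ENNReal.ofReal (dyad k) * mixNorm I 2 4 g

/-- The norm of `Y_N(I)`, `N = 2^k`. -/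
def YN (δ : ℝ) (I : Set ℝ) (k : ℤ) (g : ℝ → E4 → ℂ) : ℝ≥0∞ :=
  ENNReal.ofReal (dyad k ^ (4 / 7 + nu δ) * jap (dyad k) ^ (4 * δ)) *
      mixSphNorm I 2 (14 / (5 - δ)) (4 / δ) g +
    ENNReal.ofReal (dyad k ^ (4 / 7 + nu δ) * jap (dyad k) ^ (4 * δ)) *
      mixSphNorm I 2 28 (4 / δ) g +
    ENNReal.ofReal (jap (dyad k) ^ (1 / 7 : ℝ)) * mixNorm I (1 / δ) (14 / (5 - δ)) g +
    ENNReal.ofReal (jap (dyad k) ^ (1 / 7 : ℝ)) * mixNorm I (1 / δ) 28 g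

/-- `g = g₁ + g₂` on `I × ℝ⁴` with measurable summands of spatial frequency `N = 2^k`. -/
structure IsSplitting (I : Set ℝ) (k : ℤ) (g g₁ g₂ : ℝ → E4 → ℂ) : Prop where
  meas₁ : AEStronglyMeasurable (Function.uncurry g₁) ((volume.restrict I).prod volume)
  meas₂ : AEStronglyMeasurable (Function.uncurry g₂) ((volume.restrict I).prod volume)
  freq₁ : ∀ᵐ t ∂(volume.restrict I), HasFrequency k (g₁ t)
  freq₂ : ∀ᵐ t ∂(volume.restrict I), HasFrequency k (g₂ t)
  add_eq : ∀ᵐ t ∂(volume.restrict I), ∀ᵐ x : E4, g t x = g₁ t x + g₂ t x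

/-- The norm of `G_N(I)`, `N = 2^k`: the infimum over all splittings. -/
def GN (δ : ℝ) (I : Set ℝ) (k : ℤ) (g : ℝ → E4 → ℂ) : ℝ≥0∞ :=
  ⨅ (g₁ : ℝ → E4 → ℂ) (g₂ : ℝ → E4 → ℂ) (_ : IsSplitting I k g g₁ g₂),
    ENNReal.ofReal (dyad k) * mixNorm I 1 2 g₁ +
      ENNReal.ofReal (dyad k ^ (4 / 7 + nu δ)) *
        mixSphNorm I (2 / (1 + 2 * δ)) (14 / (9 + δ)) 2 g₂

/-- The `ℓ²`-sum over dyadic frequencies. -/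
def l2sum (a : ℤ → ℝ≥0∞) : ℝ≥0∞ := (∑' k, a k ^ 2) ^ (1 / 2 : ℝ)

/-- The norm of `X(I)`. -/
def normX (η : ℝ → ℝ) (δ : ℝ) (I : Set ℝ) (v : ℝ → E4 → ℂ) : ℝ≥0∞ :=
  l2sum fun k => XN δ I k fun t => lpProj η k (v t)

/-- The norm of `Y(I)`. -/
def normY (η : ℝ → ℝ) (δ : ℝ) (I : Set ℝ) (F : ℝ → E4 → ℂ) : ℝ≥0∞ :=
  l2sum fun k => YN δ I k fun t => lpProj η k (F t)

/-- The norm of `G(I)`. -/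
def normG (η : ℝ → ℝ) (δ : ℝ) (I : Set ℝ) (h : ℝ → E4 → ℂ) : ℝ≥0∞ :=
  l2sum fun k => GN δ I k fun t => lpProj η k (h t)

/-! ### The spaces -/

/-- Measurable functions on `I × ℝ⁴` almost all of whose time slices are tempered functions without
polynomial part. -/
structure IsBase (η : ℝ → ℝ) (I : Set ℝ) (v : ℝ → E4 → ℂ) : Prop where
  meas : AEStronglyMeasurable (Function.uncurry v) ((volume.restrict I).prod volume)
  slice : ∀ᵐ t ∂(volume.restrict I), IsHomogeneous η (v t)

/-- `v ∈ X(I)`. -/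
def MemX (η : ℝ → ℝ) (δ : ℝ) (I : Set ℝ) (v : ℝ → E4 → ℂ) : Prop :=
  IsBase η I v ∧ normX η δ I v < ⊤

/-- `F ∈ Y(I)`. -/
def MemY (η : ℝ → ℝ) (δ : ℝ) (I : Set ℝ) (F : ℝ → E4 → ℂ) : Prop :=
  IsBase η I F ∧ normY η δ I F < ⊤

/-- `h ∈ G(I)`. -/
def MemG (η : ℝ → ℝ) (δ : ℝ) (I : Set ℝ) (h : ℝ → E4 → ℂ) : Prop :=
  IsBase η I h ∧ normG η δ I h < ⊤

/-- The cubic nonlinearity `|u|²u`. -/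
def cubic (u : ℝ → E4 → ℂ) : ℝ → E4 → ℂ := fun t x => ((‖u t x‖ ^ 2 : ℝ) : ℂ) * u t x

end ForcedNLS

end

/-! Expand the cubic expressions multilinearly, split every factor into Littlewood-Paley pieces, and
sort each triple of dyadic frequencies by its largest entry K; call the other two L ≥ M. The space
containing the top piece decides where the product is estimated: a top piece from X leads to the
component L¹_t L²_x of G_N, a top piece from Y to the component with the angular norm. The two lower
pieces may come from either space, because both norms imply the common bounds recorded in `Pieces`.
With z_N the dyadic norm, a piece at frequency N is O(z_N) in L²_t L^∞_x, O(N^{1-2δ} z_N) in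
L^{1/δ}_t L^∞_x and O(N^{-2δ} z_N) in L^{1/δ}_t L⁴_x. These come from `bernstein` through
`pieces_of_XN` and `pieces_of_YN`; the latter also interpolates the components of Y_N to the
radial-angular bound needed for a top piece.

Interpolation turns the common bounds into the weight N^{2δ} in L^{2/(1-2δ)}_t L^∞_x
(`Pieces.sup_mid`) and in L^{1/δ}_t L^{4/(1-4δ)}_x (`Pieces.low`). Hölder's inequality, with the L⁴
bound on the piece at L and one of these on the piece at M, therefore gains (M/L)^{2δ}, as in
`topNorm_term_le`. The weight of G_N against that of the top piece gives (N/K)^σ with σ > 0, and N ≤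
8K by frequency supports (`conv_lpKer_mul_eq_zero`). Cauchy-Schwarz in (L, M) and Young's inequality
for sequences in (N, K) then sum the series: `l2sum_trilinear_le`.

The projections must also be bounded on the radial-angular norms. This is `sn_two_lconv_le`:
quaternion multiplication parametrizes rotations by points of S³, Minkowski's inequality in the
angle replaces a function by its spherical L² mean, and the ordinary Young inequality for that
radial mean finishes.

Elements of X and Y are a priori only tempered functions without polynomial part. The bounds place
the sum of the moduli of the pieces in L⁴ + L^{4/(1-4δ)} at almost every time (`Pieces.isTame`), so
the series of pieces converges almost everywhere, and by testing against Schwartz functions its sum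
is the given function (`ae_hasSum_conv_lpKer`). Cubic products lie in sums of Lebesgue spaces with
exponents above 1, hence again have no polynomial part. `gBound_triSum` combines all this for one
paraproduct; `Decomposes.gBound_mul` and `SumDecomposes.gBound_mul` assemble the trilinear estimate.
-/

noncomputable section

namespace ForcedNLS

section


/-! ### Lebesgue norms of nonnegative functions -/

section Lnorm

variable {α β ι : Type*} [MeasurableSpace α] [MeasurableSpace β] {μ : Measure α} {ν : Measure β}

/-- The `L^p` norm of a function with values in `[0, ∞]`. -/
def lnorm (μ : Measure α) (p : ℝ) (f : α → ℝ≥0∞) : ℝ≥0∞ := (∫⁻ a, f a ^ p ∂μ) ^ (1 / p)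

lemma eLpNorm_eq_lnorm {E : Type*} [ENorm E] {p : ℝ} (hp : 0 < p) (f : α → E) :
    eLpNorm f (ENNReal.ofReal p) μ = lnorm μ p fun a => ‖f a‖ₑ := by
  rw [eLpNorm_eq_lintegral_rpow_enorm_toReal (by simpa using hp) (by simp),
    ENNReal.toReal_ofReal hp.le, lnorm]

lemma lnorm_mono_ae {p : ℝ} (hp : 0 ≤ p) {f g : α → ℝ≥0∞} (h : ∀ᵐ a ∂μ, f a ≤ g a) :
    lnorm μ p f ≤ lnorm μ p g := by
  unfold lnorm
  refine ENNReal.rpow_le_rpow (lintegral_mono_ae ?_) (by positivity)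
  filter_upwards [h] with a ha using ENNReal.rpow_le_rpow ha hp

lemma lnorm_mono {p : ℝ} (hp : 0 ≤ p) {f g : α → ℝ≥0∞} (h : ∀ a, f a ≤ g a) :
    lnorm μ p f ≤ lnorm μ p g := lnorm_mono_ae hp (ae_of_all _ h)

lemma lnorm_const_mul {p : ℝ} (hp : 0 < p) {c : ℝ≥0∞} (hc : c ≠ ⊤) (f : α → ℝ≥0∞) :
    lnorm μ p (fun a => c * f a) = c * lnorm μ p f := by
  unfold lnorm
  simp_rw [ENNReal.mul_rpow_of_nonneg _ _ hp.le]
  rw [lintegral_const_mul' _ _ (ENNReal.rpow_ne_top_of_nonneg hp.le hc),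
    ENNReal.mul_rpow_of_nonneg _ _ (by positivity), ← ENNReal.rpow_mul, mul_one_div_cancel hp.ne',
    ENNReal.rpow_one]

lemma lnorm_zero {p : ℝ} (hp : 0 < p) : lnorm μ p (fun _ => 0) = 0 := by
  simp [lnorm, ENNReal.zero_rpow_of_pos, hp]

lemma lnorm_rpow {p a : ℝ} (hp : 0 < p) (ha : 0 < a) (f : α → ℝ≥0∞) :
    lnorm μ p (fun x => f x ^ a) = lnorm μ (a * p) f ^ a := by
  unfold lnorm
  simp_rw [← ENNReal.rpow_mul]
  congr 1
  field_simp

lemma lnorm_one (f : α → ℝ≥0∞) : lnorm μ 1 f = ∫⁻ a, f a ∂μ := by simp [lnorm]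

lemma lnorm_rpow_self {p : ℝ} (hp : 0 < p) (f : α → ℝ≥0∞) :
    lnorm μ p f ^ p = ∫⁻ a, f a ^ p ∂μ := by
  rw [lnorm, ← ENNReal.rpow_mul, one_div_mul_cancel hp.ne', ENNReal.rpow_one]

lemma lnorm_const {p : ℝ} (hp : 0 < p) (c : ℝ≥0∞) :
    lnorm μ p (fun _ => c) = c * μ univ ^ (1 / p) := by
  rw [lnorm, lintegral_const, ENNReal.mul_rpow_of_nonneg _ _ (by positivity), ← ENNReal.rpow_mul,
    mul_one_div_cancel hp.ne', ENNReal.rpow_one]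

/-- Hölder's inequality. -/
lemma lnorm_le_mul_rpow {p p₁ p₂ a b : ℝ} (hp : 0 < p) (hp₁ : 0 < p₁) (hp₂ : 0 < p₂) (ha : 0 ≤ a)
    (hb : 0 ≤ b) (h : 1 / p = a / p₁ + b / p₂) {f g k : α → ℝ≥0∞} (hf : AEMeasurable f μ)
    (hg : AEMeasurable g μ) (hk : ∀ᵐ x ∂μ, k x ≤ f x ^ a * g x ^ b) :
    lnorm μ p k ≤ lnorm μ p₁ f ^ a * lnorm μ p₂ g ^ b := by
  have h1 : p * a / p₁ + p * b / p₂ = 1 := by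
    have : p * (1 / p) = p * (a / p₁ + b / p₂) := by rw [h]
    rw [mul_one_div_cancel hp.ne'] at this
    rw [this]; ring
  have key : ∫⁻ x, k x ^ p ∂μ ≤
      (∫⁻ x, f x ^ p₁ ∂μ) ^ (p * a / p₁) * (∫⁻ x, g x ^ p₂ ∂μ) ^ (p * b / p₂) := by
    refine le_trans (lintegral_mono_ae ?_) (ENNReal.lintegral_mul_norm_pow_le (hf.pow_const p₁)
      (hg.pow_const p₂) (by positivity) (by positivity) h1)
    filter_upwards [hk] with x hx
    refine (ENNReal.rpow_le_rpow hx hp.le).trans_eq ?_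
    rw [ENNReal.mul_rpow_of_nonneg _ _ hp.le, ← ENNReal.rpow_mul, ← ENNReal.rpow_mul,
      ← ENNReal.rpow_mul, ← ENNReal.rpow_mul]
    congr 2 <;> field_simp
  unfold lnorm
  refine (ENNReal.rpow_le_rpow key (by positivity)).trans_eq ?_
  rw [ENNReal.mul_rpow_of_nonneg _ _ (by positivity), ← ENNReal.rpow_mul, ← ENNReal.rpow_mul,
      ← ENNReal.rpow_mul, ← ENNReal.rpow_mul]
  congr 2 <;> field_simp

lemma lnorm_mul_le {p p₁ p₂ : ℝ} (hp : 0 < p) (hp₁ : 0 < p₁) (hp₂ : 0 < p₂)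
    (h : 1 / p = 1 / p₁ + 1 / p₂) {f g : α → ℝ≥0∞} (hf : AEMeasurable f μ)
    (hg : AEMeasurable g μ) :
    lnorm μ p (fun x => f x * g x) ≤ lnorm μ p₁ f * lnorm μ p₂ g := by
  simpa using lnorm_le_mul_rpow (k := fun x => f x * g x) hp hp₁ hp₂ zero_le_one zero_le_one h hf hg
    (by simp)

lemma lnorm_interpolate {p p₁ p₂ a b : ℝ} (hp : 0 < p) (hp₁ : 0 < p₁) (hp₂ : 0 < p₂) (ha : 0 ≤ a)
    (hb : 0 ≤ b) (hab : a + b = 1) (h : 1 / p = a / p₁ + b / p₂) {f : α → ℝ≥0∞}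
    (hf : AEMeasurable f μ) : lnorm μ p f ≤ lnorm μ p₁ f ^ a * lnorm μ p₂ f ^ b := by
  refine lnorm_le_mul_rpow hp hp₁ hp₂ ha hb h hf hf (ae_of_all _ fun x => ?_)
  rw [← ENNReal.rpow_add_of_nonneg _ _ ha hb, hab, ENNReal.rpow_one]

lemma lnorm_le_mul_sup {p q : ℝ} (hp : 0 < p) (hpq : p ≤ q) {f : α → ℝ≥0∞}
    {B : ℝ≥0∞} (hB : B ≠ ⊤) (h : ∀ᵐ x ∂μ, f x ≤ B) :
    lnorm μ q f ≤ lnorm μ p f ^ (p / q) * B ^ (1 - p / q) := by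
  have hq := hp.trans_le hpq
  have h1 : ∫⁻ x, f x ^ q ∂μ ≤ (∫⁻ x, f x ^ p ∂μ) * B ^ (q - p) := by
    rw [← lintegral_mul_const' _ _ (ENNReal.rpow_ne_top_of_nonneg (by linarith) hB)]
    refine lintegral_mono_ae ?_
    filter_upwards [h] with x hx
    calc f x ^ q = f x ^ p * f x ^ (q - p) := by
          rw [← ENNReal.rpow_add_of_nonneg _ _ hp.le (by linarith)]; congr 1; ring
      _ ≤ _ := by gcongr
  refine (ENNReal.rpow_le_rpow h1 (by positivity)).trans_eq ?_
  rw [ENNReal.mul_rpow_of_nonneg _ _ (by positivity), lnorm, ← ENNReal.rpow_mul, ← ENNReal.rpow_mul]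
  congr 2
  · field_simp
  · field_simp

lemma lnorm_add_le {p : ℝ} (hp : 1 ≤ p) {f g : α → ℝ≥0∞} (hf : AEMeasurable f μ)
    (hg : AEMeasurable g μ) : lnorm μ p (fun x => f x + g x) ≤ lnorm μ p f + lnorm μ p g :=
  ENNReal.lintegral_Lp_add_le hf hg hp

lemma lnorm_finset_sum_le {p : ℝ} (hp : 1 ≤ p) {f : ι → α → ℝ≥0∞} (hf : ∀ i, AEMeasurable (f i) μ)
    (s : Finset ι) : lnorm μ p (fun x => ∑ i ∈ s, f i x) ≤ ∑ i ∈ s, lnorm μ p (f i) := by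
  classical
  induction s using Finset.induction_on with
  | empty => simp [lnorm_zero (zero_lt_one.trans_le hp)]
  | insert i s hi ih =>
    simp_rw [Finset.sum_insert hi]
    refine (lnorm_add_le hp (hf i) ?_).trans (by gcongr)
    exact Finset.aemeasurable_fun_sum _ fun i _ => hf i

/-- Raising to a positive power commutes with suprema of finite partial sums, so monotone
convergence along the directed family of finite sets reduces this to the finite Minkowski
inequality. -/
lemma lnorm_tsum_le [Countable ι] {p : ℝ} (hp : 1 ≤ p) {f : ι → α → ℝ≥0∞}
    (hf : ∀ i, AEMeasurable (f i) μ) :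
    lnorm μ p (fun x => ∑' i, f i x) ≤ ∑' i, lnorm μ p (f i) := by
  have hp0 := zero_lt_one.trans_le hp
  have h1 : ∀ x, (∑' i, f i x) ^ p = ⨆ s : Finset ι, (∑ i ∈ s, f i x) ^ p := fun x => by
    rw [ENNReal.tsum_eq_iSup_sum]
    exact (ENNReal.orderIsoRpow p hp0).map_iSup _
  unfold lnorm
  simp_rw [h1]
  rw [lintegral_iSup_directed]
  · have : ∀ g : Finset ι → ℝ≥0∞, (⨆ s, g s) ^ (1 / p) = ⨆ s, g s ^ (1 / p) := fun g =>
      (ENNReal.orderIsoRpow (1 / p) (by positivity)).map_iSup _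
    rw [this]
    refine iSup_le fun s => (lnorm_finset_sum_le hp hf s).trans (ENNReal.sum_le_tsum s)
  · exact fun s => (Finset.aemeasurable_fun_sum _ fun i _ => hf i).pow_const p
  · refine Monotone.directed_le fun s t hst x => ?_
    exact ENNReal.rpow_le_rpow (Finset.sum_le_sum_of_subset hst) hp0.le

lemma measurable_lnorm [SFinite ν] {p : ℝ} {f : α → β → ℝ≥0∞}
    (hf : Measurable (Function.uncurry f)) : Measurable fun a => lnorm ν p (f a) := by
  unfold lnorm
  exact (Measurable.lintegral_prod_right' (f := fun z : α × β => f z.1 z.2 ^ p)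
    (hf.pow_const p)).pow_const _

lemma ae_lt_top_of_lnorm {p : ℝ} (hp : 0 < p) {f : α → ℝ≥0∞} (hf : AEMeasurable f μ)
    (h : lnorm μ p f < ⊤) : ∀ᵐ a ∂μ, f a < ⊤ := by
  have h1 : ∫⁻ a, f a ^ p ∂μ ≠ ⊤ := by
    rw [← lnorm_rpow_self hp]
    exact ENNReal.rpow_ne_top_of_nonneg hp.le h.ne
  filter_upwards [ae_lt_top' (hf.pow_const p) h1] with a ha
  by_contra h
  rw [not_lt, top_le_iff] at h
  simp [h, hp] at ha

/-- Minkowski's integral inequality in `L²`. -/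
lemma lnorm_two_lintegral_le [SFinite μ] [SFinite ν] {f : α → β → ℝ≥0∞}
    (hf : Measurable (Function.uncurry f)) :
    lnorm μ 2 (fun a => ∫⁻ b, f a b ∂ν) ≤ ∫⁻ b, lnorm μ 2 (fun a => f a b) ∂ν := by
  have hf' : Measurable (Function.uncurry fun b a => f a b) := hf.comp measurable_swap
  have hsec : ∀ b, Measurable fun a => f a b := fun b => hf.comp measurable_prodMk_right
  have hsec' : ∀ a, Measurable fun b => f a b := fun a => hf.comp measurable_prodMk_left
  have hN : Measurable fun b => lnorm μ 2 (fun a => f a b) := measurable_lnorm hf'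
  -- Both squares are written as double integrals over `b` and `c`. After Tonelli the integrands
  -- compare by Cauchy-Schwarz in `a`, without any finiteness assumption or duality.
  have key : ∫⁻ a, (∫⁻ b, f a b ∂ν) ^ (2 : ℝ) ∂μ ≤ (∫⁻ b, lnorm μ 2 (fun a => f a b) ∂ν) ^ (2 : ℝ) := by
    have e1 : ∀ a, (∫⁻ b, f a b ∂ν) ^ (2 : ℝ) = ∫⁻ b, ∫⁻ c, f a b * f a c ∂ν ∂ν := fun a => by
      simp_rw [lintegral_const_mul _ (hsec' a), lintegral_mul_const _ (hsec' a)]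
      rw [← sq, ← ENNReal.rpow_natCast]; norm_num
    have e2 : (∫⁻ b, lnorm μ 2 (fun a => f a b) ∂ν) ^ (2 : ℝ) =
        ∫⁻ b, ∫⁻ c, lnorm μ 2 (fun a => f a b) * lnorm μ 2 (fun a => f a c) ∂ν ∂ν := by
      simp_rw [lintegral_const_mul _ hN, lintegral_mul_const _ hN]
      rw [← sq, ← ENNReal.rpow_natCast]; norm_num
    have m1 : Measurable fun z : (α × β) × β => f z.1.1 z.1.2 * f z.1.1 z.2 :=
      (hf.comp measurable_fst).mul (hf.comp ((measurable_fst.comp measurable_fst).prodMk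
        measurable_snd))
    simp_rw [e1, e2]
    rw [lintegral_lintegral_swap (m1.lintegral_prod_right').aemeasurable]
    refine lintegral_mono fun b => ?_
    rw [lintegral_lintegral_swap]
    · refine lintegral_mono fun c => ?_
      have := lnorm_mul_le (μ := μ) (p := 1) (p₁ := 2) (p₂ := 2) one_pos two_pos two_pos (by norm_num)
        (hsec b).aemeasurable (hsec c).aemeasurable
      rwa [lnorm_one] at this
    · exact ((hsec b).comp measurable_fst |>.mul hf).aemeasurable
  rw [lnorm, one_div, ENNReal.rpow_inv_le_iff two_pos]
  exact key

end Lnorm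

end

section


/-! ### Convolutions of Schwartz functions with tempered functions -/

/-- Convolution with a Schwartz function. -/
def conv (K : 𝓢(E4, ℂ)) (f : E4 → ℂ) (x : E4) : ℂ := ∫ y, K (x - y) * f y

lemma multiplier_eq_conv {m : E4 → ℝ} {M : 𝓢(E4, ℂ)}
    (h : ∀ ξ, M ξ = ((m ((2 * Real.pi) • ξ) : ℝ) : ℂ)) (f : E4 → ℂ) :
    multiplier m f = conv (𝓕⁻ M) f := by
  have h' : (fun ξ : E4 => ((m ((2 * Real.pi) • ξ) : ℝ) : ℂ)) = M := funext fun ξ => (h ξ).symm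
  funext x
  rw [multiplier, h', ← SchwartzMap.fourierInv_coe, convolution_eq_swap]
  rfl

lemma continuous_inv_one_add_norm (n : ℕ) : Continuous fun x : E4 => ((1 + ‖x‖) ^ n)⁻¹ :=
  Continuous.inv₀ (by fun_prop) fun x => by positivity

lemma exists_schwartz_decay (K : 𝓢(E4, ℂ)) (n : ℕ) :
    ∃ C : ℝ, 0 ≤ C ∧ ∀ x, ‖K x‖ ≤ C * ((1 + ‖x‖) ^ n)⁻¹ := by
  refine ⟨2 ^ n * (Finset.Iic (n, 0)).sup (fun m => SchwartzMap.seminorm ℝ m.1 m.2) K,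
    by positivity, fun x => ?_⟩
  have := SchwartzMap.one_add_le_sup_seminorm_apply (𝕜 := ℝ) (m := (n, 0)) le_rfl le_rfl K x
  rw [norm_iteratedFDeriv_zero] at this
  rw [← div_eq_mul_inv, le_div_iff₀ (by positivity), mul_comm]
  exact this

/-- Peetre's inequality, from 1 + ‖y‖ ≤ (1 + ‖x‖)(1 + ‖x - y‖). -/
lemma inv_one_add_norm_sub_le (x y : E4) (n : ℕ) :
    ((1 + ‖x - y‖) ^ n)⁻¹ ≤ (1 + ‖x‖) ^ n * ((1 + ‖y‖) ^ n)⁻¹ := by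
  rw [← div_eq_mul_inv, le_div_iff₀ (by positivity), inv_mul_le_iff₀ (by positivity), ← mul_pow]
  gcongr
  have : ‖y‖ ≤ ‖x‖ + ‖x - y‖ := by
    have := norm_sub_le x (x - y); simpa using this
  nlinarith [norm_nonneg x, norm_nonneg (x - y), mul_nonneg (norm_nonneg x) (norm_nonneg (x - y))]

lemma exists_schwartz_sub_decay (K : 𝓢(E4, ℂ)) (n : ℕ) :
    ∃ C : ℝ, 0 ≤ C ∧ ∀ x y, ‖K (x - y)‖ ≤ C * (1 + ‖x‖) ^ n * ((1 + ‖y‖) ^ n)⁻¹ := by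
  obtain ⟨C, hC, h⟩ := exists_schwartz_decay K n
  refine ⟨C, hC, fun x y => (h _).trans ?_⟩
  rw [mul_assoc]
  exact mul_le_mul_of_nonneg_left (inv_one_add_norm_sub_le x y n) hC

lemma integrable_inv_one_add_norm {n : ℕ} (hn : 4 < n) :
    Integrable fun x : E4 => ((1 + ‖x‖) ^ n)⁻¹ := by
  have := integrable_one_add_norm (E := E4) (μ := volume) (r := n) (by simpa using hn)
  refine this.congr (ae_of_all _ fun x => ?_)
  simp [Real.rpow_neg, Real.rpow_natCast, show 0 ≤ 1 + ‖x‖ by positivity]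

lemma IsTemperedFun.aestronglyMeasurable {f : E4 → ℂ} (hf : IsTemperedFun f) :
    AEStronglyMeasurable f := by
  obtain ⟨n, hn⟩ := hf
  have h1 : AEStronglyMeasurable (fun x : E4 => (1 + ‖x‖) ^ n • ((((1 + ‖x‖) ^ n)⁻¹ : ℝ) • f x)) :=
    AEStronglyMeasurable.smul (by fun_prop : Continuous fun x : E4 => (1 + ‖x‖) ^ n).aestronglyMeasurable
      hn.aestronglyMeasurable
  refine h1.congr (ae_of_all _ fun x => ?_)
  simp only [smul_smul]
  rw [mul_inv_cancel₀ (by positivity), one_smul]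

lemma IsTemperedFun.congr {f g : E4 → ℂ} (hg : IsTemperedFun g) (h : f =ᵐ[volume] g) :
    IsTemperedFun f := by
  obtain ⟨n, hn⟩ := hg
  exact ⟨n, hn.congr (h.symm.mono fun x hx => by simp only [hx])⟩

lemma IsTemperedFun.succ {f : E4 → ℂ} {n m : ℕ} (hnm : n ≤ m)
    (hf : Integrable (fun x : E4 => (((1 + ‖x‖) ^ n)⁻¹ : ℝ) • f x)) :
    Integrable (fun x : E4 => (((1 + ‖x‖) ^ m)⁻¹ : ℝ) • f x) := by
  refine hf.mono (AEStronglyMeasurable.smul (continuous_inv_one_add_norm _).aestronglyMeasurable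
    (IsTemperedFun.aestronglyMeasurable ⟨n, hf⟩)) (ae_of_all _ fun x => ?_)
  rw [norm_smul, norm_smul]
  gcongr
  rw [Real.norm_of_nonneg (by positivity), Real.norm_of_nonneg (by positivity)]
  gcongr
  simp

lemma IsTemperedFun.add {f g : E4 → ℂ} (hf : IsTemperedFun f) (hg : IsTemperedFun g) :
    IsTemperedFun (f + g) := by
  obtain ⟨n, hn⟩ := hf
  obtain ⟨m, hm⟩ := hg
  refine ⟨max n m, ?_⟩
  have := (IsTemperedFun.succ (le_max_left n m) hn).add (IsTemperedFun.succ (le_max_right n m) hm)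
  refine this.congr (ae_of_all _ fun x => ?_)
  simp

lemma IsTemperedFun.const_mul {f : E4 → ℂ} (hf : IsTemperedFun f) (c : ℂ) :
    IsTemperedFun (fun x => c * f x) := by
  obtain ⟨n, hn⟩ := hf
  refine ⟨n, (hn.const_mul c).congr (ae_of_all _ fun x => ?_)⟩
  simp only [Complex.real_smul]
  ring

lemma isTemperedFun_of_bound {f : E4 → ℂ} (hf : AEStronglyMeasurable f) {C : ℝ} {n : ℕ}
    (h : ∀ x, ‖f x‖ ≤ C * (1 + ‖x‖) ^ n) : IsTemperedFun f := by
  refine ⟨n + 5, ((integrable_inv_one_add_norm (n := 5) (by norm_num)).const_mul C).mono'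
    (AEStronglyMeasurable.smul (continuous_inv_one_add_norm _).aestronglyMeasurable hf) (ae_of_all _ fun x => ?_)⟩
  rw [norm_smul, Real.norm_of_nonneg (by positivity), pow_add, mul_inv]
  calc _ ≤ (((1 + ‖x‖) ^ n)⁻¹ * ((1 + ‖x‖) ^ 5)⁻¹) * (C * (1 + ‖x‖) ^ n) := by gcongr; exact h x
    _ = _ := by field_simp

/-- Justifies Fubini when a convolution is paired with a test function. The decay of `K` absorbs the
weight of `f` at the price of growth in the outer variable, which `ψ` absorbs with five powers to
spare, enough for integrability in dimension four. -/
lemma IsTemperedFun.integrable_schwartz_prod {f : E4 → ℂ} (hf : IsTemperedFun f)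
    (K ψ : 𝓢(E4, ℂ)) :
    Integrable (fun z : E4 × E4 => K (z.1 - z.2) * f z.2 * ψ z.1) (volume.prod volume) := by
  have hm := hf.aestronglyMeasurable
  obtain ⟨n, hn⟩ := hf
  obtain ⟨C, hC, h⟩ := exists_schwartz_sub_decay K n
  obtain ⟨D, hD, h'⟩ := exists_schwartz_decay ψ (n + 5)
  refine ((((integrable_inv_one_add_norm (n := 5) (by norm_num)).const_mul (C * D)).mul_prod
    hn.norm).mono' ?_ (ae_of_all _ fun z => ?_))
  · refine AEStronglyMeasurable.mul (AEStronglyMeasurable.mul ?_ ?_) ?_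
    · exact (K.continuous.comp (continuous_fst.sub continuous_snd)).aestronglyMeasurable
    · exact hm.comp_snd
    · exact (ψ.continuous.comp continuous_fst).aestronglyMeasurable
  · simp only [norm_mul, norm_smul]
    rw [Real.norm_of_nonneg (show 0 ≤ ((1 + ‖z.2‖) ^ n)⁻¹ by positivity)]
    calc _ ≤ (C * (1 + ‖z.1‖) ^ n * ((1 + ‖z.2‖) ^ n)⁻¹) * ‖f z.2‖ *
          (D * ((1 + ‖z.1‖) ^ (n + 5))⁻¹) := by
          gcongr
          · exact h _ _
          · exact h' _
      _ = _ := by rw [pow_add]; field_simp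

lemma IsTemperedFun.integrable_conv {f : E4 → ℂ} (hf : IsTemperedFun f) (K : 𝓢(E4, ℂ)) (x : E4) :
    Integrable fun y => K (x - y) * f y := by
  have hm := hf.aestronglyMeasurable
  obtain ⟨n, hn⟩ := hf
  obtain ⟨C, hC, h⟩ := exists_schwartz_sub_decay K n
  refine (hn.norm.const_mul (C * (1 + ‖x‖) ^ n)).mono' (AEStronglyMeasurable.mul
    (K.continuous.comp (continuous_const.sub continuous_id)).aestronglyMeasurable hm)
    (ae_of_all _ fun y => ?_)
  rw [norm_mul, norm_smul, Real.norm_of_nonneg (by positivity), ← mul_assoc]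
  gcongr
  exact h x y

lemma IsTemperedFun.exists_conv_bound {f : E4 → ℂ} (hf : IsTemperedFun f) (K : 𝓢(E4, ℂ)) :
    ∃ (C : ℝ) (n : ℕ), ∀ x, ‖conv K f x‖ ≤ C * (1 + ‖x‖) ^ n := by
  obtain ⟨n, hn⟩ := hf
  obtain ⟨C, hC, h⟩ := exists_schwartz_sub_decay K n
  refine ⟨C * ∫ y, ‖(((1 + ‖y‖) ^ n)⁻¹ : ℝ) • f y‖, n, fun x => ?_⟩
  have := norm_integral_le_of_norm_le (f := fun y => K (x - y) * f y)
    (hn.norm.const_mul (C * (1 + ‖x‖) ^ n)) (ae_of_all _ fun y => ?_)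
  · rw [integral_const_mul] at this
    refine this.trans_eq (by ring)
  · rw [norm_mul, norm_smul, Real.norm_of_nonneg (show 0 ≤ ((1 + ‖y‖) ^ n)⁻¹ by positivity),
      ← mul_assoc]
    gcongr
    exact h x y

lemma aestronglyMeasurable_conv {f : E4 → ℂ} (hf : AEStronglyMeasurable f) (K : 𝓢(E4, ℂ)) :
    AEStronglyMeasurable (conv K f) := by
  refine AEStronglyMeasurable.integral_prod_right' (f := fun z : E4 × E4 => K (z.1 - z.2) * f z.2)
    (μ := volume) (ν := volume) (AEStronglyMeasurable.mul
      (K.continuous.comp (continuous_fst.sub continuous_snd)).aestronglyMeasurable hf.comp_snd)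

lemma IsTemperedFun.conv {f : E4 → ℂ} (hf : IsTemperedFun f) (K : 𝓢(E4, ℂ)) :
    IsTemperedFun (conv K f) := by
  obtain ⟨C, n, h⟩ := hf.exists_conv_bound K
  exact isTemperedFun_of_bound (aestronglyMeasurable_conv hf.aestronglyMeasurable K) h

lemma conv_congr_ae {f g : E4 → ℂ} (h : f =ᵐ[volume] g) (K : 𝓢(E4, ℂ)) : conv K f = conv K g := by
  funext x
  exact integral_congr_ae (h.mono fun y hy => by simp only [hy])

lemma conv_add {f g : E4 → ℂ} (hf : IsTemperedFun f) (hg : IsTemperedFun g) (K : 𝓢(E4, ℂ)) :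
    conv K (f + g) = conv K f + conv K g := by
  funext x
  simp only [conv, Pi.add_apply, mul_add]
  exact integral_add (hf.integrable_conv K x) (hg.integrable_conv K x)

lemma conv_const_mul (c : ℂ) (f : E4 → ℂ) (K : 𝓢(E4, ℂ)) :
    conv K (fun x => c * f x) = fun x => c * conv K f x := by
  funext x
  simp only [conv, ← integral_const_mul]
  congr 1; funext y; ring

lemma conv_sub_left {f : E4 → ℂ} (hf : IsTemperedFun f) (K L : 𝓢(E4, ℂ)) :
    conv (K - L) f = conv K f - conv L f := by
  funext x
  simp only [conv, Pi.sub_apply, sub_apply, sub_mul]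
  exact integral_sub (hf.integrable_conv K x) (hf.integrable_conv L x)

lemma integral_conv_mul {f : E4 → ℂ} (hf : IsTemperedFun f) (K ψ : 𝓢(E4, ℂ)) :
    ∫ x, conv K f x * ψ x = ∫ y, f y * ∫ x, K (x - y) * ψ x := by
  simp only [conv, ← integral_mul_const, ← integral_const_mul]
  rw [integral_integral_swap (hf.integrable_schwartz_prod K ψ)]
  congr 1; funext y; congr 1; funext x; ring

lemma stronglyMeasurable_conv {f : ℝ → E4 → ℂ} (hf : StronglyMeasurable (Function.uncurry f))
    (K : 𝓢(E4, ℂ)) : StronglyMeasurable (Function.uncurry fun t => conv K (f t)) := by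
  refine StronglyMeasurable.integral_prod_right'
    (f := fun z : (ℝ × E4) × E4 => K (z.1.2 - z.2) * f z.1.1 z.2) (ν := volume) ?_
  refine StronglyMeasurable.mul ?_ ?_
  · exact (K.continuous.comp (by fun_prop)).stronglyMeasurable
  · exact hf.comp_measurable (by fun_prop : Measurable fun z : (ℝ × E4) × E4 => (z.1.1, z.2))

/-! ### Radial symbols -/

/-- Radial functions. -/
def IsRadial {β : Type*} (g : E4 → β) : Prop := ∀ x y, ‖x‖ = ‖y‖ → g x = g y

/-- Two points of equal norm are exchanged by the reflection in the hyperplane orthogonal to their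
difference, and the Fourier transform commutes with isometries. -/
lemma IsRadial.fourierInv {m : E4 → ℂ} (hm : IsRadial m) : IsRadial (𝓕⁻ m) := by
  intro x y hxy
  set U := Submodule.reflection (Submodule.span ℝ {x - y})ᗮ with hU
  have h1 : U x = y := Submodule.reflection_sub hxy
  have h2 : m ∘ U = m := funext fun ξ => hm _ _ (U.norm_map ξ)
  rw [← h1, ← Real.fourierInv_comp_linearIsometry, h2]

lemma IsRadial.fourier_eq {m : 𝓢(E4, ℂ)} (hm : IsRadial m) : 𝓕⁻ m = 𝓕 m := by
  have h : (m : E4 → ℂ) ∘ (LinearIsometryEquiv.neg ℝ (E := E4)) = m :=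
    funext fun ξ => hm _ _ (by simp)
  ext x
  rw [SchwartzMap.fourierInv_coe, SchwartzMap.fourier_coe, Real.fourierInv_eq_fourier_neg]
  conv_rhs => rw [← h]
  rw [Real.fourier_comp_linearIsometry]
  rfl

lemma IsRadial.fourierInv_fourierInv {m : 𝓢(E4, ℂ)} (hm : IsRadial m) : 𝓕⁻ (𝓕⁻ m) = m := by
  rw [hm.fourier_eq]; simp

lemma IsRadial.conj_fourierInv {m : 𝓢(E4, ℂ)} (hm : IsRadial m)
    (hr : ∀ ξ, (starRingEnd ℂ) (m ξ) = m ξ) (x : E4) :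
    (starRingEnd ℂ) ((𝓕⁻ m) x) = (𝓕⁻ m) x := by
  conv_rhs => rw [hm.fourier_eq]
  rw [SchwartzMap.fourierInv_coe, SchwartzMap.fourier_coe, Real.fourierInv_eq, Real.fourier_eq,
    ← integral_conj]
  congr 1; funext ξ
  rw [Circle.smul_def, Circle.smul_def, smul_eq_mul, smul_eq_mul, map_mul, hr]
  congr 1
  rw [← Circle.coe_inv_eq_conj, ← AddChar.map_neg_eq_inv]

/-! ### Spectra -/

lemma fourierInv_comp_sub (ψ : 𝓢(E4, ℂ)) (y ξ : E4) :
    𝓕⁻ (SchwartzMap.compSubConstCLM ℂ y ψ) ξ = Real.fourierChar (inner ℝ y ξ) • 𝓕⁻ ψ ξ := by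
  rw [SchwartzMap.fourierInv_coe, SchwartzMap.fourierInv_coe, Real.fourierInv_eq,
    Real.fourierInv_eq, Circle.smul_def, ← integral_smul]
  conv_rhs => rw [← integral_sub_right_eq_self _ y]
  congr 1; funext x
  rw [SchwartzMap.compSubConstCLM_apply, Circle.smul_def, Circle.smul_def, smul_smul,
    ← Circle.coe_mul, ← AddChar.map_add_eq_mul]
  congr 3
  rw [← inner_add_left, add_sub_cancel]

/-- Move the translation onto `ψ`, where it becomes a modulation after inverse Fourier transform,
and exchange the transform between the two factors. -/
lemma integral_fourierInv_sub_mul_eq_zero {m ψ : 𝓢(E4, ℂ)} (h : ∀ ξ, m ξ * 𝓕⁻ ψ ξ = 0) (y : E4) :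
    ∫ x, 𝓕⁻ m (x - y) * ψ x = 0 := by
  rw [← integral_add_right_eq_self _ y]
  have h1 : ∀ x, 𝓕⁻ m (x + y - y) * ψ (x + y) =
      𝓕⁻ m x * SchwartzMap.compSubConstCLM ℂ (-y) ψ x := fun x => by
    simp [SchwartzMap.compSubConstCLM_apply]
  simp_rw [h1]
  rw [SchwartzMap.integral_fourierInv_mul_eq]
  refine integral_eq_zero_of_ae (ae_of_all _ fun ξ => ?_)
  simp only [fourierInv_comp_sub, Circle.smul_def, smul_eq_mul, Pi.zero_apply]
  rw [mul_left_comm, h, mul_zero]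

lemma integral_fourierInv_sub_mul_fourierInv {l m : 𝓢(E4, ℂ)} (h : ∀ ξ, l ξ * m ξ = m ξ) (z : E4) :
    ∫ x, 𝓕⁻ l x * 𝓕⁻ m (z - x) = 𝓕⁻ m z := by
  have h1 : SchwartzMap.convolution (ContinuousLinearMap.mul ℂ ℂ) (𝓕⁻ l) (𝓕⁻ m) = 𝓕⁻ m := by
    rw [SchwartzMap.convolution]
    ext x
    simp only [LinearMap.coe_mk, AddHom.coe_mk, ContinuousLinearMap.comp_apply]
    congr 1
    have : SchwartzMap.pairing (ContinuousLinearMap.mul ℂ ℂ) (𝓕 (𝓕⁻ l)) (𝓕 (𝓕⁻ m)) = m := by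
      ext ξ
      rw [SchwartzMap.pairing_apply_apply]
      simp [h]
    exact congrArg _ this
  have h2 := SchwartzMap.convolution_apply (ContinuousLinearMap.mul ℂ ℂ) (𝓕⁻ l) (𝓕⁻ m) z
  rw [h1] at h2
  exact h2.symm

/-- Associativity of convolution: the outer kernel, reflected and translated to `z`, is a test
function to which the duality formula `integral_conv_mul` applies. What remains is an identity
between Schwartz kernels. -/
lemma conv_conv {l m : 𝓢(E4, ℂ)} (h : ∀ ξ, l ξ * m ξ = m ξ) {f : E4 → ℂ} (hf : IsTemperedFun f) :
    conv (𝓕⁻ l) (conv (𝓕⁻ m) f) = conv (𝓕⁻ m) f := by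
  funext z
  set ψ : 𝓢(E4, ℂ) := SchwartzMap.compCLMOfContinuousLinearEquiv ℂ
    (LinearIsometryEquiv.neg ℝ (E := E4)).toContinuousLinearEquiv
    (SchwartzMap.compSubConstCLM ℂ (-z) (𝓕⁻ l)) with hψ
  have hψ' : ∀ x, ψ x = 𝓕⁻ l (z - x) := fun x => by
    simp [hψ, SchwartzMap.compSubConstCLM_apply]
    congr 1; abel
  have h1 : conv (𝓕⁻ l) (conv (𝓕⁻ m) f) z = ∫ x, conv (𝓕⁻ m) f x * ψ x := by
    rw [conv]; congr 1; funext x; rw [hψ', mul_comm]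
  rw [h1, integral_conv_mul hf]
  rw [conv]
  congr 1; funext y
  rw [mul_comm]
  congr 1
  rw [← integral_fourierInv_sub_mul_fourierInv h (z - y), ← integral_sub_left_eq_self _ _ z]
  congr 1; funext x
  rw [hψ', mul_comm]
  congr 2 <;> abel

/-- The Fourier transform of the bounded function `g` is supported in the ball of radius `R`. -/
def SpectrumInBall (R : ℝ) (g : E4 → ℂ) : Prop :=
  ∀ ψ : 𝓢(E4, ℂ), (∀ ξ, ‖ξ‖ ≤ R → 𝓕⁻ ψ ξ = 0) → ∫ x, g x * ψ x = 0

lemma spectrumInBall_one : SpectrumInBall 0 fun _ => 1 := by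
  intro ψ hψ
  have := hψ 0 (by simp)
  rw [SchwartzMap.fourierInv_coe, Real.fourierInv_eq] at this
  simpa using this

lemma fourierInv_mul_eq_integral (ψ χ : 𝓢(E4, ℂ)) (ξ : E4) :
    𝓕⁻ (SchwartzMap.pairing (ContinuousLinearMap.mul ℂ ℂ) χ ψ) ξ =
      ∫ η, 𝓕⁻ χ η * 𝓕⁻ ψ (ξ - η) := by
  have h1 : 𝓕⁻ (SchwartzMap.pairing (ContinuousLinearMap.mul ℂ ℂ) χ ψ) =
      SchwartzMap.convolution (ContinuousLinearMap.mul ℂ ℂ) (𝓕⁻ χ) (𝓕⁻ ψ) := by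
    rw [SchwartzMap.convolution]
    ext x
    simp
  rw [h1, SchwartzMap.convolution_apply]
  rfl

/-- Radii of spectra add under multiplication. The second factor is a superposition of translates of
a band-limited Schwartz kernel, so it suffices to multiply by one translate, and that can be shifted
to the test function. -/
lemma SpectrumInBall.mul_conv {R ρ A B : ℝ} {g f : E4 → ℂ} (hg : SpectrumInBall R g) {m : 𝓢(E4, ℂ)}
    (hm : IsRadial m) (hρ : ∀ ξ, ρ < ‖ξ‖ → m ξ = 0) (hgm : AEStronglyMeasurable g)
    (hgA : ∀ x, ‖g x‖ ≤ A) (hfm : AEStronglyMeasurable f) (hfB : ∀ x, ‖f x‖ ≤ B) :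
    SpectrumInBall (R + ρ) fun x => g x * conv (𝓕⁻ m) f x := by
  intro ψ hψ
  set K := 𝓕⁻ m with hK
  have hint : Integrable (fun z : E4 × E4 => g z.1 * (K (z.1 - z.2) * f z.2) * ψ z.1)
      (volume.prod volume) := by
    have h0 : Integrable (fun z : E4 × E4 => K (z.1 - z.2) * ψ z.1) (volume.prod volume) := by
      have := (isTemperedFun_of_bound (f := fun _ => (1 : ℂ)) (C := 1) (n := 0)
        aestronglyMeasurable_const (by simp)).integrable_schwartz_prod K ψ
      simpa using this
    refine (h0.norm.const_mul (A * B)).mono' ?_ (ae_of_all _ fun z => ?_)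
    · refine AEStronglyMeasurable.mul (hgm.comp_fst.mul (AEStronglyMeasurable.mul ?_ hfm.comp_snd)) ?_
      · exact (K.continuous.comp (continuous_fst.sub continuous_snd)).aestronglyMeasurable
      · exact (ψ.continuous.comp continuous_fst).aestronglyMeasurable
    · simp only [norm_mul]
      have hA : 0 ≤ A := (norm_nonneg _).trans (hgA 0)
      calc _ ≤ A * (‖K (z.1 - z.2)‖ * B) * ‖ψ z.1‖ := by
            gcongr
            · exact hgA _
            · exact hfB _
        _ = _ := by ring
  have h1 : ∀ x, g x * conv K f x * ψ x = ∫ y, g x * (K (x - y) * f y) * ψ x := fun x => by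
    rw [integral_mul_const, integral_const_mul]; rfl
  simp_rw [h1]
  rw [integral_integral_swap hint]
  refine integral_eq_zero_of_ae (ae_of_all _ fun y => ?_)
  set χ := SchwartzMap.pairing (ContinuousLinearMap.mul ℂ ℂ) (SchwartzMap.compSubConstCLM ℂ y K) ψ
    with hχ
  have h2 : ∀ x, g x * (K (x - y) * f y) * ψ x = f y * (g x * χ x) := fun x => by
    rw [hχ, SchwartzMap.pairing_apply_apply, SchwartzMap.compSubConstCLM_apply]
    simp only [ContinuousLinearMap.mul_apply']
    ring
  simp_rw [h2, integral_const_mul]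
  rw [hg χ, mul_zero, Pi.zero_apply]
  intro ξ hξ
  rw [hχ, fourierInv_mul_eq_integral]
  refine integral_eq_zero_of_ae (ae_of_all _ fun η => ?_)
  simp only [Pi.zero_apply]
  by_cases hη : ‖η‖ ≤ ρ
  · rw [hψ (ξ - η) ((norm_sub_le _ _).trans (add_le_add hξ hη)), mul_zero]
  · rw [fourierInv_comp_sub, hK, hm.fourierInv_fourierInv, hρ η (not_le.1 hη)]
    simp

/-- The value of the convolution at `x` is the pairing of `g` with the translated kernel, which is
radial; its inverse transform is a modulation of `m`. -/
lemma SpectrumInBall.conv_eq_zero {R : ℝ} {g : E4 → ℂ} (hg : SpectrumInBall R g) {m : 𝓢(E4, ℂ)}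
    (hm : IsRadial m) (hR : ∀ ξ, ‖ξ‖ ≤ R → m ξ = 0) : conv (𝓕⁻ m) g = 0 := by
  funext x
  have hK : IsRadial (𝓕⁻ m : 𝓢(E4, ℂ)) := by
    rw [SchwartzMap.fourierInv_coe]; exact hm.fourierInv
  have := hg (SchwartzMap.compSubConstCLM ℂ x (𝓕⁻ m)) fun ξ hξ => by
    rw [fourierInv_comp_sub, hm.fourierInv_fourierInv, hR ξ hξ, smul_zero]
  rw [conv, Pi.zero_apply, ← this]
  congr 1; funext y
  rw [SchwartzMap.compSubConstCLM_apply, mul_comm, hK (x - y) (y - x) (norm_sub_rev x y)]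

end

section


/-! ### The Littlewood-Paley kernels -/

lemma dyad_pos (k : ℤ) : 0 < dyad k := by unfold dyad; positivity

lemma dyad_add (k l : ℤ) : dyad (k + l) = dyad k * dyad l := zpow_add₀ two_ne_zero k l

lemma dyad_sub_one (k : ℤ) : dyad (k - 1) = dyad k / 2 := by
  rw [sub_eq_add_neg, dyad_add]; simp [dyad, div_eq_mul_inv]

lemma dyad_add_one (k : ℤ) : dyad (k + 1) = 2 * dyad k := by
  rw [dyad_add]; simp [dyad, mul_comm]

lemma dyad_mono {k l : ℤ} (h : k ≤ l) : dyad k ≤ dyad l :=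
  zpow_le_zpow_right₀ one_le_two h

lemma dyad_eq_rpow (k : ℤ) : dyad k = (2 : ℝ) ^ (k : ℝ) := (Real.rpow_intCast 2 k).symm

lemma tendsto_dyad_atTop : Tendsto dyad atTop atTop := by
  simp_rw [funext dyad_eq_rpow]
  exact (tendsto_rpow_atTop_of_base_gt_one 2 one_lt_two).comp tendsto_intCast_atTop_atTop

lemma dyad_zero : dyad 0 = 1 := by simp [dyad]

lemma lpSymbol_eq (η : ℝ → ℝ) (k : ℤ) (ξ : E4) :
    lpSymbol η k ξ = lpSymbolLow η k ξ - lpSymbolLow η (k - 1) ξ := by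
  simp only [lpSymbol, lpSymbolLow, dyad_sub_one]
  congr 2
  field_simp

lemma contDiff_lpSymbolLow {η : ℝ → ℝ} (hη : IsLPCutoff η) (k : ℤ) :
    ContDiff ℝ ∞ fun ξ : E4 => lpSymbolLow η k ξ := by
  have hN := dyad_pos k
  rw [contDiff_iff_contDiffAt]
  intro ξ
  rcases eq_or_ne ξ 0 with rfl | hξ
  · have h1 : ∀ᶠ ξ : E4 in 𝓝 0, ‖ξ‖ < dyad k := by
      filter_upwards [Metric.ball_mem_nhds (0 : E4) hN] with ξ h using by simpa using h
    refine ContDiffAt.congr_of_eventuallyEq (f := fun _ => (1 : ℝ)) contDiffAt_const ?_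
    filter_upwards [h1] with ξ h
    refine hη.eq_one _ ?_
    rw [abs_of_nonneg (by positivity), div_le_iff₀ hN]
    nlinarith
  · refine hη.smooth.contDiffAt.comp ξ ?_
    exact (contDiffAt_norm ℝ hξ).div_const _

lemma lpSymbolLow_eq_zero {η : ℝ → ℝ} (hη : IsLPCutoff η) {k : ℤ} {ξ : E4}
    (h : 8 / 5 * dyad k ≤ ‖ξ‖) : lpSymbolLow η k ξ = 0 := by
  have hN := dyad_pos k
  refine hη.eq_zero _ ?_
  rw [abs_of_nonneg (by positivity), le_div_iff₀ hN]
  exact h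

lemma lpSymbolLow_eq_one {η : ℝ → ℝ} (hη : IsLPCutoff η) {k : ℤ} {ξ : E4}
    (h : ‖ξ‖ ≤ 5 / 4 * dyad k) : lpSymbolLow η k ξ = 1 := by
  have hN := dyad_pos k
  refine hη.eq_one _ ?_
  rw [abs_of_nonneg (by positivity), div_le_iff₀ hN]
  exact h

lemma norm_two_pi_smul (ξ : E4) : ‖(2 * Real.pi) • ξ‖ = 2 * Real.pi * ‖ξ‖ := by
  rw [norm_smul, Real.norm_of_nonneg (by positivity)]

variable {η : ℝ → ℝ} (hη : IsLPCutoff η)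

/-- The symbol of `P_{≤N}` in Mathlib's frequency variable. -/
def lowSym (k : ℤ) : 𝓢(E4, ℂ) :=
  HasCompactSupport.toSchwartzMap
    (f := fun ξ : E4 => ((lpSymbolLow η k ((2 * Real.pi) • ξ) : ℝ) : ℂ))
    (by
      have hpi := Real.pi_gt_three
      refine HasCompactSupport.intro (isCompact_closedBall (0 : E4) (8 / 5 * dyad k)) fun ξ h => ?_
      rw [mem_closedBall_zero_iff, not_le] at h
      have hN := dyad_pos k
      rw [lpSymbolLow_eq_zero hη, Complex.ofReal_zero]
      rw [norm_two_pi_smul]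
      nlinarith [norm_nonneg ξ])
    (Complex.ofRealCLM.contDiff.comp ((contDiff_lpSymbolLow hη k).comp (contDiff_const_smul _)))

lemma lowSym_apply (k : ℤ) (ξ : E4) :
    lowSym hη k ξ = ((lpSymbolLow η k ((2 * Real.pi) • ξ) : ℝ) : ℂ) := rfl

/-- The symbol of `P_N` in Mathlib's frequency variable. -/
def lpSym (k : ℤ) : 𝓢(E4, ℂ) := lowSym hη k - lowSym hη (k - 1)

lemma lpSym_apply (k : ℤ) (ξ : E4) :
    lpSym hη k ξ = ((lpSymbol η k ((2 * Real.pi) • ξ) : ℝ) : ℂ) := by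
  rw [lpSym, sub_apply, lowSym_apply, lowSym_apply, lpSymbol_eq, Complex.ofReal_sub]

/-- The kernel of `P_{≤N}`. -/
def lowKer (k : ℤ) : 𝓢(E4, ℂ) := 𝓕⁻ (lowSym hη k)

/-- The kernel of `P_N`. -/
def lpKer (k : ℤ) : 𝓢(E4, ℂ) := 𝓕⁻ (lpSym hη k)

lemma lpProjLow_eq (k : ℤ) (f : E4 → ℂ) : lpProjLow η k f = conv (lowKer hη k) f :=
  multiplier_eq_conv (lowSym_apply hη k) f

lemma lpProj_eq (k : ℤ) (f : E4 → ℂ) : lpProj η k f = conv (lpKer hη k) f :=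
  multiplier_eq_conv (lpSym_apply hη k) f

lemma lpKer_eq (k : ℤ) : lpKer hη k = lowKer hη k - lowKer hη (k - 1) := by
  simp only [lpKer, lowKer, lpSym]
  exact (FourierTransform.fourierInvCLM ℂ 𝓢(E4, ℂ)).map_sub _ _

lemma isRadial_lowSym (k : ℤ) : IsRadial (lowSym hη k) := fun x y h => by
  simp only [lowSym_apply, lpSymbolLow, norm_two_pi_smul, h]

lemma isRadial_lpSym (k : ℤ) : IsRadial (lpSym hη k) := fun x y h => by
  simp only [lpSym_apply, lpSymbol, norm_two_pi_smul, h]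

lemma isRadial_lpKer (k : ℤ) : IsRadial (lpKer hη k) := by
  rw [lpKer, SchwartzMap.fourierInv_coe]
  exact (isRadial_lpSym hη k).fourierInv

lemma conj_lowKer (k : ℤ) (x : E4) : (starRingEnd ℂ) (lowKer hη k x) = lowKer hη k x :=
  (isRadial_lowSym hη k).conj_fourierInv (fun ξ => by rw [lowSym_apply, Complex.conj_ofReal]) x

lemma conv_lowKer_conj (k : ℤ) (f : E4 → ℂ) :
    conv (lowKer hη k) (fun x => (starRingEnd ℂ) (f x)) =
      fun x => (starRingEnd ℂ) (conv (lowKer hη k) f x) := by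
  funext x
  simp only [conv]
  rw [← integral_conj]
  congr 1; funext y
  rw [map_mul, conj_lowKer]

lemma lpSym_eq_zero_of_le {k : ℤ} {ξ : E4} (h : ‖(2 * Real.pi) • ξ‖ ≤ 5 / 8 * dyad k) :
    lpSym hη k ξ = 0 := by
  have hN := dyad_pos k
  rw [lpSym_apply, lpSymbol_eq, lpSymbolLow_eq_one hη, lpSymbolLow_eq_one hη]
  · simp
  · rw [dyad_sub_one]; linarith
  · linarith

lemma lpSym_eq_zero_of_ge {k : ℤ} {ξ : E4} (h : 8 / 5 * dyad k ≤ ‖(2 * Real.pi) • ξ‖) :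
    lpSym hη k ξ = 0 := by
  have hN := dyad_pos k
  rw [lpSym_apply, lpSymbol_eq, lpSymbolLow_eq_zero hη, lpSymbolLow_eq_zero hη]
  · simp
  · rw [dyad_sub_one]; linarith
  · linarith

lemma lowSym_mul_lpSym {j k : ℤ} (h : k < j) (ξ : E4) :
    lowSym hη j ξ * lpSym hη k ξ = lpSym hη k ξ := by
  rcases le_total (8 / 5 * dyad k) ‖(2 * Real.pi) • ξ‖ with h1 | h1
  · rw [lpSym_eq_zero_of_ge hη h1, mul_zero]
  · have h2 := dyad_mono (show k + 1 ≤ j by omega)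
    rw [dyad_add_one] at h2
    rw [lowSym_apply, lpSymbolLow_eq_one hη (by linarith [dyad_pos k])]
    simp

lemma conv_lowKer_lpKer {j k : ℤ} (h : k < j) {f : E4 → ℂ} (hf : IsTemperedFun f) :
    conv (lowKer hη j) (conv (lpKer hη k) f) = conv (lpKer hη k) f :=
  conv_conv (lowSym_mul_lpSym hη h) hf

/-- The distributional support lies in the closed shell from 5/8 to 8/5 times 2^k outside of which
the symbol vanishes, and this shell sits inside the required open annulus. -/
lemma hasFrequency_conv (k : ℤ) {f : E4 → ℂ} (hf : IsTemperedFun f) :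
    HasFrequency k (conv (lpKer hη k) f) := by
  have hN := dyad_pos k
  refine ⟨hf.conv _, ?_⟩
  have hcont : Continuous fun ξ : E4 => ‖(2 * Real.pi) • ξ‖ := by fun_prop
  set S : Set E4 := {ξ | 5 / 8 * dyad k ≤ ‖(2 * Real.pi) • ξ‖ ∧
    ‖(2 * Real.pi) • ξ‖ ≤ 8 / 5 * dyad k} with hS
  have hclosed : IsClosed S :=
    (isClosed_le continuous_const hcont).inter (isClosed_le hcont continuous_const)
  intro ξ hξ
  have : ξ ∈ S := by
    refine (Distribution.mem_dsupport_iff ξ).1 hξ S ?_ hclosed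
    intro φ hφ
    rw [fourierDist, integral_conv_mul hf]
    refine integral_eq_zero_of_ae (ae_of_all _ fun y => ?_)
    simp only [Pi.zero_apply]
    rw [lpKer, integral_fourierInv_sub_mul_eq_zero, mul_zero]
    intro ζ
    rw [FourierTransform.fourierInv_fourier_eq]
    by_cases hζ : ζ ∈ S
    · have : φ ζ = 0 := by
        by_contra h0
        exact hφ (subset_tsupport _ h0) hζ
      rw [this, mul_zero]
    · rw [hS, mem_ofPred_eq, not_and_or, not_le, not_le] at hζ
      rcases hζ with hζ | hζ
      · rw [lpSym_eq_zero_of_le hη hζ.le, zero_mul]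
      · rw [lpSym_eq_zero_of_ge hη hζ.le, zero_mul]
  exact ⟨by linarith [this.1], by linarith [this.2]⟩

lemma lowSym_scale (k : ℤ) (ξ : E4) : lowSym hη k ξ = lowSym hη 0 ((dyad k)⁻¹ • ξ) := by
  have hN := dyad_pos k
  simp only [lowSym_apply, lpSymbolLow, dyad_zero, div_one, norm_smul, norm_inv,
    Real.norm_of_nonneg hN.le]
  congr 2
  field_simp

lemma lowKer_scale (k : ℤ) (x : E4) :
    lowKer hη k x = ((dyad k ^ 4 : ℝ) : ℂ) * lowKer hη 0 (dyad k • x) := by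
  have hN := dyad_pos k
  simp only [lowKer, SchwartzMap.fourierInv_coe, Real.fourierInv_eq, lowSym_scale hη k]
  have h := Measure.integral_comp_smul (volume : Measure E4)
    (fun v : E4 => Real.fourierChar (inner ℝ v (dyad k • x)) • lowSym hη 0 v) (dyad k)⁻¹
  rw [finrank_euclideanSpace_fin] at h
  have h2 : ∀ v : E4, Real.fourierChar (inner ℝ ((dyad k)⁻¹ • v) (dyad k • x)) •
      lowSym hη 0 ((dyad k)⁻¹ • v) =
      Real.fourierChar (inner ℝ v x) • lowSym hη 0 ((dyad k)⁻¹ • v) := fun v => by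
    rw [real_inner_smul_left, real_inner_smul_right]
    congr 3
    field_simp
  simp_rw [h2] at h
  rw [h, inv_pow, inv_inv, abs_of_nonneg (by positivity), Complex.real_smul]

lemma integral_lowKer_zero : ∫ x, lowKer hη 0 x = 1 := by
  have h1 : 𝓕 (lowKer hη 0) 0 = 1 := by
    rw [lowKer, FourierTransform.fourier_fourierInv_eq, lowSym_apply, lpSymbolLow_eq_one hη]
    · simp
    · simp only [smul_zero, norm_zero, dyad_zero]; norm_num
  rw [SchwartzMap.fourier_coe, Real.fourier_eq] at h1
  simpa using h1

/-- Rescaling fixes the kernel and moves the dependence on `k` into the test function, the form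
suited to dominated convergence. -/
lemma integral_lowKer_sub_mul (k : ℤ) (φ : 𝓢(E4, ℂ)) (y : E4) :
    ∫ x, lowKer hη k (x - y) * φ x = ∫ z, lowKer hη 0 z * φ (y + (dyad k)⁻¹ • z) := by
  have hN := dyad_pos k
  have h := Measure.integral_comp_smul (volume : Measure E4)
    (fun z : E4 => lowKer hη 0 z * φ (y + (dyad k)⁻¹ • z)) (dyad k)
  rw [finrank_euclideanSpace_fin] at h
  rw [← integral_add_right_eq_self _ y]
  simp only [add_sub_cancel_right, lowKer_scale hη k, mul_assoc]
  rw [integral_const_mul]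
  simp_rw [smul_smul, inv_mul_cancel₀ hN.ne', one_smul, add_comm y] at h
  rw [h, Complex.real_smul, ← mul_assoc, ← Complex.ofReal_mul, abs_of_nonneg (by positivity),
    mul_inv_cancel₀ (by positivity)]
  simp [add_comm y]

lemma tendsto_integral_lowKer_sub_mul (φ : 𝓢(E4, ℂ)) (y : E4) :
    Tendsto (fun k : ℤ => ∫ x, lowKer hη k (x - y) * φ x) atTop (𝓝 (φ y)) := by
  simp_rw [integral_lowKer_sub_mul]
  obtain ⟨D, hD, h'⟩ := exists_schwartz_decay φ 0
  have hd : Tendsto (fun k : ℤ => (dyad k)⁻¹) atTop (𝓝 0) := by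
    refine tendsto_inv_atTop_zero.comp ?_
    exact tendsto_dyad_atTop
  have := tendsto_integral_filter_of_dominated_convergence (μ := (volume : Measure E4))
    (l := (atTop : Filter ℤ))
    (F := fun k z => lowKer hη 0 z * φ (y + (dyad k)⁻¹ • z)) (f := fun z => lowKer hη 0 z * φ y)
    (fun z => ‖lowKer hη 0 z‖ * D) ?_ ?_ ?_ ?_
  · rwa [integral_mul_const, integral_lowKer_zero, one_mul] at this
  · refine Eventually.of_forall fun k => Continuous.aestronglyMeasurable ?_
    exact (lowKer hη 0).continuous.mul (φ.continuous.comp (by fun_prop))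
  · refine Eventually.of_forall fun k => ae_of_all _ fun z => ?_
    rw [norm_mul]
    gcongr
    simpa using h' (y + (dyad k)⁻¹ • z)
  · exact (lowKer hη 0).integrable.norm.mul_const D
  · refine ae_of_all _ fun z => Tendsto.mul tendsto_const_nhds ?_
    refine (φ.continuous.tendsto y).comp ?_
    have : Tendsto (fun k : ℤ => y + (dyad k)⁻¹ • z) atTop (𝓝 (y + (0 : ℝ) • z)) :=
      tendsto_const_nhds.add (hd.smul_const z)
    simpa using this

/-- By duality the projection acts on `φ`, where it is an approximate identity. The mollified test
functions keep, uniformly in `k`, the decay that makes `f` integrable against them. -/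
lemma tendsto_integral_lowProj (hη : IsLPCutoff η) {f : E4 → ℂ} (hf : IsTemperedFun f) (φ : 𝓢(E4, ℂ)) :
    Tendsto (fun k : ℤ => ∫ x, lpProjLow η k f x * φ x) atTop (𝓝 (∫ x, f x * φ x)) := by
  simp_rw [lpProjLow_eq hη, integral_conv_mul hf]
  have hm := hf.aestronglyMeasurable
  obtain ⟨n, hn⟩ := hf
  obtain ⟨D, hD, h'⟩ := exists_schwartz_decay φ n
  set M := ∫ z, ‖lowKer hη 0 z‖ * (1 + ‖z‖) ^ n with hM
  have hint : Integrable fun z => ‖lowKer hη 0 z‖ * (1 + ‖z‖) ^ n := by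
    obtain ⟨E, hE, h''⟩ := exists_schwartz_decay (lowKer hη 0) (n + 5)
    refine ((integrable_inv_one_add_norm (n := 5) (by norm_num)).const_mul E).mono'
      (Continuous.aestronglyMeasurable (by fun_prop)) (ae_of_all _ fun z => ?_)
    rw [norm_mul, norm_norm, Real.norm_of_nonneg (by positivity)]
    calc _ ≤ E * ((1 + ‖z‖) ^ (n + 5))⁻¹ * (1 + ‖z‖) ^ n := by gcongr; exact h'' z
      _ = _ := by rw [pow_add]; field_simp
  refine tendsto_integral_filter_of_dominated_convergence
    (fun y => M * D * ‖(((1 + ‖y‖) ^ n)⁻¹ : ℝ) • f y‖) ?_ ?_ ?_ ?_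
  · refine Eventually.of_forall fun k => hm.mul ?_
    exact (AEStronglyMeasurable.integral_prod_right' (f := fun z : E4 × E4 =>
      lowKer hη k (z.2 - z.1) * φ z.2) (μ := volume) (ν := volume)
      (Continuous.aestronglyMeasurable (((lowKer hη k).continuous.comp (by fun_prop)).mul
        (φ.continuous.comp (by fun_prop)))))
  -- For `k ≥ 0` the dilation by `(dyad k)⁻¹` does not increase norms, which makes the dominating
  -- function independent of `k`.
  · filter_upwards [eventually_ge_atTop 0] with k hk
    refine ae_of_all _ fun y => ?_
    rw [integral_lowKer_sub_mul, norm_mul, norm_smul, Real.norm_of_nonneg (by positivity)]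
    have hk1 : (dyad k)⁻¹ ≤ 1 := inv_le_one_of_one_le₀ (by rw [← dyad_zero]; exact dyad_mono hk)
    have : ‖∫ z, lowKer hη 0 z * φ (y + (dyad k)⁻¹ • z)‖ ≤ M * (D * ((1 + ‖y‖) ^ n)⁻¹) := by
      rw [hM, ← integral_mul_const]
      refine norm_integral_le_of_norm_le (hint.mul_const _) (ae_of_all _ fun z => ?_)
      rw [norm_mul]
      have h2 := inv_one_add_norm_sub_le ((dyad k)⁻¹ • z) (-y) n
      have h3 : ‖(dyad k)⁻¹ • z‖ ≤ ‖z‖ := by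
        rw [norm_smul, norm_inv, Real.norm_of_nonneg (dyad_pos k).le]
        exact mul_le_of_le_one_left (norm_nonneg z) hk1
      rw [sub_neg_eq_add, norm_neg, add_comm _ y] at h2
      calc _ ≤ ‖lowKer hη 0 z‖ * (D * ((1 + ‖z‖) ^ n * ((1 + ‖y‖) ^ n)⁻¹)) := by
            gcongr
            refine (h' _).trans ?_
            gcongr
            refine h2.trans ?_
            gcongr
        _ = _ := by ring
    calc _ ≤ ‖f y‖ * (M * (D * ((1 + ‖y‖) ^ n)⁻¹)) := by gcongr
      _ = _ := by ring
  · exact hn.norm.const_mul _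
  · exact ae_of_all _ fun y => tendsto_const_nhds.mul (tendsto_integral_lowKer_sub_mul hη φ y)

/-! ### Bernstein's inequality -/

lemma lintegral_comp_dyad_smul (k : ℤ) {f : E4 → ℝ≥0∞} (hf : Measurable f) :
    ∫⁻ x, f (dyad k • x) = ENNReal.ofReal ((dyad k ^ 4)⁻¹) * ∫⁻ x, f x := by
  have hN := dyad_pos k
  have h := Measure.map_addHaar_smul (volume : Measure E4) hN.ne'
  rw [finrank_euclideanSpace_fin, abs_of_nonneg (by positivity)] at h
  rw [← lintegral_map hf (measurable_const_smul (dyad k)), h, lintegral_smul_measure, smul_eq_mul]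

lemma lnorm_lowKer {r : ℝ} (hr : 0 < r) (k : ℤ) :
    lnorm volume r (fun x => ‖lowKer hη k x‖ₑ) =
      ENNReal.ofReal (dyad k ^ (4 - 4 / r)) * lnorm volume r (fun x => ‖lowKer hη 0 x‖ₑ) := by
  have hN := dyad_pos k
  have h1 : ∀ x, ‖lowKer hη k x‖ₑ =
      ENNReal.ofReal (dyad k ^ 4) * ‖lowKer hη 0 (dyad k • x)‖ₑ := fun x => by
    rw [lowKer_scale, enorm_mul]
    congr 1
    rw [← ofReal_norm, Complex.norm_real, Real.norm_of_nonneg (by positivity)]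
  simp_rw [h1]
  rw [lnorm_const_mul hr (by simp)]
  have hm : Measurable fun x => ‖lowKer hη 0 x‖ₑ ^ r :=
    ((lowKer hη 0).continuous.enorm.measurable).pow_const r
  have h2 : lnorm volume r (fun x => ‖lowKer hη 0 (dyad k • x)‖ₑ) =
      ENNReal.ofReal ((dyad k ^ 4)⁻¹) ^ (1 / r) * lnorm volume r (fun x => ‖lowKer hη 0 x‖ₑ) := by
    unfold lnorm
    rw [lintegral_comp_dyad_smul k hm, ENNReal.mul_rpow_of_nonneg _ _ (by positivity)]
  rw [h2, ← mul_assoc, ENNReal.ofReal_rpow_of_pos (by positivity), ← ENNReal.ofReal_mul (by positivity)]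
  congr 2
  rw [← Real.rpow_natCast, ← Real.rpow_neg hN.le, ← Real.rpow_mul hN.le, ← Real.rpow_add hN]
  congr 1
  push_cast
  ring

lemma lnorm_schwartz_lt_top {r : ℝ} (hr : 0 < r) (K : 𝓢(E4, ℂ)) :
    lnorm volume r (fun x => ‖K x‖ₑ) < ⊤ := by
  rw [← eLpNorm_eq_lnorm hr]
  exact (K.memLp (ENNReal.ofReal r) volume).2

lemma enorm_conv_le {p p' : ℝ} (hp : 0 < p) (hp' : 0 < p') (h : 1 / p' + 1 / p = 1)
    (K : 𝓢(E4, ℂ)) {f : E4 → ℂ} {G : E4 → ℝ≥0∞} (hG : AEMeasurable G)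
    (hf : ∀ᵐ x, ‖f x‖ₑ ≤ G x) (x : E4) :
    ‖conv K f x‖ₑ ≤ lnorm volume p' (fun x => ‖K x‖ₑ) * lnorm volume p G := by
  have h1 : lnorm volume p' (fun y => ‖K (x - y)‖ₑ) = lnorm volume p' (fun x => ‖K x‖ₑ) := by
    unfold lnorm
    rw [lintegral_sub_left_eq_self (fun y => ‖K y‖ₑ ^ p')]
  rw [← h1]
  have hK : Continuous fun y => ‖K (x - y)‖ₑ :=
    continuous_enorm.comp (K.continuous.comp (continuous_const.sub continuous_id))
  refine le_trans ?_ (lnorm_mul_le one_pos hp' hp (by rw [h]; norm_num)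
    hK.measurable.aemeasurable hG)
  rw [lnorm_one]
  refine (enorm_integral_le_lintegral_enorm _).trans (lintegral_mono_ae ?_)
  filter_upwards [hf] with y hy
  rw [enorm_mul]
  gcongr

/-- The constant in Bernstein's inequality. -/
def bernsteinConst (p : ℝ) : ℝ≥0∞ :=
  ENNReal.ofReal (2 ^ (4 / p)) * lnorm volume (p / (p - 1)) (fun x => ‖lowKer hη 0 x‖ₑ)

lemma bernsteinConst_ne_top {p : ℝ} (hp : 1 < p) : bernsteinConst hη p ≠ ⊤ :=
  ENNReal.mul_ne_top (by simp)
    (lnorm_schwartz_lt_top (div_pos (by linarith) (by linarith)) _).ne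

/-- The function reproduces itself under convolution with the kernel at scale `k + 1`, so Hölder's
inequality and the scaling of the dual norm of that kernel give the bound. The factor 2^{4/p} in
`bernsteinConst` pays for `k + 1` instead of `k`. -/
lemma bernstein {p : ℝ} (hp : 1 < p) {k : ℤ} {f : E4 → ℂ} (hf : AEMeasurable f)
    (hk : conv (lowKer hη (k + 1)) f = f) (x : E4) :
    ‖f x‖ₑ ≤ bernsteinConst hη p * (ENNReal.ofReal (dyad k ^ (4 / p)) *
      lnorm volume p fun x => ‖f x‖ₑ) := by
  have hN := dyad_pos k
  have hp1 : 0 < p - 1 := by linarith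
  conv_lhs => rw [← hk]
  refine (enorm_conv_le (p := p) (p' := p / (p - 1)) (by linarith) (by positivity)
    (by field_simp; ring) _ hf.enorm (ae_of_all _ fun x => le_rfl) x).trans_eq ?_
  rw [lnorm_lowKer hη (by positivity), bernsteinConst, ← mul_assoc]
  congr 1
  rw [dyad_add_one, show 4 - 4 / (p / (p - 1)) = 4 / p by field_simp; ring,
    Real.mul_rpow two_pos.le hN.le, ENNReal.ofReal_mul (by positivity)]
  ring

end

section


/-! ### Polar coordinates -/

/-- The surface measure of the unit sphere. -/
abbrev sphMeas : Measure (Metric.sphere (0 : E4) 1) := (volume : Measure E4).toSphere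

/-- The radial measure `r³ dr`. -/
abbrev radMeas : Measure (Ioi (0 : ℝ)) := Measure.volumeIoiPow 3

lemma measurable_polar : Measurable fun z : Ioi (0 : ℝ) × Metric.sphere (0 : E4) 1 =>
    ((z.1 : ℝ) • (z.2 : E4)) := by fun_prop

lemma lintegral_polar {S : E4 → ℝ≥0∞} (hS : Measurable S) :
    ∫⁻ x, S x = ∫⁻ r, ∫⁻ θ, S ((r : ℝ) • (θ : E4)) ∂sphMeas ∂radMeas := by
  have h1 := (volume : Measure E4).measurePreserving_homeomorphUnitSphereProd
  rw [finrank_euclideanSpace_fin] at h1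
  have h2 : ∫⁻ x, S x = ∫⁻ x : ({0}ᶜ : Set E4), S x ∂(Measure.comap Subtype.val volume) := by
    rw [lintegral_subtype_comap (measurableSet_singleton _).compl, restrict_compl_singleton]
  have hG : Measurable fun z : Metric.sphere (0 : E4) 1 × Ioi (0 : ℝ) =>
      S ((z.2 : ℝ) • (z.1 : E4)) := hS.comp (measurable_polar.comp measurable_swap)
  rw [h2, lintegral_lintegral_swap (f := fun (r : Ioi (0 : ℝ)) (θ : Metric.sphere (0 : E4) 1) =>
      S ((r : ℝ) • (θ : E4))) (hS.comp measurable_polar).aemeasurable,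
    ← lintegral_prod _ hG.aemeasurable, ← h1.lintegral_comp hG]
  refine lintegral_congr fun x => ?_
  congr 1
  have hx : ‖(x : E4)‖ ≠ 0 := norm_ne_zero_iff.2 x.2
  simp [smul_smul, hx]

/-- The norm of `𝓛^p_r L^μ_θ` for functions with values in `[0, ∞]`. -/
def sn (p μ : ℝ) (S : E4 → ℝ≥0∞) : ℝ≥0∞ :=
  lnorm radMeas p fun r => lnorm sphMeas μ fun θ => S ((r : ℝ) • (θ : E4))

lemma sphNorm_eq_sn {p μ : ℝ} (hp : 0 < p) (hμ : 0 < μ) (f : E4 → ℂ) :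
    sphNorm (ENNReal.ofReal p) (ENNReal.ofReal μ) f = sn p μ fun x => ‖f x‖ₑ := by
  rw [sphNorm, eLpNorm_eq_lnorm hp, sn]
  simp_rw [eLpNorm_eq_lnorm hμ]
  rfl

section

variable {S T U : E4 → ℝ≥0∞}

lemma measurable_slice (hS : Measurable S) (r : Ioi (0 : ℝ)) :
    Measurable fun θ : Metric.sphere (0 : E4) 1 => S ((r : ℝ) • (θ : E4)) :=
  hS.comp (measurable_polar.comp measurable_prodMk_left)

lemma measurable_lnorm_slice (hS : Measurable S) (μ : ℝ) :
    Measurable fun r : Ioi (0 : ℝ) =>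
      lnorm sphMeas μ fun θ : Metric.sphere (0 : E4) 1 => S ((r : ℝ) • (θ : E4)) :=
  measurable_lnorm (hS.comp measurable_polar)

lemma sn_self {p : ℝ} (hp : 0 < p) (hS : Measurable S) : sn p p S = lnorm volume p S := by
  unfold sn
  rw [lnorm, lnorm, lintegral_polar (hS.pow_const p)]
  simp_rw [lnorm_rpow_self hp]

lemma sn_mono {p μ : ℝ} (hp : 0 < p) (hμ : 0 < μ) (h : ∀ x, S x ≤ T x) : sn p μ S ≤ sn p μ T :=
  lnorm_mono hp.le fun _ => lnorm_mono hμ.le fun _ => h _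

lemma sn_le_mul_rpow {p p₁ p₂ μ μ₁ μ₂ a b : ℝ} (hp : 0 < p) (hp₁ : 0 < p₁) (hp₂ : 0 < p₂)
    (hμ : 0 < μ) (hμ₁ : 0 < μ₁) (hμ₂ : 0 < μ₂) (ha : 0 ≤ a) (hb : 0 ≤ b)
    (h : 1 / p = a / p₁ + b / p₂) (h' : 1 / μ = a / μ₁ + b / μ₂) (hS : Measurable S)
    (hT : Measurable T) (hU : ∀ x, U x ≤ S x ^ a * T x ^ b) :
    sn p μ U ≤ sn p₁ μ₁ S ^ a * sn p₂ μ₂ T ^ b := by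
  refine lnorm_le_mul_rpow hp hp₁ hp₂ ha hb h (measurable_lnorm_slice hS _).aemeasurable
    (measurable_lnorm_slice hT _).aemeasurable (ae_of_all _ fun r => ?_)
  exact lnorm_le_mul_rpow hμ hμ₁ hμ₂ ha hb h' (measurable_slice hS r).aemeasurable
    (measurable_slice hT r).aemeasurable (ae_of_all _ fun θ => hU _)

lemma sn_mul_le {p p₁ p₂ μ μ₁ μ₂ : ℝ} (hp : 0 < p) (hp₁ : 0 < p₁) (hp₂ : 0 < p₂)
    (hμ : 0 < μ) (hμ₁ : 0 < μ₁) (hμ₂ : 0 < μ₂) (h : 1 / p = 1 / p₁ + 1 / p₂)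
    (h' : 1 / μ = 1 / μ₁ + 1 / μ₂) (hS : Measurable S) (hT : Measurable T) :
    sn p μ (fun x => S x * T x) ≤ sn p₁ μ₁ S * sn p₂ μ₂ T := by
  simpa using sn_le_mul_rpow (U := fun x => S x * T x) hp hp₁ hp₂ hμ hμ₁ hμ₂ zero_le_one zero_le_one
    h h' hS hT (by simp)

lemma sn_interpolate {p p₁ p₂ μ μ₁ μ₂ a b : ℝ} (hp : 0 < p) (hp₁ : 0 < p₁) (hp₂ : 0 < p₂)
    (hμ : 0 < μ) (hμ₁ : 0 < μ₁) (hμ₂ : 0 < μ₂) (ha : 0 ≤ a) (hb : 0 ≤ b) (hab : a + b = 1)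
    (h : 1 / p = a / p₁ + b / p₂) (h' : 1 / μ = a / μ₁ + b / μ₂) (hS : Measurable S) :
    sn p μ S ≤ sn p₁ μ₁ S ^ a * sn p₂ μ₂ S ^ b := by
  refine sn_le_mul_rpow hp hp₁ hp₂ hμ hμ₁ hμ₂ ha hb h h' hS hS fun x => ?_
  rw [← ENNReal.rpow_add_of_nonneg _ _ ha hb, hab, ENNReal.rpow_one]

lemma sphMeas_univ_ne_zero : sphMeas univ ≠ 0 := by
  rw [Ne, Measure.measure_univ_eq_zero]
  exact Measure.toSphere_ne_zero _

/-- Hölder's inequality on the sphere, which has finite measure. -/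
lemma sn_mono_angular {p μ₁ μ₂ : ℝ} (hp : 0 < p) (hμ₁ : 0 < μ₁) (hμ : μ₁ ≤ μ₂)
    (hS : Measurable S) : sn p μ₁ S ≤ sphMeas univ ^ (1 / μ₁ - 1 / μ₂) * sn p μ₂ S := by
  have hμ₂ := hμ₁.trans_le hμ
  unfold sn
  rw [← lnorm_const_mul hp (ENNReal.rpow_ne_top_of_nonneg
    (sub_nonneg.2 (one_div_le_one_div_of_le hμ₁ hμ)) (measure_ne_top _ _))]
  refine lnorm_mono hp.le fun r => ?_
  have h1 := lnorm_le_mul_rpow (μ := sphMeas) (p := μ₁) (p₁ := μ₂) (p₂ := 1) (a := 1)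
    (b := 1 / μ₁ - 1 / μ₂) (f := fun θ => S ((r : ℝ) • (θ : E4))) (g := fun _ => 1)
    (k := fun θ => S ((r : ℝ) • (θ : E4))) hμ₁ hμ₂ one_pos zero_le_one
    (sub_nonneg.2 (one_div_le_one_div_of_le hμ₁ hμ)) (by ring)
    (measurable_slice hS r).aemeasurable aemeasurable_const (by simp)
  rw [lnorm_const one_pos, ENNReal.rpow_one, one_mul, div_one, ENNReal.rpow_one, mul_comm] at h1
  exact h1

/-! ### Rotations by quaternions -/

/-- The quaternion product on `ℝ⁴`. -/
def qmul (x y : E4) : E4 :=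
  Quaternion.linearIsometryEquivTuple (Quaternion.linearIsometryEquivTuple.symm x *
    Quaternion.linearIsometryEquivTuple.symm y)

lemma norm_qmul (x y : E4) : ‖qmul x y‖ = ‖x‖ * ‖y‖ := by
  rw [qmul, LinearIsometryEquiv.norm_map, norm_mul, LinearIsometryEquiv.norm_map,
    LinearIsometryEquiv.norm_map]

lemma continuous_qmul : Continuous fun z : E4 × E4 => qmul z.1 z.2 := by
  unfold qmul
  refine (LinearIsometryEquiv.continuous _).comp (Continuous.mul ?_ ?_)
  · exact (LinearIsometryEquiv.continuous _).comp continuous_fst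
  · exact (LinearIsometryEquiv.continuous _).comp continuous_snd

lemma qmul_smul (r : ℝ) (x y : E4) : qmul x (r • y) = r • qmul x y := by
  simp only [qmul, map_smul, mul_smul_comm]

lemma qmul_sub (x y z : E4) : qmul x (y - z) = qmul x y - qmul x z := by
  simp only [qmul, map_sub, mul_sub]

/-- The neutral element of the quaternion product. -/
def qone : E4 := Quaternion.linearIsometryEquivTuple 1

lemma qmul_qone (x : E4) : qmul x qone = x := by simp only [qmul, qone, LinearIsometryEquiv.symm_apply_apply, mul_one, LinearIsometryEquiv.apply_symm_apply]

lemma measurable_uncurry_sphere {q : E4 → E4 → E4} (hq : Measurable fun z : E4 × E4 => q z.1 z.2) :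
    Measurable fun w : Metric.sphere (0 : E4) 1 × E4 => q w.1 w.2 :=
  hq.comp (by fun_prop : Measurable fun w : Metric.sphere (0 : E4) 1 × E4 => ((w.1 : E4), w.2))

lemma measurable_qmul_sphere :
    Measurable fun w : Metric.sphere (0 : E4) 1 × E4 => qmul w.1 w.2 :=
  measurable_uncurry_sphere continuous_qmul.measurable

/-- Left multiplication with a unit quaternion. -/
def qleft (q : E4) (hq : ‖q‖ = 1) : E4 ≃ₗᵢ[ℝ] E4 :=
  LinearIsometry.toLinearIsometryEquiv
    { toFun := qmul q
      map_add' := fun x y => by simp only [qmul, map_add, mul_add]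
      map_smul' := fun r x => qmul_smul r q x
      norm_map' := fun x => by
        change ‖qmul q x‖ = ‖x‖
        rw [norm_qmul, hq, one_mul] } rfl

/-- Right multiplication with a unit quaternion. -/
def qright (q : E4) (hq : ‖q‖ = 1) : E4 ≃ₗᵢ[ℝ] E4 :=
  LinearIsometry.toLinearIsometryEquiv
    { toFun := fun x => qmul x q
      map_add' := fun x y => by simp only [qmul, map_add, add_mul]
      map_smul' := fun r x => by simp only [qmul, map_smul, smul_mul_assoc, RingHom.id_apply]
      norm_map' := fun x => by
        change ‖qmul x q‖ = ‖x‖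
        rw [norm_qmul, hq, mul_one] } rfl

/-- Rotation invariance of surface measure is inherited from Lebesgue measure: extend `G` to be
homogeneous of degree zero and integrate over the unit ball, which multiplies the spherical integral
by ∫₀¹ r³ dr = 1/4. -/
lemma lintegral_sphere_comp (V : E4 ≃ₗᵢ[ℝ] E4) {G : E4 → ℝ≥0∞} (hG : Measurable G) :
    ∫⁻ θ : Metric.sphere (0 : E4) 1, G (V θ) ∂sphMeas =
      ∫⁻ θ : Metric.sphere (0 : E4) 1, G θ ∂sphMeas := by
  have key : ∀ H : E4 → ℝ≥0∞, Measurable H →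
      ∫⁻ x, (Metric.ball (0 : E4) 1).indicator (fun x => H (‖x‖⁻¹ • x)) x =
        ENNReal.ofReal (1 / 4) * ∫⁻ θ : Metric.sphere (0 : E4) 1, H θ ∂sphMeas := by
    intro H hH
    have hm : Measurable fun x : E4 => H (‖x‖⁻¹ • x) := hH.comp (by fun_prop)
    rw [lintegral_polar (hm.indicator measurableSet_ball)]
    have h1 : ∀ r : Ioi (0 : ℝ), ∫⁻ θ : Metric.sphere (0 : E4) 1,
        (Metric.ball (0 : E4) 1).indicator (fun x => H (‖x‖⁻¹ • x)) ((r : ℝ) • (θ : E4)) ∂sphMeas =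
        (Iio (⟨1, mem_Ioi.2 one_pos⟩ : Ioi (0 : ℝ))).indicator
          (fun _ => ∫⁻ θ : Metric.sphere (0 : E4) 1, H θ ∂sphMeas) r := by
      intro r
      have hr : (0 : ℝ) < r := r.2
      have hn : ∀ θ : Metric.sphere (0 : E4) 1, ‖(r : ℝ) • (θ : E4)‖ = r := fun θ => by
        rw [norm_smul, Real.norm_of_nonneg hr.le, norm_eq_of_mem_sphere, mul_one]
      by_cases h : (r : ℝ) < 1
      · rw [indicator_of_mem (show r ∈ Iio (⟨1, mem_Ioi.2 one_pos⟩ : Ioi (0 : ℝ)) from h)]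
        refine lintegral_congr fun θ => ?_
        rw [indicator_of_mem (by rw [mem_ball_zero_iff, hn]; exact h), hn, smul_smul,
          inv_mul_cancel₀ hr.ne', one_smul]
      · rw [indicator_of_notMem (show r ∉ Iio (⟨1, mem_Ioi.2 one_pos⟩ : Ioi (0 : ℝ)) from h)]
        refine lintegral_eq_zero_of_ae_eq_zero (ae_of_all _ fun θ => ?_)
        exact indicator_of_notMem (by rw [mem_ball_zero_iff, hn]; exact h) _
    simp_rw [h1]
    rw [lintegral_indicator_const measurableSet_Iio, Measure.volumeIoiPow_apply_Iio, mul_comm]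
    norm_num
  have h1 := key G hG
  have h2 := key (fun x => G (V x)) (hG.comp V.continuous.measurable)
  have h3 : ∫⁻ x, (Metric.ball (0 : E4) 1).indicator (fun x => G (V (‖x‖⁻¹ • x))) x =
      ∫⁻ x, (Metric.ball (0 : E4) 1).indicator (fun x => G (‖x‖⁻¹ • x)) x := by
    have hm : Measurable fun x : E4 => G (‖x‖⁻¹ • x) := hG.comp (by fun_prop)
    rw [← V.measurePreserving.lintegral_comp (hm.indicator measurableSet_ball)]
    refine lintegral_congr fun x => ?_
    by_cases hx : x ∈ Metric.ball (0 : E4) 1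
    · rw [indicator_of_mem hx, indicator_of_mem (by simpa using hx), V.norm_map, map_smul]
    · rw [indicator_of_notMem hx, indicator_of_notMem (by simpa using hx)]
  rw [h1, h2] at h3
  exact (ENNReal.mul_right_inj (by simp) (by simp)).1 h3

/-- For `z ≠ 0`, right multiplication by `z` is the dilation by `‖z‖` composed with an isometry,
which does not change integrals over the sphere. -/
lemma lnorm_sphere_qmul {μ : ℝ} (hS : Measurable S) (z : E4) :
    lnorm sphMeas μ (fun θ : Metric.sphere (0 : E4) 1 => S (qmul θ z)) =
      lnorm sphMeas μ (fun θ : Metric.sphere (0 : E4) 1 => S (‖z‖ • (θ : E4))) := by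
  rcases eq_or_ne z 0 with rfl | hz
  · have : ∀ x, qmul x 0 = 0 := fun x => by simp only [qmul, map_zero, mul_zero]
    simp [this]
  · have hz' : ‖z‖ ≠ 0 := norm_ne_zero_iff.2 hz
    have h1 : ‖‖z‖⁻¹ • z‖ = 1 := by rw [norm_smul, norm_inv, norm_norm, inv_mul_cancel₀ hz']
    have h2 : ∀ x, qmul x z = ‖z‖ • qright _ h1 x := fun x => by
      change _ = ‖z‖ • qmul x _
      rw [qmul_smul, smul_smul, mul_inv_cancel₀ hz', one_smul]
    unfold lnorm
    simp_rw [h2]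
    congr 1
    exact lintegral_sphere_comp (qright _ h1) (G := fun x => S (‖z‖ • x) ^ μ)
      ((hS.comp (measurable_const_smul _)).pow_const _)

/-! ### Convolutions with radial kernels -/

/-- Convolution of functions with values in `[0, ∞]`. -/
def lconv (K S : E4 → ℝ≥0∞) (x : E4) : ℝ≥0∞ := ∫⁻ y, K (x - y) * S y

variable {K : E4 → ℝ≥0∞}

lemma measurable_lconv (hK : Measurable K) (hS : Measurable S) : Measurable (lconv K S) :=
  Measurable.lintegral_prod_right' (f := fun z : E4 × E4 => K (z.1 - z.2) * S z.2)
    ((hK.comp (measurable_fst.sub measurable_snd)).mul (hS.comp measurable_snd))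

/-- Young's inequality. -/
lemma lnorm_lconv_le {p : ℝ} (hp : 1 ≤ p) (hK : Measurable K) (hK' : ∫⁻ x, K x ≠ ⊤)
    (hS : Measurable S) : lnorm volume p (lconv K S) ≤ (∫⁻ x, K x) * lnorm volume p S := by
  have hp0 := zero_lt_one.trans_le hp
  have hp1 : 0 ≤ 1 - 1 / p := by
    rw [sub_nonneg, div_le_one hp0]; exact hp
  have hKx : ∀ x, Measurable fun y => K (x - y) := fun x =>
    hK.comp (measurable_const.sub measurable_id)
  -- Hölder's inequality for the splitting K = K^{1-1/p} · K^{1/p}, with exponents chosen so that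
  -- only the integral of `K` and that of K · S^p appear.
  have h1 : ∀ x, lconv K S x ≤
      (∫⁻ y, K y) ^ (1 - 1 / p) * (∫⁻ y, K (x - y) * S y ^ p) ^ (1 / p) := by
    intro x
    have := lnorm_le_mul_rpow (μ := volume) (p := 1) (p₁ := 1) (p₂ := p) (a := 1 - 1 / p) (b := 1)
      (f := fun y => K (x - y)) (g := fun y => K (x - y) ^ (1 / p) * S y)
      (k := fun y => K (x - y) * S y) one_pos one_pos hp0 hp1 zero_le_one
      (by ring) (hKx x).aemeasurable (((hKx x).pow_const _).mul hS).aemeasurable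
      (ae_of_all _ fun y => ?_)
    · rw [lnorm_one, lnorm_one, ENNReal.rpow_one, lintegral_sub_left_eq_self] at this
      refine this.trans_eq ?_
      unfold lnorm
      congr 2
      refine lintegral_congr fun y => ?_
      rw [ENNReal.mul_rpow_of_nonneg _ _ hp0.le, ← ENNReal.rpow_mul, one_div_mul_cancel hp0.ne',
        ENNReal.rpow_one]
    · rw [ENNReal.rpow_one, ← mul_assoc, ← ENNReal.rpow_add_of_nonneg _ _ hp1 (by positivity)]
      simp
  refine (lnorm_mono hp0.le h1).trans ?_
  rw [lnorm_const_mul hp0 (ENNReal.rpow_ne_top_of_nonneg hp1 hK')]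
  have h2 : lnorm volume p (fun x => (∫⁻ y, K (x - y) * S y ^ p) ^ (1 / p)) =
      (∫⁻ y, K y) ^ (1 / p) * lnorm volume p S := by
    unfold lnorm
    simp_rw [← ENNReal.rpow_mul, one_div_mul_cancel hp0.ne', ENNReal.rpow_one]
    rw [lintegral_lintegral_swap, ← ENNReal.mul_rpow_of_nonneg _ _ (by positivity)]
    · congr 1
      rw [← lintegral_const_mul _ (hS.pow_const p)]
      refine lintegral_congr fun y => ?_
      have hKy : Measurable fun x => K (x - y) := hK.comp (measurable_id.sub measurable_const)
      rw [lintegral_mul_const _ hKy, lintegral_sub_right_eq_self]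
    · exact ((hK.comp (measurable_fst.sub measurable_snd)).mul
        ((hS.comp measurable_snd).pow_const p)).aemeasurable
  rw [h2, ← mul_assoc, ← ENNReal.rpow_add_of_nonneg _ _ hp1 (by positivity)]
  simp

/-- Substituting y = θz is an isometric change of variables, and |rθ - θz| = |r - z| in quaternion
notation. A radial kernel thus no longer sees `θ`, and the whole angular dependence sits in `S`. -/
lemma lconv_polar (hK : Measurable K) (hKr : IsRadial K) (hS : Measurable S) (r : ℝ)
    (θ : Metric.sphere (0 : E4) 1) :
    lconv K S (r • (θ : E4)) = ∫⁻ z, K (r • qone - z) * S (qmul θ z) := by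
  have hθ : ‖(θ : E4)‖ = 1 := norm_eq_of_mem_sphere θ
  have hm : Measurable fun y => K (r • (θ : E4) - y) * S y :=
    (hK.comp (measurable_const.sub measurable_id)).mul hS
  rw [lconv, ← (qleft _ hθ).measurePreserving.lintegral_comp hm]
  refine lintegral_congr fun z => ?_
  change K (r • (θ : E4) - qmul θ z) * S (qmul θ z) = _
  congr 1
  refine hKr _ _ ?_
  have h1 : qmul (θ : E4) (r • qone - z) = r • (θ : E4) - qmul θ z := by
    rw [qmul_sub, qmul_smul, qmul_qone]
  rw [← h1, norm_qmul, hθ, one_mul]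

/-- Boundedness of radial convolutions on the mixed norm. By `lconv_polar` and Minkowski's
inequality in `θ`, the spherical L² norm of the convolution is at most the convolution with the
spherical L² norm `M` of `S`. Since `M` is radial, the scalar Young inequality applies to it. -/
lemma sn_two_lconv_le {p : ℝ} (hp : 1 ≤ p) (hK : Measurable K) (hKr : IsRadial K)
    (hK' : ∫⁻ x, K x ≠ ⊤) (hKt : ∀ x, K x ≠ ⊤) (hS : Measurable S) :
    sn p 2 (lconv K S) ≤ (∫⁻ x, K x) * sn p 2 S := by
  have hp0 := zero_lt_one.trans_le hp
  set M : E4 → ℝ≥0∞ := fun x => lnorm sphMeas 2 fun θ => S (‖x‖ • (θ : E4)) with hM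
  have hMm : Measurable M := by
    refine measurable_lnorm (f := fun (x : E4) (θ : Metric.sphere (0 : E4) 1) => S (‖x‖ • (θ : E4)))
      (hS.comp ?_)
    fun_prop
  have hMr : ∀ (r : Ioi (0 : ℝ)) (θ : Metric.sphere (0 : E4) 1), M ((r : ℝ) • (θ : E4)) =
      lnorm sphMeas 2 fun θ => S ((r : ℝ) • (θ : E4)) := fun r θ => by
    have hr : (0 : ℝ) < r := r.2
    simp only [hM, norm_smul, Real.norm_of_nonneg hr.le, norm_eq_of_mem_sphere, mul_one]
  have h1 : ∀ r : Ioi (0 : ℝ), lnorm sphMeas 2 (fun θ => lconv K S ((r : ℝ) • (θ : E4))) ≤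
      lconv K M ((r : ℝ) • qone) := by
    intro r
    simp_rw [lconv_polar hK hKr hS]
    have hm : Measurable fun w : Metric.sphere (0 : E4) 1 × E4 =>
        K ((r : ℝ) • qone - w.2) * S (qmul w.1 w.2) := by
      have hm1 : Measurable fun w : Metric.sphere (0 : E4) 1 × E4 => K ((r : ℝ) • qone - w.2) :=
        hK.comp (measurable_const.sub measurable_snd)
      have hm2 : Measurable fun w : Metric.sphere (0 : E4) 1 × E4 => S (qmul w.1 w.2) :=
        hS.comp measurable_qmul_sphere
      exact hm1.mul hm2
    refine (lnorm_two_lintegral_le (μ := sphMeas) (ν := volume)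
      (f := fun (θ : Metric.sphere (0 : E4) 1) z => K ((r : ℝ) • qone - z) * S (qmul θ z))
      hm).trans_eq ?_
    · refine lintegral_congr fun z => ?_
      rw [lnorm_const_mul two_pos (hKt _), lnorm_sphere_qmul hS]
  have h2 : ∀ (r : Ioi (0 : ℝ)) (θ : Metric.sphere (0 : E4) 1),
      lconv K M ((r : ℝ) • (θ : E4)) = lconv K M ((r : ℝ) • qone) := by
    intro r θ
    rw [lconv_polar hK hKr hMm]
    refine lintegral_congr fun z => ?_
    congr 1
    simp only [hM, norm_qmul, norm_eq_of_mem_sphere, one_mul]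
  have h3 := lnorm_lconv_le hp hK hK' hMm
  rw [← sn_self hp0 (measurable_lconv hK hMm), ← sn_self hp0 hMm] at h3
  -- Young's inequality for radial functions, read in polar coordinates, carries a power of the area
  -- of the sphere on both sides. It is positive and finite and cancels.
  simp only [sn, h2, hMr, lnorm_const hp0] at h3
  have hc : sphMeas univ ^ (1 / p) ≠ ⊤ :=
    ENNReal.rpow_ne_top_of_nonneg (by positivity) (measure_ne_top _ _)
  have hc0 : sphMeas univ ^ (1 / p) ≠ 0 :=
    (ENNReal.rpow_pos (pos_iff_ne_zero.2 sphMeas_univ_ne_zero) (measure_ne_top _ _)).ne'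
  simp_rw [mul_comm _ (sphMeas univ ^ (1 / p))] at h3
  rw [lnorm_const_mul hp0 hc, lnorm_const_mul hp0 hc, mul_left_comm,
    ENNReal.mul_le_mul_iff_right hc0 hc] at h3
  exact (lnorm_mono hp0.le h1).trans h3

end

end

section


/-! ### Dyadic pieces and their space-time norms -/

lemma mixNorm_eq_lnorm {q p : ℝ} (hq : 0 < q) (hp : 0 < p) (I : Set ℝ) (g : ℝ → E4 → ℂ) :
    mixNorm I q p g =
      lnorm (volume.restrict I) q fun t => lnorm volume p fun x => ‖g t x‖ₑ := by
  rw [mixNorm, eLpNorm_eq_lnorm hq]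
  simp_rw [eLpNorm_eq_lnorm hp]
  rfl

lemma mixSphNorm_eq_lnorm {q p μ : ℝ} (hq : 0 < q) (hp : 0 < p) (hμ : 0 < μ) (I : Set ℝ)
    (g : ℝ → E4 → ℂ) :
    mixSphNorm I q p μ g = lnorm (volume.restrict I) q fun t => sn p μ fun x => ‖g t x‖ₑ := by
  rw [mixSphNorm, eLpNorm_eq_lnorm hq]
  simp_rw [sphNorm_eq_sn hp hμ]
  rfl

lemma measurable_sn {p μ : ℝ} {g : ℝ → E4 → ℝ≥0∞} (hg : Measurable (Function.uncurry g)) :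
    Measurable fun t => sn p μ (g t) := by
  refine measurable_lnorm (f := fun t (r : Ioi (0 : ℝ)) => lnorm sphMeas μ
    fun θ : Metric.sphere (0 : E4) 1 => g t ((r : ℝ) • (θ : E4))) ?_
  refine measurable_lnorm (f := fun (z : ℝ × Ioi (0 : ℝ)) (θ : Metric.sphere (0 : E4) 1) =>
    g z.1 ((z.2 : ℝ) • (θ : E4))) ?_
  have h : Measurable fun w : (ℝ × Ioi (0 : ℝ)) × Metric.sphere (0 : E4) 1 =>
      (w.1.1, (w.1.2 : ℝ) • (w.2 : E4)) := by fun_prop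
  exact hg.comp h

lemma dyad_rpow_mul (k : ℤ) (a b : ℝ) : dyad k ^ a * dyad k ^ b = dyad k ^ (a + b) :=
  (Real.rpow_add (dyad_pos k) a b).symm

lemma one_le_dyad {k : ℤ} (hk : 0 ≤ k) : 1 ≤ dyad k := by
  rw [← dyad_zero]; exact dyad_mono hk

lemma dyad_le_one {k : ℤ} (hk : k ≤ 0) : dyad k ≤ 1 := by
  rw [← dyad_zero]; exact dyad_mono hk

lemma one_le_jap (a : ℝ) : 1 ≤ jap a := by
  rw [jap, Real.one_le_sqrt]; nlinarith [sq_nonneg a]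

lemma le_jap (a : ℝ) : a ≤ jap a := Real.le_sqrt_of_sq_le (by linarith)

lemma ofReal_mul_le_of_weight {a b w : ℝ} (hb : 0 ≤ b) (h : a ≤ b * w) {n z : ℝ≥0∞}
    (hz : ENNReal.ofReal w * n ≤ z) : ENNReal.ofReal a * n ≤ ENNReal.ofReal b * z := by
  calc ENNReal.ofReal a * n ≤ ENNReal.ofReal (b * w) * n := by gcongr
    _ = ENNReal.ofReal b * (ENNReal.ofReal w * n) := by rw [ENNReal.ofReal_mul hb, mul_assoc]
    _ ≤ _ := by gcongr

lemma le_tsum_rpow_two (z : ℤ → ℝ≥0∞) (k : ℤ) : z k ≤ l2sum z := by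
  have h1 : z k ^ 2 ≤ ∑' k, z k ^ 2 := ENNReal.le_tsum k
  calc z k = (z k ^ 2) ^ (1 / 2 : ℝ) := by
        rw [← ENNReal.rpow_natCast, ← ENNReal.rpow_mul]; norm_num
    _ ≤ _ := ENNReal.rpow_le_rpow h1 (by norm_num)

variable {η : ℝ → ℝ} (hη : IsLPCutoff η)

/-- A family of functions with frequencies `|ξ| ≲ 2^k` together with the bounds which follow from
a control of the `X_N(I)`-norms (`b = true`) or of the `Y_N(I)`-norms (`b = false`) by `z`. -/
structure Pieces (δ : ℝ) (I : Set ℝ) (b : Bool) (C : ℝ≥0∞) (f : ℤ → ℝ → E4 → ℂ)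
    (β : ℤ → ℝ → ℝ≥0∞) (z : ℤ → ℝ≥0∞) : Prop where
  meas : ∀ k, Measurable (Function.uncurry (f k))
  repr : ∀ᵐ t ∂(volume.restrict I), ∀ k, conv (lowKer hη (k + 1)) (f k t) = f k t
  fin : l2sum z < ⊤
  meas_sup : ∀ k, Measurable (β k)
  le_sup : ∀ᵐ t ∂(volume.restrict I), ∀ k x, ‖f k t x‖ₑ ≤ β k t
  sup_two : ∀ k, lnorm (volume.restrict I) 2 (β k) ≤ C * z k
  sup_inv : ∀ k, lnorm (volume.restrict I) (1 / δ) (β k) ≤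
    C * (ENNReal.ofReal (dyad k ^ (1 - 2 * δ)) * z k)
  four : ∀ k, lnorm (volume.restrict I) (1 / δ) (fun t => lnorm volume 4 fun x => ‖f k t x‖ₑ) ≤
    C * (ENNReal.ofReal (dyad k ^ (-(2 * δ))) * z k)
  topX : b = true → ∀ k, lnorm (volume.restrict I) 2
    (fun t => lnorm volume 4 fun x => ‖f k t x‖ₑ) ≤ C * (ENNReal.ofReal (dyad k ^ (-1 : ℝ)) * z k)
  topY : b = false → ∀ k, lnorm (volume.restrict I) (2 / (1 - 2 * δ))
    (fun t => sn (14 / (2 + 15 * δ)) (1 / δ) fun x => ‖f k t x‖ₑ) ≤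
      C * (ENNReal.ofReal (dyad k ^ (-(4 / 7 + nu δ))) * z k)

/-- L⁴ lies between L^p and L^∞, and the sup norm is itself controlled by the L^p norm through
`bernstein`. -/
lemma bernstein_four {p : ℝ} (hp : 1 < p) (hp4 : p ≤ 4) {k : ℤ} {f : E4 → ℂ} (hf : Measurable f)
    (hk : conv (lowKer hη (k + 1)) f = f) (hfin : (lnorm volume p fun x => ‖f x‖ₑ) ≠ ⊤) :
    (lnorm volume 4 fun x => ‖f x‖ₑ) ≤ bernsteinConst hη p ^ (1 - p / 4) *
      (ENNReal.ofReal (dyad k ^ (4 / p - 1)) * lnorm volume p fun x => ‖f x‖ₑ) := by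
  have hN := dyad_pos k
  have hp0 : 0 < p := by linarith
  have h0 : 0 ≤ 1 - p / 4 := by linarith
  refine (lnorm_le_mul_sup hp0 hp4 ?_ (ae_of_all _ fun x =>
    bernstein hη hp hf.aemeasurable hk x)).trans_eq ?_
  · exact ENNReal.mul_ne_top (bernsteinConst_ne_top hη hp) (ENNReal.mul_ne_top (by simp) hfin)
  · rw [ENNReal.mul_rpow_of_nonneg _ _ h0, ENNReal.mul_rpow_of_nonneg _ _ h0, mul_left_comm]
    congr 1
    rw [mul_left_comm, ← ENNReal.rpow_add_of_nonneg _ _ (by positivity) h0]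
    rw [ENNReal.ofReal_rpow_of_pos (by positivity), ← Real.rpow_mul hN.le]
    simp only [add_sub_cancel, ENNReal.rpow_one]
    congr 3
    field_simp

/-- The L²_t component bounds the sup norm through L⁴ and is itself the bound for a top piece. The
L^{1/δ}_t component, with spatial exponent p such that 4/p = 2 - 2δ, gives the sup bound with weight
N^{1-2δ} and, through `bernstein_four`, the L⁴ bound with weight N^{-2δ}. -/
lemma pieces_of_XN {δ : ℝ} (hδ : 0 < δ) (hδ' : δ ≤ 1 / 100) :
    ∃ C : ℝ≥0∞, C ≠ ⊤ ∧ ∀ (I : Set ℝ) (f : ℤ → ℝ → E4 → ℂ) (z : ℤ → ℝ≥0∞),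
      (∀ k, Measurable (Function.uncurry (f k))) →
      (∀ᵐ t ∂(volume.restrict I), ∀ k, conv (lowKer hη (k + 1)) (f k t) = f k t) →
      l2sum z < ⊤ → (∀ k, XN δ I k (f k) ≤ z k) →
      ∃ β, Pieces hη δ I true C f β z := by
  set p := 2 / (1 - δ) with hp
  have h1δ : 0 < 1 - δ := by linarith
  have hp1 : 1 < p := by rw [hp, lt_div_iff₀ h1δ]; linarith
  have hp4 : p ≤ 4 := by rw [hp, div_le_iff₀ h1δ]; linarith
  have h4p : 4 / p = 2 - 2 * δ := by rw [hp]; field_simp; ring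
  have hcp := bernsteinConst_ne_top hη hp1
  have hc4 := bernsteinConst_ne_top hη (p := 4) (by norm_num)
  set cp := bernsteinConst hη p
  set c4 := bernsteinConst hη 4
  have hcp' : cp ^ (1 - p / 4) ≠ ⊤ := ENNReal.rpow_ne_top_of_nonneg (by linarith) hcp
  refine ⟨1 + cp + c4 + cp ^ (1 - p / 4), by simp [hcp, hc4, hcp'], fun I f z hm hr hz hX => ?_⟩
  set C := 1 + cp + c4 + cp ^ (1 - p / 4)
  have hC1 : 1 ≤ C := by simp only [C, add_assoc]; exact le_self_add
  have hC2 : cp ≤ C := by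
    simp only [C]; exact le_add_right (le_add_right le_add_self)
  have hC3 : c4 ≤ C := by simp only [C]; exact le_add_right le_add_self
  have hC4 : cp ^ (1 - p / 4) ≤ C := le_add_self
  set L4 : ℤ → ℝ → ℝ≥0∞ := fun k t => lnorm volume 4 fun x => ‖f k t x‖ₑ with hL4
  set Lp : ℤ → ℝ → ℝ≥0∞ := fun k t => lnorm volume p fun x => ‖f k t x‖ₑ with hLp
  have hLm : ∀ q k, Measurable fun t => lnorm volume q fun x => ‖f k t x‖ₑ := fun q k =>
    measurable_lnorm (f := fun t x => ‖f k t x‖ₑ) (hm k).enorm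
  have hδ1 : 0 < 1 / δ := by positivity
  have hXl : ∀ k, ENNReal.ofReal (dyad k) * lnorm (volume.restrict I) (1 / δ) (Lp k) +
      ENNReal.ofReal (dyad k) * lnorm (volume.restrict I) 2 (L4 k) ≤ z k := fun k => by
    have := hX k
    rw [XN, mixNorm_eq_lnorm hδ1 (by linarith), mixNorm_eq_lnorm two_pos (by norm_num)] at this
    exact this
  have ha : ∀ k, ENNReal.ofReal (dyad k) * lnorm (volume.restrict I) (1 / δ) (Lp k) ≤ z k :=
    fun k => le_self_add.trans (hXl k)
  have hb : ∀ k, ENNReal.ofReal (dyad k) * lnorm (volume.restrict I) 2 (L4 k) ≤ z k :=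
    fun k => le_add_self.trans (hXl k)
  have hLfin : ∀ᵐ t ∂(volume.restrict I), ∀ k, Lp k t ≠ ⊤ := by
    rw [ae_all_iff]
    intro k
    refine (ae_lt_top_of_lnorm hδ1 (hLm p k).aemeasurable ?_).mono fun t ht => ht.ne
    have h1 : ENNReal.ofReal (dyad k) * lnorm (volume.restrict I) (1 / δ) (Lp k) < ⊤ :=
      (ha k).trans_lt ((le_tsum_rpow_two z k).trans_lt hz)
    refine lt_top_iff_ne_top.2 fun h => ?_
    rw [show lnorm (volume.restrict I) (1 / δ) (Lp k) = ⊤ from h, ENNReal.mul_top] at h1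
    · exact lt_irrefl _ h1
    · simpa using dyad_pos k
  -- One majorant must serve two time exponents. The minimum of both Bernstein bounds does: its
  -- first entry is used for L²_t, its second for L^{1/δ}_t.
  refine ⟨fun k t => min (c4 * (ENNReal.ofReal (dyad k) * L4 k t))
    (cp * (ENNReal.ofReal (dyad k ^ (2 - 2 * δ)) * Lp k t)), hm, hr, hz, ?_, ?_, ?_, ?_, ?_, ?_, ?_⟩
  · exact fun k => (((hLm 4 k).const_mul _).const_mul _).min (((hLm p k).const_mul _).const_mul _)
  · filter_upwards [hr] with t ht k x
    have hmt : Measurable (f k t) := (hm k).comp measurable_prodMk_left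
    refine le_min ?_ ?_
    · have := bernstein hη (p := 4) (by norm_num) hmt.aemeasurable (ht k) x
      rwa [div_self (by norm_num : (4 : ℝ) ≠ 0), Real.rpow_one] at this
    · have := bernstein hη hp1 hmt.aemeasurable (ht k) x
      rwa [h4p] at this
  · intro k
    refine (lnorm_mono two_pos.le fun t => min_le_left _ _).trans ?_
    rw [lnorm_const_mul two_pos hc4, lnorm_const_mul two_pos (by simp)]
    exact mul_le_mul' hC3 (hb k)
  · intro k
    refine (lnorm_mono hδ1.le fun t => min_le_right _ _).trans ?_
    rw [lnorm_const_mul hδ1 hcp, lnorm_const_mul hδ1 (by simp)]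
    refine mul_le_mul' hC2 (ofReal_mul_le_of_weight (by have := dyad_pos k; positivity) ?_ (ha k))
    conv_rhs => rw [← Real.rpow_one (dyad k), ← Real.rpow_mul (dyad_pos k).le, dyad_rpow_mul]
    exact le_of_eq (by congr 1; ring)
  · intro k
    have : lnorm (volume.restrict I) (1 / δ) (L4 k) ≤ lnorm (volume.restrict I) (1 / δ)
        (fun t => cp ^ (1 - p / 4) * (ENNReal.ofReal (dyad k ^ (4 / p - 1)) * Lp k t)) := by
      refine lnorm_mono_ae hδ1.le ?_
      filter_upwards [hr, hLfin] with t ht hfin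
      exact bernstein_four hη hp1 hp4 ((hm k).comp measurable_prodMk_left) (ht k) (hfin k)
    refine this.trans ?_
    rw [lnorm_const_mul hδ1 hcp', lnorm_const_mul hδ1 (by simp)]
    refine mul_le_mul' hC4 (ofReal_mul_le_of_weight (by have := dyad_pos k; positivity) ?_ (ha k))
    conv_rhs => rw [← Real.rpow_one (dyad k), ← Real.rpow_mul (dyad_pos k).le, dyad_rpow_mul]
    exact le_of_eq (by rw [h4p]; congr 1; ring)
  · intro _ k
    refine le_trans ?_ (mul_le_mul_left hC1 _)
    rw [one_mul]
    have := ofReal_mul_le_of_weight (a := 1) (b := dyad k ^ (-1 : ℝ)) (by have := dyad_pos k; positivity) ?_ (hb k)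
    · simpa using this
    · rw [Real.rpow_neg_one, inv_mul_cancel₀ (dyad_pos k).ne']
  · intro h; simp at h

end

/-! ### Pieces controlled by the norm of Y -/

section


variable {η : ℝ → ℝ} (hη : IsLPCutoff η)

lemma rpow_mul_rpow_le_of_le {x y z W : ℝ≥0∞} {a b : ℝ} (ha : 0 ≤ a) (hb : 0 ≤ b) (hab : a + b = 1)
    (hx : W * x ≤ z) (hy : W * y ≤ z) : W * (x ^ a * y ^ b) ≤ z := by
  have e : ∀ w : ℝ≥0∞, w = w ^ a * w ^ b := fun w => by
    rw [← ENNReal.rpow_add_of_nonneg _ _ ha hb, hab, ENNReal.rpow_one]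
  calc W * (x ^ a * y ^ b) = (W ^ a * W ^ b) * (x ^ a * y ^ b) := by rw [← e]
    _ = (W * x) ^ a * (W * y) ^ b := by
        rw [ENNReal.mul_rpow_of_nonneg _ _ ha, ENNReal.mul_rpow_of_nonneg _ _ hb]; ring
    _ ≤ z ^ a * z ^ b := by gcongr
    _ = z := (e z).symm

/-- Elementary facts on the weights of the norm of `Y_N`. -/
lemma weights_Y {δ : ℝ} (hδ : 0 < δ) (hδ' : δ ≤ 1 / 100) (k : ℤ) :
    let N := dyad k
    let w₁ := N ^ (4 / 7 + nu δ) * jap N ^ (4 * δ)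
    let w₂ := jap N ^ (1 / 7 : ℝ)
    let θ := 2 * δ / (1 - 2 * δ)
    (0 ≤ k → N ^ (1 / 7 : ℝ) ≤ 1 * w₁ ∧ N ^ (1 / 7 : ℝ) ≤ N ^ (1 - 2 * δ) * w₂ ∧
      1 ≤ N ^ (-(2 * δ)) * w₂) ∧
    (k < 0 → N ^ ((10 - 2 * δ) / 7) ≤ 1 * w₁ ∧
      N ^ ((10 - 2 * δ) / 7) ≤ N ^ (1 - 2 * δ) * w₂ ∧
      N ^ ((10 - 2 * δ) / 7 - 1) ≤ N ^ (-(2 * δ)) * w₂) ∧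
    1 ≤ N ^ (-(4 / 7 + nu δ)) * (w₁ ^ (1 - θ) * w₂ ^ θ) := by
  intro N w₁ w₂ θ
  have hN : 0 < N := dyad_pos k
  have hJ1 : 1 ≤ jap N := one_le_jap N
  have hJN : N ≤ jap N := le_jap N
  have hJ0 : 0 < jap N := by linarith
  have hw₂ : 1 ≤ w₂ := Real.one_le_rpow hJ1 (by norm_num)
  have hJδ : 1 ≤ jap N ^ (4 * δ) := Real.one_le_rpow hJ1 (by positivity)
  have hν : nu δ = 16 / 7 * δ := rfl
  refine ⟨fun hk => ?_, fun hk => ?_, ?_⟩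
  · have h1 : 1 ≤ N := one_le_dyad hk
    refine ⟨?_, ?_, ?_⟩
    · rw [one_mul]
      calc N ^ (1 / 7 : ℝ) ≤ N ^ (4 / 7 + nu δ) :=
            Real.rpow_le_rpow_of_exponent_le h1 (by rw [hν]; linarith)
        _ ≤ _ := le_mul_of_one_le_right (by positivity) hJδ
    · calc N ^ (1 / 7 : ℝ) ≤ N ^ (1 - 2 * δ) :=
            Real.rpow_le_rpow_of_exponent_le h1 (by linarith)
        _ ≤ _ := le_mul_of_one_le_right (by positivity) hw₂
    · rw [Real.rpow_neg hN.le, ← div_eq_inv_mul, one_le_div (by positivity)]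
      calc N ^ (2 * δ) ≤ N ^ (1 / 7 : ℝ) := Real.rpow_le_rpow_of_exponent_le h1 (by linarith)
        _ ≤ _ := Real.rpow_le_rpow hN.le hJN (by norm_num)
  · have h1 : N ≤ 1 := dyad_le_one hk.le
    refine ⟨?_, ?_, ?_⟩
    · rw [one_mul]
      calc N ^ ((10 - 2 * δ) / 7) ≤ N ^ (4 / 7 + nu δ) :=
            Real.rpow_le_rpow_of_exponent_ge hN h1 (by rw [hν]; linarith)
        _ ≤ _ := le_mul_of_one_le_right (by positivity) hJδ
    · calc N ^ ((10 - 2 * δ) / 7) ≤ N ^ (1 - 2 * δ) :=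
            Real.rpow_le_rpow_of_exponent_ge hN h1 (by linarith)
        _ ≤ _ := le_mul_of_one_le_right (by positivity) hw₂
    · calc N ^ ((10 - 2 * δ) / 7 - 1) ≤ N ^ (-(2 * δ)) :=
            Real.rpow_le_rpow_of_exponent_ge hN h1 (by linarith)
        _ ≤ _ := le_mul_of_one_le_right (by positivity) hw₂
  · have h2δ : 0 < 1 - 2 * δ := by linarith
    have hθ0 : 0 ≤ θ := by positivity
    have hθ1 : θ ≤ 1 / 4 := by
      simp only [θ]; rw [div_le_iff₀ h2δ]; linarith
    have hθδ : θ * (1 - 2 * δ) = 2 * δ := by simp only [θ]; field_simp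
    set s := 4 / 7 + nu δ with hs
    have e1 : w₁ ^ (1 - θ) * w₂ ^ θ =
        N ^ (s * (1 - θ)) * jap N ^ (4 * δ * (1 - θ) + 1 / 7 * θ) := by
      simp only [w₁, w₂]
      rw [Real.mul_rpow (by positivity) (by positivity), ← Real.rpow_mul hN.le,
        ← Real.rpow_mul hJ0.le, ← Real.rpow_mul hJ0.le, Real.rpow_add hJ0]
      ring
    rw [e1, ← mul_assoc, ← Real.rpow_add hN, show -s + s * (1 - θ) = -(s * θ) by ring,
      Real.rpow_neg hN.le, ← div_eq_inv_mul, one_le_div (by positivity)]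
    -- Interpolating with the component that has no factor N^s loses N^{sθ}. The factor ⟨N⟩^{4δ} of
    -- the weight compensates for this, since 4δ = 2θ(1 - 2δ) dominates sθ, where s is close to 4/7.
    calc N ^ (s * θ) ≤ jap N ^ (s * θ) := Real.rpow_le_rpow hN.le hJN (by rw [hs, hν]; positivity)
      _ ≤ _ := Real.rpow_le_rpow_of_exponent_le hJ1 (by
          rw [hs, hν]
          nlinarith [mul_nonneg hθ0 hδ.le])

-- The spatial exponents 14/(5-δ) and 28 serve low and high frequencies respectively: Bernstein's
-- inequality from the former costs N^{(10-2δ)/7}, from the latter N^{1/7}, and `weights_Y` compares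
-- these costs with the weights. The angular bound for a top piece interpolates first between the
-- two radial exponents at time exponent 2, then with L^{1/δ}_t L^{28}_x.
set_option maxHeartbeats 1000000 in
lemma pieces_of_YN {δ : ℝ} (hδ : 0 < δ) (hδ' : δ ≤ 1 / 100) :
    ∃ C : ℝ≥0∞, C ≠ ⊤ ∧ ∀ (I : Set ℝ) (f : ℤ → ℝ → E4 → ℂ) (z : ℤ → ℝ≥0∞),
      (∀ k, Measurable (Function.uncurry (f k))) →
      (∀ᵐ t ∂(volume.restrict I), ∀ k, conv (lowKer hη (k + 1)) (f k t) = f k t) →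
      l2sum z < ⊤ → (∀ k, YN δ I k (f k) ≤ z k) →
      ∃ β, Pieces hη δ I false C f β z := by
  set P := 14 / (5 - δ) with hP
  have h5δ : 0 < 5 - δ := by linarith
  have h2δ : 0 < 1 - 2 * δ := by linarith
  have h4δ : 0 < 1 - 4 * δ := by linarith
  have hP1 : 1 < P := by rw [hP, lt_div_iff₀ h5δ]; linarith
  have hP4 : P ≤ 4 := by rw [hP, div_le_iff₀ h5δ]; linarith
  have h4P : 4 / P = (10 - 2 * δ) / 7 := by rw [hP]; field_simp; ring
  have h1P : 1 / P = (5 - δ) / 14 := by rw [hP]; field_simp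
  have hδ1 : 0 < 1 / δ := by positivity
  have h4δ1 : 0 < 4 / δ := by positivity
  have hP0 : 0 < P := by linarith
  have h28 : 28 ≤ 4 / δ := by rw [le_div_iff₀ hδ]; linarith
  -- the interpolation parameters
  set θ := 2 * δ / (1 - 2 * δ) with hθ
  have hθ0 : 0 ≤ θ := by positivity
  have hθ1 : θ ≤ 1 := by rw [hθ, div_le_iff₀ h2δ]; linarith
  -- The time exponents force `θ`; `x₀` is then the solution of (2 + 15δ)/14 = (1 - θ)x₀ + θ/28. It
  -- lies between the reciprocals of 28 and of `P`, so the radial exponent 1/x₀ is reached by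
  -- interpolation with parameter `lam`.
  set x₀ := (2 + 10 * δ - 30 * δ ^ 2) / (14 * (1 - 4 * δ)) with hx₀
  have hx₀1 : 1 / 28 < x₀ := by
    rw [hx₀, lt_div_iff₀ (by positivity)]; nlinarith
  have hx₀2 : x₀ ≤ 1 / P := by
    rw [hx₀, h1P, div_le_iff₀ (by positivity)]; nlinarith
  have hgap : 0 < 1 / P - 1 / 28 := by rw [h1P]; linarith
  set lam := (1 / P - x₀) / (1 / P - 1 / 28) with hlam
  have hlam0 : 0 ≤ lam := div_nonneg (by linarith) hgap.le
  have hlam1 : lam ≤ 1 := by rw [hlam, div_le_one hgap]; linarith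
  have hlamx : 1 / (1 / x₀) = (1 - lam) / P + lam / 28 := by
    have h0 : lam * (1 / P - 1 / 28) = 1 / P - x₀ := by
      rw [hlam, div_mul_cancel₀ _ hgap.ne']
    rw [one_div_one_div]
    have : (1 - lam) / P + lam / 28 = 1 / P - lam * (1 / P - 1 / 28) := by ring
    rw [this, h0]; ring
  have hx₀0 : 0 < x₀ := by linarith
  set lam4 := (1 / P - 1 / 4) / (1 / P - 1 / 28) with hlam4
  have hlam40 : 0 ≤ lam4 := div_nonneg (by rw [h1P]; linarith) hgap.le
  have hlam41 : lam4 ≤ 1 := by rw [hlam4, div_le_one hgap]; linarith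
  have hlam4x : 1 / 4 = (1 - lam4) / P + lam4 / 28 := by
    have h0 : lam4 * (1 / P - 1 / 28) = 1 / P - 1 / 4 := by
      rw [hlam4, div_mul_cancel₀ _ hgap.ne']
    have : (1 - lam4) / P + lam4 / 28 = 1 / P - lam4 * (1 / P - 1 / 28) := by ring
    rw [this, h0]; ring
  -- The angular exponent produced by the interpolation. It is at least 1/δ, and the surplus is
  -- given away on the sphere by `sn_mono_angular`.
  set μ₁ := 1 / ((1 - θ) / (4 / δ) + θ / 28) with hμ₁
  have hμ₁0 : 0 < (1 - θ) / (4 / δ) + θ / 28 := by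
    have h2 : 0 < θ := by rw [hθ]; positivity
    have : 0 ≤ (1 - θ) / (4 / δ) := div_nonneg (by linarith) h4δ1.le
    positivity
  have hμ₁1 : 1 / δ ≤ μ₁ := by
    rw [hμ₁]
    refine one_div_le_one_div_of_le hμ₁0 ?_
    have h1 : (1 - θ) / (4 / δ) = (1 - θ) * δ / 4 := by field_simp
    have h2 : θ ≤ 4 * δ := by rw [hθ, div_le_iff₀ h2δ]; nlinarith
    rw [h1]
    nlinarith [mul_nonneg hθ0 hδ.le]
  have hptop : 1 / (14 / (2 + 15 * δ)) = (1 - θ) / (1 / x₀) + θ / 28 := by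
    have e : 1 - θ = (1 - 4 * δ) / (1 - 2 * δ) := by rw [hθ]; field_simp; ring
    have e2 : (1 - θ) / (1 / x₀) = (2 + 10 * δ - 30 * δ ^ 2) / (14 * (1 - 2 * δ)) := by
      rw [e, hx₀]; field_simp
    rw [e2, hθ]; field_simp; ring
  have htime : 1 / (2 / (1 - 2 * δ)) = (1 - θ) / 2 + θ / (1 / δ) := by
    rw [hθ]; field_simp; ring
  -- the constants
  have hcP := bernsteinConst_ne_top hη hP1
  have hc28 := bernsteinConst_ne_top hη (p := 28) (by norm_num)
  set cP := bernsteinConst hη P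
  set c28 := bernsteinConst hη 28
  have hcP' : cP ^ (1 - P / 4) ≠ ⊤ := ENNReal.rpow_ne_top_of_nonneg (by linarith) hcP
  set aP := sphMeas univ ^ (1 / P - 1 / (4 / δ)) with haP
  set a28 := sphMeas univ ^ (1 / 28 - 1 / (4 / δ)) with ha28
  set a1 := sphMeas univ ^ (1 / (1 / δ) - 1 / μ₁) with ha1
  have hP28 : P ≤ 4 / δ := by linarith
  have haPt : aP ≠ ⊤ := ENNReal.rpow_ne_top_of_nonneg
    (sub_nonneg.2 (one_div_le_one_div_of_le hP0 hP28)) (measure_ne_top _ _)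
  have ha28t : a28 ≠ ⊤ := ENNReal.rpow_ne_top_of_nonneg
    (sub_nonneg.2 (one_div_le_one_div_of_le (by norm_num) h28)) (measure_ne_top _ _)
  have ha1t : a1 ≠ ⊤ := ENNReal.rpow_ne_top_of_nonneg
    (sub_nonneg.2 (one_div_le_one_div_of_le hδ1 hμ₁1)) (measure_ne_top _ _)
  set C := 1 + cP + c28 + cP ^ (1 - P / 4) + cP * aP + c28 * a28 + a1 with hC
  have hCt : C ≠ ⊤ := by
    simp only [hC, ne_eq, ENNReal.add_eq_top, not_or]
    exact ⟨⟨⟨⟨⟨⟨by simp, hcP⟩, hc28⟩, hcP'⟩, ENNReal.mul_ne_top hcP haPt⟩,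
      ENNReal.mul_ne_top hc28 ha28t⟩, ha1t⟩
  have hC7 : a1 ≤ C := le_add_self
  have hC6 : c28 * a28 ≤ C := le_add_right le_add_self
  have hC5 : cP * aP ≤ C := le_add_right (le_add_right le_add_self)
  have hC4 : cP ^ (1 - P / 4) ≤ C := le_add_right (le_add_right (le_add_right le_add_self))
  have hC3 : c28 ≤ C := le_add_right (le_add_right (le_add_right (le_add_right le_add_self)))
  have hC2 : cP ≤ C :=
    le_add_right (le_add_right (le_add_right (le_add_right (le_add_right le_add_self))))
  have hC1 : 1 ≤ C := by simp only [hC, add_assoc]; exact le_self_add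
  refine ⟨C, hCt, fun I f z hm hr hz hY => ?_⟩
  set w₁ : ℤ → ℝ := fun k => dyad k ^ (4 / 7 + nu δ) * jap (dyad k) ^ (4 * δ) with hw₁
  set w₂ : ℤ → ℝ := fun k => jap (dyad k) ^ (1 / 7 : ℝ) with hw₂
  have hw := fun k => weights_Y hδ hδ' k
  have hs : ∀ k t, Measurable fun x => ‖f k t x‖ₑ := fun k t =>
    ((hm k).comp measurable_prodMk_left).enorm
  have hLm : ∀ q k, Measurable fun t => lnorm volume q fun x => ‖f k t x‖ₑ := fun q k =>
    measurable_lnorm (f := fun t x => ‖f k t x‖ₑ) (hm k).enorm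
  have hSm : ∀ q μ k, Measurable fun t => sn q μ fun x => ‖f k t x‖ₑ := fun q μ k =>
    measurable_sn (g := fun t x => ‖f k t x‖ₑ) (hm k).enorm
  set n1 : ℤ → ℝ≥0∞ := fun k =>
    lnorm (volume.restrict I) 2 (fun t => sn P (4 / δ) fun x => ‖f k t x‖ₑ) with hn1
  set n2 : ℤ → ℝ≥0∞ := fun k =>
    lnorm (volume.restrict I) 2 (fun t => sn 28 (4 / δ) fun x => ‖f k t x‖ₑ) with hn2
  set n3 : ℤ → ℝ≥0∞ := fun k =>
    lnorm (volume.restrict I) (1 / δ) (fun t => lnorm volume P fun x => ‖f k t x‖ₑ) with hn3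
  set n4 : ℤ → ℝ≥0∞ := fun k =>
    lnorm (volume.restrict I) (1 / δ) (fun t => lnorm volume 28 fun x => ‖f k t x‖ₑ) with hn4
  have hYl : ∀ k, ENNReal.ofReal (w₁ k) * n1 k + ENNReal.ofReal (w₁ k) * n2 k +
      ENNReal.ofReal (w₂ k) * n3 k + ENNReal.ofReal (w₂ k) * n4 k ≤ z k := fun k => by
    have := hY k
    rw [YN, mixSphNorm_eq_lnorm two_pos hP0 h4δ1, mixSphNorm_eq_lnorm two_pos (by norm_num) h4δ1,
      mixNorm_eq_lnorm hδ1 hP0, mixNorm_eq_lnorm hδ1 (by norm_num)] at this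
    exact this
  have h1 : ∀ k, ENNReal.ofReal (w₁ k) * n1 k ≤ z k := fun k =>
    (le_add_right (le_add_right le_self_add)).trans (hYl k)
  have h2 : ∀ k, ENNReal.ofReal (w₁ k) * n2 k ≤ z k := fun k =>
    (le_add_right (le_add_right le_add_self)).trans (hYl k)
  have h3 : ∀ k, ENNReal.ofReal (w₂ k) * n3 k ≤ z k := fun k =>
    (le_add_right le_add_self).trans (hYl k)
  have h4 : ∀ k, ENNReal.ofReal (w₂ k) * n4 k ≤ z k := fun k => le_add_self.trans (hYl k)
  have hw₂0 : ∀ k, 0 < w₂ k := fun k => by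
    have := one_le_jap (dyad k); simp only [hw₂]; positivity
  have hw₁0 : ∀ k, 0 < w₁ k := fun k => by
    have := one_le_jap (dyad k); have := dyad_pos k; simp only [hw₁]; positivity
  have hLfin : ∀ᵐ t ∂(volume.restrict I), ∀ k, (lnorm volume P fun x => ‖f k t x‖ₑ) ≠ ⊤ := by
    rw [ae_all_iff]
    intro k
    refine (ae_lt_top_of_lnorm hδ1 (hLm P k).aemeasurable ?_).mono fun t ht => ht.ne
    have h5 : ENNReal.ofReal (w₂ k) * n3 k < ⊤ :=
      (h3 k).trans_lt ((le_tsum_rpow_two z k).trans_lt hz)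
    refine lt_top_iff_ne_top.2 fun h => ?_
    rw [show n3 k = ⊤ from h, ENNReal.mul_top] at h5
    · exact lt_irrefl _ h5
    · simpa using hw₂0 k
  have hP2 : ∀ k, lnorm (volume.restrict I) 2 (fun t => lnorm volume P fun x => ‖f k t x‖ₑ) ≤
      aP * n1 k := fun k => by
    rw [hn1, ← lnorm_const_mul two_pos haPt]
    refine lnorm_mono two_pos.le fun t => ?_
    rw [← sn_self hP0 (hs k t)]
    exact sn_mono_angular hP0 hP0 hP28 (hs k t)
  have h282 : ∀ k, lnorm (volume.restrict I) 2 (fun t => lnorm volume 28 fun x => ‖f k t x‖ₑ) ≤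
      a28 * n2 k := fun k => by
    rw [hn2, ← lnorm_const_mul two_pos ha28t]
    refine lnorm_mono two_pos.le fun t => ?_
    rw [← sn_self (by norm_num) (hs k t)]
    exact sn_mono_angular (by norm_num) (by norm_num) h28 (hs k t)
  -- High frequencies use the cheaper Bernstein inequality from L^{28}; for low frequencies the
  -- larger power of N coming from `P` is the advantage.
  refine ⟨fun k t => if 0 ≤ k then
      c28 * (ENNReal.ofReal (dyad k ^ (1 / 7 : ℝ)) * lnorm volume 28 fun x => ‖f k t x‖ₑ) else
      cP * (ENNReal.ofReal (dyad k ^ ((10 - 2 * δ) / 7)) * lnorm volume P fun x => ‖f k t x‖ₑ),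
    hm, hr, hz, ?_, ?_, ?_, ?_, ?_, ?_, ?_⟩
  · intro k
    by_cases hk : 0 ≤ k
    · simp only [hk, if_true]
      exact ((hLm _ k).const_mul _).const_mul _
    · simp only [hk, if_false]
      exact ((hLm _ k).const_mul _).const_mul _
  · filter_upwards [hr] with t ht k x
    have hmt : Measurable (f k t) := (hm k).comp measurable_prodMk_left
    by_cases hk : 0 ≤ k
    · simp only [hk, if_true]
      have := bernstein hη (p := 28) (by norm_num) hmt.aemeasurable (ht k) x
      rwa [show (4 / 28 : ℝ) = 1 / 7 by norm_num] at this
    · simp only [hk, if_false]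
      have := bernstein hη hP1 hmt.aemeasurable (ht k) x
      rwa [h4P] at this
  · intro k
    by_cases hk : 0 ≤ k
    · simp only [hk, if_true]
      rw [lnorm_const_mul two_pos hc28, lnorm_const_mul two_pos (by simp)]
      calc _ ≤ c28 * (ENNReal.ofReal (dyad k ^ (1 / 7 : ℝ)) * (a28 * n2 k)) := by
            gcongr; exact h282 k
        _ = c28 * a28 * (ENNReal.ofReal (dyad k ^ (1 / 7 : ℝ)) * n2 k) := by ring
        _ ≤ C * (ENNReal.ofReal 1 * z k) := by
            gcongr ?_ * ?_
            exact ofReal_mul_le_of_weight zero_le_one ((hw k).1 hk).1 (h2 k)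
        _ = _ := by simp
    · simp only [hk, if_false]
      rw [lnorm_const_mul two_pos hcP, lnorm_const_mul two_pos (by simp)]
      calc _ ≤ cP * (ENNReal.ofReal (dyad k ^ ((10 - 2 * δ) / 7)) * (aP * n1 k)) := by
            gcongr; exact hP2 k
        _ = cP * aP * (ENNReal.ofReal (dyad k ^ ((10 - 2 * δ) / 7)) * n1 k) := by ring
        _ ≤ C * (ENNReal.ofReal 1 * z k) := by
            gcongr ?_ * ?_
            exact ofReal_mul_le_of_weight zero_le_one ((hw k).2.1 (not_le.1 hk)).1 (h1 k)
        _ = _ := by simp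
  · intro k
    have hNp := dyad_pos k
    by_cases hk : 0 ≤ k
    · simp only [hk, if_true]
      rw [lnorm_const_mul hδ1 hc28, lnorm_const_mul hδ1 (by simp)]
      exact mul_le_mul' hC3
        (ofReal_mul_le_of_weight (by positivity) ((hw k).1 hk).2.1 (h4 k))
    · simp only [hk, if_false]
      rw [lnorm_const_mul hδ1 hcP, lnorm_const_mul hδ1 (by simp)]
      exact mul_le_mul' hC2
        (ofReal_mul_le_of_weight (by positivity) ((hw k).2.1 (not_le.1 hk)).2.1 (h3 k))
  · intro k
    have hNp := dyad_pos k
    by_cases hk : 0 ≤ k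
    · refine le_trans ?_ (mul_le_mul_left hC1 _)
      rw [one_mul]
      have h5 : lnorm (volume.restrict I) (1 / δ)
          (fun t => lnorm volume 4 fun x => ‖f k t x‖ₑ) ≤ n3 k ^ (1 - lam4) * n4 k ^ lam4 := by
        refine lnorm_le_mul_rpow hδ1 hδ1 hδ1 (by linarith) hlam40 (by ring)
          (hLm P k).aemeasurable (hLm 28 k).aemeasurable (ae_of_all _ fun t => ?_)
        exact lnorm_interpolate (by norm_num) hP0 (by norm_num) (by linarith) hlam40 (by ring)
          hlam4x (hs k t).aemeasurable
      refine h5.trans ?_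
      have := ofReal_mul_le_of_weight (a := 1) (b := dyad k ^ (-(2 * δ))) (by positivity)
        ((hw k).1 hk).2.2
        (rpow_mul_rpow_le_of_le (by linarith) hlam40 (by ring) (h3 k) (h4 k) :
          _ * (n3 k ^ (1 - lam4) * n4 k ^ lam4) ≤ z k)
      simpa using this
    · have h5 : lnorm (volume.restrict I) (1 / δ) (fun t => lnorm volume 4 fun x => ‖f k t x‖ₑ) ≤
          lnorm (volume.restrict I) (1 / δ) (fun t => cP ^ (1 - P / 4) *
            (ENNReal.ofReal (dyad k ^ (4 / P - 1)) * lnorm volume P fun x => ‖f k t x‖ₑ)) := by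
        refine lnorm_mono_ae hδ1.le ?_
        filter_upwards [hr, hLfin] with t ht hfin
        exact bernstein_four hη hP1 hP4 ((hm k).comp measurable_prodMk_left) (ht k) (hfin k)
      refine h5.trans ?_
      rw [lnorm_const_mul hδ1 hcP', lnorm_const_mul hδ1 (by simp), h4P]
      exact mul_le_mul' hC4
        (ofReal_mul_le_of_weight (by positivity) ((hw k).2.1 (not_le.1 hk)).2.2 (h3 k))
  · intro h; simp at h
  · intro _ k
    have hNp := dyad_pos k
    set m : ℝ → ℝ≥0∞ := fun t => sn (1 / x₀) (4 / δ) fun x => ‖f k t x‖ₑ with hm0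
    -- First interpolation: only the radial exponent moves. The second, in `h8`, moves the time,
    -- radial and angular exponents together.
    have h6 : lnorm (volume.restrict I) 2 m ≤ n1 k ^ (1 - lam) * n2 k ^ lam := by
      refine lnorm_le_mul_rpow two_pos two_pos two_pos (by linarith) hlam0 (by ring)
        (hSm P _ k).aemeasurable (hSm 28 _ k).aemeasurable (ae_of_all _ fun t => ?_)
      exact sn_interpolate (by positivity) hP0 (by norm_num) h4δ1 h4δ1 h4δ1 (by linarith) hlam0
        (by ring) hlamx (by ring) (hs k t)
    have h7 : lnorm (volume.restrict I) (2 / (1 - 2 * δ))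
        (fun t => sn (14 / (2 + 15 * δ)) (1 / δ) fun x => ‖f k t x‖ₑ) ≤
        lnorm (volume.restrict I) (2 / (1 - 2 * δ))
          (fun t => a1 * sn (14 / (2 + 15 * δ)) μ₁ fun x => ‖f k t x‖ₑ) :=
      lnorm_mono (by positivity) fun t => sn_mono_angular (by positivity) hδ1 hμ₁1 (hs k t)
    have h8 : lnorm (volume.restrict I) (2 / (1 - 2 * δ))
        (fun t => sn (14 / (2 + 15 * δ)) μ₁ fun x => ‖f k t x‖ₑ) ≤
        lnorm (volume.restrict I) 2 m ^ (1 - θ) * n4 k ^ θ := by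
      refine lnorm_le_mul_rpow (by positivity) two_pos hδ1 (by linarith) hθ0 htime
        (hSm _ _ k).aemeasurable (hLm 28 k).aemeasurable (ae_of_all _ fun t => ?_)
      rw [← sn_self (by norm_num) (hs k t)]
      exact sn_interpolate (by positivity) (by positivity) (by norm_num) (by positivity) h4δ1
        (by norm_num) (by linarith) hθ0 (by ring) hptop (by rw [hμ₁, one_div_one_div]) (hs k t)
    refine h7.trans ?_
    rw [lnorm_const_mul (by positivity) ha1t]
    refine mul_le_mul' hC7 (h8.trans ?_)
    have h9 : ENNReal.ofReal (w₁ k) * lnorm (volume.restrict I) 2 m ≤ z k :=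
      le_trans (by gcongr) (rpow_mul_rpow_le_of_le (by linarith) hlam0 (by ring) (h1 k) (h2 k))
    have hθ1' : 0 ≤ 1 - θ := by linarith
    have h10 : ENNReal.ofReal (w₁ k ^ (1 - θ) * w₂ k ^ θ) *
        (lnorm (volume.restrict I) 2 m ^ (1 - θ) * n4 k ^ θ) ≤ z k := by
      rw [ENNReal.ofReal_mul (Real.rpow_nonneg (hw₁0 k).le _), ← ENNReal.ofReal_rpow_of_pos (hw₁0 k),
        ← ENNReal.ofReal_rpow_of_pos (hw₂0 k)]
      calc _ = (ENNReal.ofReal (w₁ k) * lnorm (volume.restrict I) 2 m) ^ (1 - θ) *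
            (ENNReal.ofReal (w₂ k) * n4 k) ^ θ := by
            rw [ENNReal.mul_rpow_of_nonneg _ _ hθ1', ENNReal.mul_rpow_of_nonneg _ _ hθ0]; ring
        _ ≤ z k ^ (1 - θ) * z k ^ θ := by gcongr; exact h4 k
        _ = z k := by
            rw [← ENNReal.rpow_add_of_nonneg _ _ hθ1' hθ0]; simp
    have := ofReal_mul_le_of_weight (a := 1) (b := dyad k ^ (-(4 / 7 + nu δ))) (by positivity)
      (hw k).2.2 h10
    simpa using this

end

section


variable {η : ℝ → ℝ} (hη : IsLPCutoff η)

lemma IsTemperedFun.integrable_mul_schwartz {f : E4 → ℂ} (hf : IsTemperedFun f) (φ : 𝓢(E4, ℂ)) :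
    Integrable fun x => f x * φ x := by
  have h := hf.integrable_conv (SchwartzMap.compCLMOfContinuousLinearEquiv ℂ
    (ContinuousLinearEquiv.neg ℝ) φ) 0
  refine h.congr (ae_of_all _ fun x => ?_)
  simp [mul_comm]

/-! ### Functions in a sum of two Lebesgue spaces -/

/-- `S` is dominated by an element of `L^{r₁} + L^{r₂}`. -/
def IsTame (r₁ r₂ : ℝ) (S : E4 → ℝ≥0∞) : Prop :=
  ∃ G₁ G₂ : E4 → ℝ≥0∞, Measurable G₁ ∧ Measurable G₂ ∧ lnorm volume r₁ G₁ < ⊤ ∧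
    lnorm volume r₂ G₂ < ⊤ ∧ ∀ x, S x ≤ G₁ x + G₂ x

lemma IsTame.mono {r₁ r₂ : ℝ} {S T : E4 → ℝ≥0∞} (hT : IsTame r₁ r₂ T) (h : ∀ x, S x ≤ T x) :
    IsTame r₁ r₂ S := by
  obtain ⟨G₁, G₂, h1, h2, h3, h4, h5⟩ := hT
  exact ⟨G₁, G₂, h1, h2, h3, h4, fun x => (h x).trans (h5 x)⟩

lemma IsTame.add {r₁ r₂ : ℝ} (hr₁ : 1 ≤ r₁) (hr₂ : 1 ≤ r₂) {S T : E4 → ℝ≥0∞}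
    (hS : IsTame r₁ r₂ S) (hT : IsTame r₁ r₂ T) : IsTame r₁ r₂ fun x => S x + T x := by
  obtain ⟨G₁, G₂, h1, h2, h3, h4, h5⟩ := hS
  obtain ⟨H₁, H₂, k1, k2, k3, k4, k5⟩ := hT
  refine ⟨fun x => G₁ x + H₁ x, fun x => G₂ x + H₂ x, h1.add k1, h2.add k2,
    (lnorm_add_le hr₁ h1.aemeasurable k1.aemeasurable).trans_lt (ENNReal.add_lt_top.2 ⟨h3, k3⟩),
    (lnorm_add_le hr₂ h2.aemeasurable k2.aemeasurable).trans_lt (ENNReal.add_lt_top.2 ⟨h4, k4⟩),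
    fun x => (add_le_add (h5 x) (k5 x)).trans (by rw [add_add_add_comm])⟩

lemma cube_add_le (a c : ℝ≥0∞) : (a + c) ^ 3 ≤ 4 * (a ^ 3 + c ^ 3) := by
  have h := ENNReal.rpow_add_le_mul_rpow_add_rpow a c (p := 3) (by norm_num)
  have e : (2 : ℝ≥0∞) ^ ((3 : ℝ) - 1) = 4 := by
    rw [show (3 : ℝ) - 1 = (2 : ℕ) by norm_num, ENNReal.rpow_natCast]; norm_num
  have e' : ∀ a : ℝ≥0∞, a ^ (3 : ℝ) = a ^ 3 := fun a => by
    rw [← ENNReal.rpow_natCast]; norm_num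
  rwa [e, e', e', e'] at h

lemma IsTame.cube {r₁ r₂ : ℝ} (hr₁ : 0 < r₁) (hr₂ : 0 < r₂) {S : E4 → ℝ≥0∞}
    (hS : IsTame r₁ r₂ S) : IsTame (r₁ / 3) (r₂ / 3) fun x => S x ^ 3 := by
  obtain ⟨G₁, G₂, h1, h2, h3, h4, h5⟩ := hS
  have key : ∀ {r : ℝ} {G : E4 → ℝ≥0∞}, 0 < r → lnorm volume r G < ⊤ →
      lnorm volume (r / 3) (fun x => 4 * G x ^ 3) < ⊤ := fun {r G} hr h => by
    rw [lnorm_const_mul (by positivity) (by norm_num)]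
    have : (fun x => G x ^ 3) = fun x => G x ^ (3 : ℝ) := by
      funext x; rw [← ENNReal.rpow_natCast]; norm_num
    rw [this, lnorm_rpow (by positivity) (by norm_num), mul_div_cancel₀ _ (by norm_num)]
    exact ENNReal.mul_lt_top (by norm_num) (ENNReal.rpow_lt_top_of_nonneg (by norm_num) h.ne)
  refine ⟨fun x => 4 * G₁ x ^ 3, fun x => 4 * G₂ x ^ 3, (h1.pow_const _).const_mul _,
    (h2.pow_const _).const_mul _, key hr₁ h3, key hr₂ h4, fun x => ?_⟩
  calc S x ^ 3 ≤ (G₁ x + G₂ x) ^ 3 := by gcongr; exact h5 x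
    _ ≤ 4 * (G₁ x ^ 3 + G₂ x ^ 3) := cube_add_le _ _
    _ = _ := mul_add _ _ _

lemma lintegral_mul_lt_top_of_isTame {r₁ r₂ : ℝ} (hr₁ : 1 < r₁) (hr₂ : 1 < r₂)
    {S W : E4 → ℝ≥0∞} (hS : IsTame r₁ r₂ S) (hW : Measurable W)
    (hW' : ∀ r, 1 < r → lnorm volume r W < ⊤) : ∫⁻ x, W x * S x < ⊤ := by
  obtain ⟨G₁, G₂, h1, h2, h3, h4, h5⟩ := hS
  have key : ∀ {r : ℝ} {G : E4 → ℝ≥0∞}, 1 < r → Measurable G → lnorm volume r G < ⊤ →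
      ∫⁻ x, W x * G x < ⊤ := fun {r G} hr hG h => by
    have h' : 1 < r / (r - 1) := by rw [one_lt_div (by linarith)]; linarith
    rw [← lnorm_one]
    refine (lnorm_mul_le one_pos (by linarith : 0 < r / (r - 1)) (by linarith : 0 < r) ?_
      hW.aemeasurable hG.aemeasurable).trans_lt (ENNReal.mul_lt_top (hW' _ h') h)
    have : r - 1 ≠ 0 := by linarith
    field_simp
    ring
  calc ∫⁻ x, W x * S x ≤ ∫⁻ x, (W x * G₁ x + W x * G₂ x) :=
        lintegral_mono fun x => by rw [← mul_add]; gcongr; exact h5 x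
    _ = (∫⁻ x, W x * G₁ x) + ∫⁻ x, W x * G₂ x :=
        lintegral_add_left (f := fun x => W x * G₁ x) (hW.mul h1) _
    _ < ⊤ := ENNReal.add_lt_top.2 ⟨key hr₁ h1 h3, key hr₂ h2 h4⟩

lemma measurable_enorm_schwartz (K : 𝓢(E4, ℂ)) : Measurable fun x => ‖K x‖ₑ :=
  (continuous_enorm.comp K.continuous).measurable

lemma lintegral_schwartz_sub_mul_lt_top {r₁ r₂ : ℝ} (hr₁ : 1 < r₁) (hr₂ : 1 < r₂)
    {S : E4 → ℝ≥0∞} (hS : IsTame r₁ r₂ S) (K : 𝓢(E4, ℂ)) (x : E4) :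
    ∫⁻ y, ‖K (x - y)‖ₑ * S y < ⊤ := by
  refine lintegral_mul_lt_top_of_isTame hr₁ hr₂ hS
    ((measurable_enorm_schwartz K).comp (measurable_const.sub measurable_id)) fun r hr => ?_
  have : lnorm volume r (fun y => ‖K (x - y)‖ₑ) = lnorm volume r (fun x => ‖K x‖ₑ) := by
    unfold lnorm
    rw [lintegral_sub_left_eq_self (fun y => ‖K y‖ₑ ^ r)]
  rw [this]
  exact lnorm_schwartz_lt_top (by linarith) K

lemma lintegral_schwartz_mul_lt_top {r₁ r₂ : ℝ} (hr₁ : 1 < r₁) (hr₂ : 1 < r₂)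
    {S : E4 → ℝ≥0∞} (hS : IsTame r₁ r₂ S) (K : 𝓢(E4, ℂ)) : ∫⁻ y, ‖K y‖ₑ * S y < ⊤ :=
  lintegral_mul_lt_top_of_isTame hr₁ hr₂ hS (measurable_enorm_schwartz K)
    fun _ hr => lnorm_schwartz_lt_top (by linarith) K

lemma IsTame.ae_lt_top {r₁ r₂ : ℝ} (hr₁ : 0 < r₁) (hr₂ : 0 < r₂) {S : E4 → ℝ≥0∞}
    (hS : IsTame r₁ r₂ S) : ∀ᵐ x, S x < ⊤ := by
  obtain ⟨G₁, G₂, h1, h2, h3, h4, h5⟩ := hS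
  filter_upwards [ae_lt_top_of_lnorm hr₁ h1.aemeasurable h3,
    ae_lt_top_of_lnorm hr₂ h2.aemeasurable h4] with x a b
  exact (h5 x).trans_lt (ENNReal.add_lt_top.2 ⟨a, b⟩)

lemma IsTame.isTemperedFun {r₁ r₂ : ℝ} (hr₁ : 1 < r₁) (hr₂ : 1 < r₂) {f : E4 → ℂ}
    (hf : AEStronglyMeasurable f) (hS : IsTame r₁ r₂ fun x => ‖f x‖ₑ) : IsTemperedFun f := by
  refine ⟨5, AEStronglyMeasurable.smul
    (continuous_inv_one_add_norm _).aestronglyMeasurable hf, ?_⟩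
  rw [hasFiniteIntegral_iff_enorm]
  simp only [enorm_smul]
  have hc : Continuous fun x : E4 => ‖((1 + ‖x‖) ^ 5)⁻¹‖ₑ :=
    continuous_enorm.comp (continuous_inv_one_add_norm 5)
  refine lintegral_mul_lt_top_of_isTame hr₁ hr₂ hS hc.measurable fun r hr => ?_
  refine ENNReal.rpow_lt_top_of_nonneg (by positivity) (ne_of_lt ?_)
  have h5 := (integrable_inv_one_add_norm (n := 5) (by norm_num)).2
  rw [hasFiniteIntegral_iff_enorm] at h5
  refine (lintegral_mono fun x => ?_).trans_lt h5
  refine (ENNReal.rpow_le_rpow_of_exponent_ge ?_ hr.le).trans (ENNReal.rpow_one _).le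
  beta_reduce
  rw [Real.enorm_eq_ofReal (by positivity)]
  refine ENNReal.ofReal_le_one.2 (inv_le_one_of_one_le₀ (one_le_pow₀ ?_))
  linarith [norm_nonneg x]

lemma tendsto_dyad_rpow_atBot {s : ℝ} (hs : 0 < s) :
    Tendsto (fun k : ℤ => ENNReal.ofReal (dyad k ^ s)) atBot (𝓝 0) := by
  rw [← ENNReal.ofReal_zero]
  refine ENNReal.tendsto_ofReal ?_
  have h1 : Tendsto (fun k : ℤ => dyad k) atBot (𝓝 0) := by
    have h := (tendsto_inv_atTop_zero.comp tendsto_dyad_atTop).comp tendsto_neg_atBot_atTop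
    refine h.congr fun k => ?_
    simp [dyad]
  have h2 := ((Real.continuousAt_rpow_const 0 s (Or.inr hs.le)).tendsto).comp h1
  rwa [Real.zero_rpow hs.ne'] at h2

lemma enorm_conv_le_lintegral (K : 𝓢(E4, ℂ)) (f : E4 → ℂ) (x : E4) :
    ‖conv K f x‖ₑ ≤ ∫⁻ y, ‖K (x - y)‖ₑ * ‖f y‖ₑ := by
  refine (enorm_integral_le_lintegral_enorm _).trans (lintegral_mono fun y => ?_)
  rw [enorm_mul]

lemma lintegral_schwartz_sub_mul_le {r : ℝ} (hr : 1 < r) (K : 𝓢(E4, ℂ)) {G : E4 → ℝ≥0∞}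
    (hG : Measurable G) (x : E4) : ∫⁻ y, ‖K (x - y)‖ₑ * G y ≤
      lnorm volume (r / (r - 1)) (fun x => ‖K x‖ₑ) * lnorm volume r G := by
  have h1 : lnorm volume (r / (r - 1)) (fun y => ‖K (x - y)‖ₑ) =
      lnorm volume (r / (r - 1)) (fun x => ‖K x‖ₑ) := by
    unfold lnorm
    rw [lintegral_sub_left_eq_self (fun y => ‖K y‖ₑ ^ (r / (r - 1)))]
  rw [← h1, ← lnorm_one]
  have : r - 1 ≠ 0 := by linarith
  refine lnorm_mul_le one_pos (div_pos (by linarith) (by linarith)) (by linarith) ?_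
    ((measurable_enorm_schwartz K).comp (measurable_const.sub measurable_id)).aemeasurable
    hG.aemeasurable
  field_simp
  ring

lemma tendsto_sup_lowKer {r : ℝ} (hr : 1 < r) {a : ℝ≥0∞} (ha : a < ⊤) :
    Tendsto (fun k : ℤ => lnorm volume (r / (r - 1)) (fun x => ‖lowKer hη k x‖ₑ) * a) atBot
      (𝓝 0) := by
  have hr' : 0 < r / (r - 1) := div_pos (by linarith) (by linarith)
  have hb := (lnorm_schwartz_lt_top hr' (lowKer hη 0)).ne
  have : r - 1 ≠ 0 := by linarith
  have e : 4 - 4 / (r / (r - 1)) = 4 / r := by field_simp; ring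
  have := ENNReal.Tendsto.mul_const (tendsto_dyad_rpow_atBot (s := 4 / r) (by positivity))
    (b := lnorm volume (r / (r - 1)) (fun x => ‖lowKer hη 0 x‖ₑ) * a)
    (Or.inr (ENNReal.mul_ne_top hb ha.ne))
  rw [zero_mul] at this
  refine this.congr fun k => ?_
  rw [lnorm_lowKer hη hr' k, e, mul_assoc]

/-- On L^r with 1 < r < ∞ the low frequency projection is bounded in sup norm by a constant times
N^{4/r}, which tends to zero with N. Hence no polynomial part can be present. -/
lemma IsTame.isHomogeneous (hη : IsLPCutoff η) {r₁ r₂ : ℝ} (hr₁ : 1 < r₁) (hr₂ : 1 < r₂)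
    {f : E4 → ℂ} (hf : AEStronglyMeasurable f) (hS : IsTame r₁ r₂ fun x => ‖f x‖ₑ) :
    IsHomogeneous η f := by
  refine ⟨hS.isTemperedFun hr₁ hr₂ hf, fun φ => ?_⟩
  obtain ⟨G₁, G₂, h1, h2, h3, h4, h5⟩ := hS
  rw [tendsto_zero_iff_enorm_tendsto_zero]
  have hlim := (tendsto_sup_lowKer hη hr₁ h3).add (tendsto_sup_lowKer hη hr₂ h4)
  have hφ : ∫⁻ x, ‖φ x‖ₑ ≠ ⊤ := by
    have := lnorm_schwartz_lt_top one_pos φ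
    rw [lnorm_one] at this
    exact this.ne
  have hlim' := ENNReal.Tendsto.mul_const hlim (b := ∫⁻ x, ‖φ x‖ₑ) (Or.inr hφ)
  rw [add_zero, zero_mul] at hlim'
  refine tendsto_of_tendsto_of_tendsto_of_le_of_le tendsto_const_nhds hlim' (fun _ => zero_le)
    fun k => ?_
  simp only [lpProjLow_eq hη]
  refine (enorm_integral_le_lintegral_enorm _).trans ?_
  rw [← lintegral_const_mul _ (measurable_enorm_schwartz φ)]
  refine lintegral_mono fun x => ?_
  rw [enorm_mul]
  gcongr
  refine (enorm_conv_le_lintegral _ _ _).trans ?_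
  refine le_trans (lintegral_mono fun y => mul_le_mul_right (h5 y) _) ?_
  simp only [mul_add]
  have hm : Measurable fun y => ‖lowKer hη k (x - y)‖ₑ * G₁ y :=
    ((measurable_enorm_schwartz _).comp (measurable_const.sub measurable_id)).mul h1
  rw [lintegral_add_left hm]
  exact add_le_add (lintegral_schwartz_sub_mul_le hr₁ _ h1 x)
    (lintegral_schwartz_sub_mul_le hr₂ _ h2 x)

end

/-! ### Almost everywhere convergence of the Littlewood-Paley series -/

section


variable {η : ℝ → ℝ} (hη : IsLPCutoff η)

lemma sum_Ioc_sub (a : ℤ → ℂ) (n : ℕ) :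
    ∑ k ∈ Finset.Ioc (-(n : ℤ)) n, (a k - a (k - 1)) = a n - a (-n) := by
  induction n with
  | zero => simp
  | succ n ih =>
    have h : Finset.Ioc (-((n + 1 : ℕ) : ℤ)) ((n + 1 : ℕ) : ℤ) =
        insert (-(n : ℤ)) (insert ((n : ℤ) + 1) (Finset.Ioc (-(n : ℤ)) n)) := by
      ext k
      simp only [Finset.mem_Ioc, Finset.mem_insert]
      push_cast
      omega
    rw [h, Finset.sum_insert (by simp; omega), Finset.sum_insert (by simp), ih]
    push_cast
    rw [show -(n : ℤ) - 1 = -1 + -n by ring]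
    ring_nf

lemma tendsto_Ioc_atTop :
    Tendsto (fun n : ℕ => Finset.Ioc (-(n : ℤ)) (n : ℤ)) atTop atTop := by
  refine tendsto_atTop_finset_of_monotone (fun m n h => ?_) fun k => ⟨k.natAbs + 1, ?_⟩
  · exact Finset.Ioc_subset_Ioc (by simpa using h) (by simpa using h)
  · simp only [Finset.mem_Ioc]; omega

/-- A tempered function without polynomial part is the sum of its Littlewood-Paley pieces, almost
everywhere, if this sum is controlled. -/
lemma ae_hasSum_conv_lpKer {r₁ r₂ : ℝ} (hr₁ : 1 < r₁) (hr₂ : 1 < r₂) {f : E4 → ℂ}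
    (hf : IsHomogeneous η f) (hS : IsTame r₁ r₂ fun x => ∑' k, ‖conv (lpKer hη k) f x‖ₑ) :
    ∀ᵐ x, HasSum (fun k => conv (lpKer hη k) f x) (f x) := by
  obtain ⟨ht, h0⟩ := hf
  have hfm := ht.aestronglyMeasurable
  set g : E4 → ℂ := fun x => ∑' k, conv (lpKer hη k) f x with hg
  set s : ℕ → E4 → ℂ := fun n x => ∑ k ∈ Finset.Ioc (-(n : ℤ)) n, conv (lpKer hη k) f x with hs
  have hsum : ∀ᵐ x, HasSum (fun k => conv (lpKer hη k) f x) (g x) := by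
    filter_upwards [hS.ae_lt_top (by linarith) (by linarith)] with x hx
    refine Summable.hasSum (Summable.of_norm ?_)
    exact NNReal.summable_coe.2 (ENNReal.tsum_coe_ne_top_iff_summable.1 hx.ne)
  have hlim : ∀ᵐ x, Tendsto (fun n => s n x) atTop (𝓝 (g x)) := by
    filter_upwards [hsum] with x hx
    exact hx.comp tendsto_Ioc_atTop
  have hsm : ∀ n, AEStronglyMeasurable (s n) := fun n => by
    have := Finset.aestronglyMeasurable_sum (μ := volume) (Finset.Ioc (-(n : ℤ)) n)
      (f := fun k => conv (lpKer hη k) f) fun k _ => aestronglyMeasurable_conv hfm _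
    refine this.congr (ae_of_all _ fun x => ?_)
    simp [hs]
  have hgm : AEStronglyMeasurable g := aestronglyMeasurable_of_tendsto_ae atTop hsm hlim
  have hgS : ∀ x, ‖g x‖ₑ ≤ ∑' k, ‖conv (lpKer hη k) f x‖ₑ := fun x => enorm_tsum_le_tsum_enorm
  have hgt : IsTemperedFun g := (hS.mono hgS).isTemperedFun hr₁ hr₂ hgm
  have hs_eq : ∀ n x, s n x = conv (lowKer hη n) f x - conv (lowKer hη (-n)) f x := fun n x => by
    rw [← sum_Ioc_sub (fun k => conv (lowKer hη k) f x)]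
    refine Finset.sum_congr rfl fun k _ => ?_
    rw [lpKer_eq, conv_sub_left ht]
    rfl
  -- The pairings of the partial sums converge in two ways: by domination to the pairing of the
  -- pointwise sum `g`; and, since the partial sums telescope to a difference of low frequency
  -- projections, to the pairing of `f`, the absence of a polynomial part removing the lower end.
  have key : ∀ φ : 𝓢(E4, ℂ), ∫ x, g x * φ x = ∫ x, f x * φ x := fun φ => by
    have h1 : Tendsto (fun n : ℕ => ∫ x, s n x * φ x) atTop (𝓝 (∫ x, g x * φ x)) := by
      have hlt := lintegral_schwartz_mul_lt_top hr₁ hr₂ hS φ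
      refine tendsto_integral_of_dominated_convergence
        (fun x => (‖φ x‖ₑ * ∑' k, ‖conv (lpKer hη k) f x‖ₑ).toReal)
        (fun n => (hsm n).mul φ.continuous.aestronglyMeasurable) ?_ ?_ ?_
      · refine integrable_toReal_of_lintegral_ne_top ?_ hlt.ne
        exact (measurable_enorm_schwartz φ).aemeasurable.mul (AEMeasurable.tsum fun k =>
          (aestronglyMeasurable_conv hfm _).enorm)
      · intro n
        filter_upwards [hS.ae_lt_top (by linarith) (by linarith)] with x hx
        rw [← toReal_enorm, enorm_mul, mul_comm]
        refine ENNReal.toReal_mono (ENNReal.mul_ne_top enorm_ne_top hx.ne) ?_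
        gcongr
        exact (enorm_sum_le _ _).trans (ENNReal.sum_le_tsum _)
      · filter_upwards [hlim] with x hx
        exact hx.mul_const _
    have hint : ∀ k, Integrable fun x => conv (lowKer hη k) f x * φ x := fun k =>
      (ht.conv (lowKer hη k)).integrable_mul_schwartz φ
    have h2 : Tendsto (fun n : ℕ => ∫ x, s n x * φ x) atTop (𝓝 (∫ x, f x * φ x)) := by
      have a1 := (tendsto_integral_lowProj hη ht φ).comp tendsto_natCast_atTop_atTop
      have a2 := (h0 φ).comp (tendsto_neg_atTop_atBot.comp
        (tendsto_natCast_atTop_atTop (R := ℤ)))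
      have a3 := a1.sub a2
      rw [sub_zero] at a3
      refine a3.congr fun n => ?_
      simp only [Function.comp_apply, lpProjLow_eq hη]
      rw [← integral_sub (hint _) (hint _)]
      refine integral_congr_ae (ae_of_all _ fun x => ?_)
      simp only [hs_eq]
      ring
    exact tendsto_nhds_unique h1 h2
  have hgf : ∀ᵐ x, g x - f x = 0 := by
    have hd : IsTemperedFun fun x => g x - f x := by
      have := hgt.add (ht.const_mul (-1))
      refine this.congr (ae_of_all _ fun x => ?_)
      simp [sub_eq_add_neg]
    have hli : LocallyIntegrable fun x => g x - f x := by
      obtain ⟨n, hn⟩ := hd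
      have h1 := hn.locallyIntegrable.continuous_smul
        (g := fun x : E4 => (1 + ‖x‖) ^ n) (by fun_prop)
      refine h1.congr (ae_of_all _ fun x => ?_)
      simp only [smul_smul]
      rw [mul_inv_cancel₀ (by positivity), one_smul]
    refine ae_eq_zero_of_integral_contDiff_smul_eq_zero hli fun φ hφ hφc => ?_
    have hψ : ContDiff ℝ ∞ fun x => (φ x : ℂ) := Complex.ofRealCLM.contDiff.comp hφ
    have hψc : HasCompactSupport fun x => (φ x : ℂ) := hφc.comp_left (g := fun y : ℝ => (y : ℂ))
      Complex.ofReal_zero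
    have h := key (hψc.toSchwartzMap hψ)
    rw [← sub_eq_zero, ← integral_sub (hgt.integrable_mul_schwartz _)
      (ht.integrable_mul_schwartz _)] at h
    rw [← h]
    refine integral_congr_ae (ae_of_all _ fun x => ?_)
    simp only [Complex.real_smul]
    change (φ x : ℂ) * (g x - f x) = g x * (φ x : ℂ) - f x * (φ x : ℂ)
    ring
  filter_upwards [hsum, hgf] with x h1 h2
  rwa [← sub_eq_zero.1 h2]

end

section


variable {η : ℝ → ℝ} (hη : IsLPCutoff η)

/-! ### Geometric sums -/

/-- The sum of the two-sided geometric series `∑ 2^{-c|k|}`. -/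
def geo (c : ℝ) : ℝ≥0∞ := ∑' k : ℤ, ENNReal.ofReal (dyad (-|k|) ^ c)

lemma geo_ne_top {c : ℝ} (hc : 0 < c) : geo c ≠ ⊤ := by
  have h : ∀ k : ℤ, dyad (-|k|) ^ c = ((2 : ℝ) ^ (-c)) ^ k.natAbs := fun k => by
    rw [dyad_eq_rpow, ← Real.rpow_natCast, ← Real.rpow_mul (by norm_num),
      ← Real.rpow_mul (by norm_num), Nat.cast_natAbs]
    congr 1
    push_cast
    ring
  have hs : Summable fun k : ℤ => dyad (-|k|) ^ c := by
    simp_rw [h]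
    have h1 : Summable fun n : ℕ => ((2 : ℝ) ^ (-c)) ^ n := by
      refine summable_geometric_of_lt_one (by positivity) ?_
      exact Real.rpow_lt_one_of_one_lt_of_neg (by norm_num) (by linarith)
    refine Summable.of_nat_of_neg (by simpa using h1) (by simpa using h1)
  unfold geo
  rw [← ENNReal.ofReal_tsum_of_nonneg (fun k => by have := dyad_pos (-|k|); positivity) hs]
  exact ENNReal.ofReal_ne_top

lemma interpolate_weight {C z : ℝ≥0∞} {N a b s r : ℝ} (hN : 0 < N) (hs : 0 ≤ s) (hr : 0 ≤ r)
    (h : s + r = 1) :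
    (C * (ENNReal.ofReal (N ^ a) * z)) ^ s * (C * (ENNReal.ofReal (N ^ b) * z)) ^ r =
      C * (ENNReal.ofReal (N ^ (a * s + b * r)) * z) := by
  have e : ∀ w : ℝ≥0∞, w ^ s * w ^ r = w := fun w => by
    rw [← ENNReal.rpow_add_of_nonneg _ _ hs hr, h, ENNReal.rpow_one]
  rw [ENNReal.mul_rpow_of_nonneg _ _ hs, ENNReal.mul_rpow_of_nonneg _ _ hr,
    ENNReal.mul_rpow_of_nonneg _ _ hs, ENNReal.mul_rpow_of_nonneg _ _ hr,
    ENNReal.ofReal_rpow_of_pos (by positivity), ENNReal.ofReal_rpow_of_pos (by positivity),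
    ← Real.rpow_mul hN.le, ← Real.rpow_mul hN.le, Real.rpow_add hN,
    ENNReal.ofReal_mul (by positivity)]
  calc _ = (C ^ s * C ^ r) * (ENNReal.ofReal (N ^ (a * s)) * ENNReal.ofReal (N ^ (b * r)) *
        (z ^ s * z ^ r)) := by ring
    _ = _ := by rw [e, e]

variable {δ : ℝ} {I : Set ℝ} {b : Bool} {C : ℝ≥0∞} {f : ℤ → ℝ → E4 → ℂ} {β : ℤ → ℝ → ℝ≥0∞}
  {z : ℤ → ℝ≥0∞}

/-! ### Interpolated bounds and summability of pieces -/

namespace Pieces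

variable {hη}

lemma z_lt_top (h : Pieces hη δ I b C f β z) (k : ℤ) : z k < ⊤ :=
  (le_tsum_rpow_two z k).trans_lt h.fin

lemma measurable_enorm (h : Pieces hη δ I b C f β z) (k : ℤ) :
    Measurable (Function.uncurry fun t x => ‖f k t x‖ₑ) := (h.meas k).enorm

lemma measurable_enorm_slice (h : Pieces hη δ I b C f β z) (k : ℤ) (t : ℝ) :
    Measurable fun x => ‖f k t x‖ₑ :=
  (h.measurable_enorm k).comp (measurable_const.prodMk measurable_id)

lemma sup_lt_top (h : Pieces hη δ I b C f β z) (hC : C ≠ ⊤) :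
    ∀ᵐ t ∂(volume.restrict I), ∀ k, β k t < ⊤ := by
  rw [ae_all_iff]
  exact fun k => ae_lt_top_of_lnorm two_pos (h.meas_sup k).aemeasurable
    ((h.sup_two k).trans_lt (ENNReal.mul_lt_top hC.lt_top (h.z_lt_top k)))

/-- The interpolation parameter 2δ/(1 - 2δ) on the L^{1/δ}_t bound multiplies its weight exponent 1
- 2δ to exactly 2δ, the inverse of the weight in `four`. -/
lemma sup_mid (hδ : 0 < δ) (hδ' : δ ≤ 1 / 100) (h : Pieces hη δ I b C f β z) (k : ℤ) :
    lnorm (volume.restrict I) (2 / (1 - 2 * δ)) (β k) ≤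
      C * (ENNReal.ofReal (dyad k ^ (2 * δ)) * z k) := by
  have h0 : 1 - 2 * δ ≠ 0 := by linarith
  have h1 : 0 < 1 - 2 * δ := by linarith
  have hθ : 2 * δ / (1 - 2 * δ) ≤ 1 := by rw [div_le_one h1]; linarith
  refine (lnorm_interpolate (p₁ := 2) (p₂ := 1 / δ) (a := 1 - 2 * δ / (1 - 2 * δ))
    (b := 2 * δ / (1 - 2 * δ)) (by positivity) (by norm_num) (by positivity) (by linarith)
    (by positivity) (by ring) (by field_simp; ring) (h.meas_sup k).aemeasurable).trans ?_
  have hs2 : lnorm (volume.restrict I) 2 (β k) ≤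
      C * (ENNReal.ofReal (dyad k ^ (0 : ℝ)) * z k) := by simpa using h.sup_two k
  refine (mul_le_mul' (ENNReal.rpow_le_rpow hs2 (by linarith))
    (ENNReal.rpow_le_rpow (h.sup_inv k) (by positivity))).trans ?_
  rw [interpolate_weight (dyad_pos k) (by linarith) (by positivity) (by ring)]
  refine le_of_eq ?_
  congr 4
  field_simp
  ring

/-- Interpolates `four` with `sup_inv`: the weight exponent is -2δ(1 - 4δ) + 4δ(1 - 2δ) = 2δ, the
same as in `sup_mid`. Raising the exponent slightly above 4 makes low frequencies summable. -/
lemma low (hδ : 0 < δ) (hδ' : δ ≤ 1 / 100) (hC : C ≠ ⊤) (h : Pieces hη δ I b C f β z) (k : ℤ) :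
    lnorm (volume.restrict I) (1 / δ)
        (fun t => lnorm volume (4 / (1 - 4 * δ)) fun x => ‖f k t x‖ₑ) ≤
      C * (ENNReal.ofReal (dyad k ^ (2 * δ)) * z k) := by
  have h0 : 1 - 4 * δ ≠ 0 := by linarith
  have h1 : 0 < 1 - 4 * δ := by linarith
  have e1 : 4 / (4 / (1 - 4 * δ)) = 1 - 4 * δ := by field_simp
  have hpt : ∀ᵐ t ∂(volume.restrict I), (lnorm volume (4 / (1 - 4 * δ)) fun x => ‖f k t x‖ₑ) ≤
      (lnorm volume 4 fun x => ‖f k t x‖ₑ) ^ (1 - 4 * δ) * β k t ^ (4 * δ) := by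
    filter_upwards [h.sup_lt_top hC, h.le_sup] with t ht ht'
    have := lnorm_le_mul_sup (μ := volume) (p := 4) (q := 4 / (1 - 4 * δ)) (by norm_num)
      (by rw [le_div_iff₀ h1]; linarith) (ht k).ne (ae_of_all _ (ht' k))
    rw [e1] at this
    convert this using 2
    ring_nf
  refine (lnorm_le_mul_rpow (p₁ := 1 / δ) (p₂ := 1 / δ) (a := 1 - 4 * δ) (b := 4 * δ)
    (by positivity) (by positivity) (by positivity) (by linarith) (by linarith)
    (by field_simp; ring) (measurable_lnorm (h.measurable_enorm k)).aemeasurable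
    (h.meas_sup k).aemeasurable hpt).trans ?_
  refine (mul_le_mul' (ENNReal.rpow_le_rpow (h.four k) (by linarith))
    (ENNReal.rpow_le_rpow (h.sup_inv k) (by linarith))).trans ?_
  rw [interpolate_weight (dyad_pos k) (by linarith) (by linarith) (by ring)]
  refine le_of_eq ?_
  congr 4
  ring

end Pieces

lemma ae_lnorm_tsum_lt_top {p δ : ℝ} (hδ : 0 < δ) (hδ' : δ ≤ 1) (hp : 1 ≤ p) (hC : C ≠ ⊤)
    {c : ℝ} (hc : 0 < c) (hz : l2sum z < ⊤) {u : ℤ → ℝ → E4 → ℝ≥0∞}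
    (hu : ∀ k, Measurable (Function.uncurry (u k)))
    (h : ∀ k, lnorm (volume.restrict I) (1 / δ) (fun t => lnorm volume p (u k t)) ≤
      C * (ENNReal.ofReal (dyad (-|k|) ^ c) * z k)) :
    ∀ᵐ t ∂(volume.restrict I), lnorm volume p (fun x => ∑' k, u k t x) < ⊤ := by
  have hm : ∀ k t, Measurable (u k t) := fun k t =>
    (hu k).comp (measurable_const.prodMk measurable_id)
  have h1 : lnorm (volume.restrict I) (1 / δ) (fun t => ∑' k, lnorm volume p (u k t)) < ⊤ := by
    refine (lnorm_tsum_le (by rw [le_div_iff₀ hδ]; linarith)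
      fun k => (measurable_lnorm (hu k)).aemeasurable).trans_lt ?_
    calc _ ≤ ∑' k, C * (ENNReal.ofReal (dyad (-|k|) ^ c) * l2sum z) := by
          refine ENNReal.tsum_le_tsum fun k => (h k).trans ?_
          gcongr
          exact le_tsum_rpow_two z k
      _ = C * (geo c * l2sum z) := by rw [ENNReal.tsum_mul_left, ENNReal.tsum_mul_right]; rfl
      _ < ⊤ := ENNReal.mul_lt_top hC.lt_top (ENNReal.mul_lt_top (geo_ne_top hc).lt_top hz)
  filter_upwards [ae_lt_top_of_lnorm (by positivity)
    (Measurable.tsum fun k => measurable_lnorm (hu k)).aemeasurable h1] with t ht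
  exact (lnorm_tsum_le hp fun k => (hm k t).aemeasurable).trans_lt ht

variable {hη}

/-- Pieces with `k ≥ 0` are summed in L⁴ with weights 2^{-2δk}, those with `k < 0` in the slightly
larger exponent with weights 2^{2δk}; both series are geometric. -/
lemma Pieces.isTame (hδ : 0 < δ) (hδ' : δ ≤ 1 / 100) (hC : C ≠ ⊤) (h : Pieces hη δ I b C f β z) :
    ∀ᵐ t ∂(volume.restrict I), IsTame 4 (4 / (1 - 4 * δ)) fun x => ∑' k, ‖f k t x‖ₑ := by
  have h1 : 0 < 1 - 4 * δ := by linarith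
  set u : ℤ → ℝ → E4 → ℝ≥0∞ := fun k t x => if 0 ≤ k then ‖f k t x‖ₑ else 0 with hu
  set w : ℤ → ℝ → E4 → ℝ≥0∞ := fun k t x => if 0 ≤ k then 0 else ‖f k t x‖ₑ with hw
  have hum : ∀ k, Measurable (Function.uncurry (u k)) := fun k => by
    by_cases hk : 0 ≤ k
    · simpa only [hu, hk, if_true] using h.measurable_enorm k
    · simp only [hu, hk, if_false]; exact measurable_const
  have hwm : ∀ k, Measurable (Function.uncurry (w k)) := fun k => by
    by_cases hk : 0 ≤ k
    · simp only [hw, hk, if_true]; exact measurable_const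
    · simpa only [hw, hk, if_false] using h.measurable_enorm k
  have a1 := ae_lnorm_tsum_lt_top (I := I) (p := 4) (c := 2 * δ) hδ (by linarith) (by norm_num) hC
    (by positivity) h.fin hum fun k => by
      by_cases hk : 0 ≤ k
      · simp only [hu, hk, if_true]
        refine (h.four k).trans (le_of_eq ?_)
        rw [abs_of_nonneg hk, dyad_eq_rpow, dyad_eq_rpow, ← Real.rpow_mul (by norm_num),
          ← Real.rpow_mul (by norm_num)]
        congr 4
        push_cast
        ring
      · simp only [hu, hk, if_false]
        rw [lnorm_zero (by norm_num), lnorm_zero (by positivity)]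
        exact zero_le
  have a2 := ae_lnorm_tsum_lt_top (I := I) (p := 4 / (1 - 4 * δ)) (c := 2 * δ) hδ (by linarith)
    (by rw [le_div_iff₀ h1]; linarith) hC (by positivity) h.fin hwm fun k => by
      by_cases hk : 0 ≤ k
      · simp only [hw, hk, if_true]
        rw [lnorm_zero (by positivity), lnorm_zero (by positivity)]
        exact zero_le
      · simp only [hw, hk, if_false]
        refine (h.low hδ hδ' hC k).trans (le_of_eq ?_)
        rw [abs_of_nonpos (by omega), neg_neg]
  filter_upwards [a1, a2] with t h1 h2
  refine ⟨_, _, Measurable.tsum fun k => (hum k).comp (measurable_const.prodMk measurable_id),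
    Measurable.tsum fun k => (hwm k).comp (measurable_const.prodMk measurable_id), h1, h2,
    fun x => ?_⟩
  rw [← ENNReal.tsum_add]
  refine ENNReal.tsum_le_tsum fun k => ?_
  by_cases hk : 0 ≤ k <;> simp [hu, hw, hk]

/-- The bounds involve moduli only, and the reproducing kernels are real because their symbols are
real and radial. -/
lemma Pieces.conj (h : Pieces hη δ I b C f β z) :
    Pieces hη δ I b C (fun k t x => (starRingEnd ℂ) (f k t x)) β z where
  meas k := Complex.continuous_conj.measurable.comp (h.meas k)
  repr := by
    filter_upwards [h.repr] with t ht k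
    rw [conv_lowKer_conj, ht]
  fin := h.fin
  meas_sup := h.meas_sup
  le_sup := by
    filter_upwards [h.le_sup] with t ht k x
    rw [RCLike.enorm_conj]
    exact ht k x
  sup_two := h.sup_two
  sup_inv := h.sup_inv
  four := by simpa only [RCLike.enorm_conj] using h.four
  topX := by simpa only [RCLike.enorm_conj] using h.topX
  topY := by simpa only [RCLike.enorm_conj] using h.topY

lemma Pieces.mono {C' : ℝ≥0∞} (hC : C ≤ C') (h : Pieces hη δ I b C f β z) :
    Pieces hη δ I b C' f β z where
  meas := h.meas
  repr := h.repr
  fin := h.fin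
  meas_sup := h.meas_sup
  le_sup := h.le_sup
  sup_two k := (h.sup_two k).trans (by gcongr)
  sup_inv k := (h.sup_inv k).trans (by gcongr)
  four k := (h.four k).trans (by gcongr)
  topX hb k := (h.topX hb k).trans (by gcongr)
  topY hb k := (h.topY hb k).trans (by gcongr)

/-- `h` has a decomposition into Littlewood-Paley pieces, with norm `B`. -/
def Decomposes (hη : IsLPCutoff η) (δ : ℝ) (I : Set ℝ) (b : Bool) (C : ℝ≥0∞) (B : ℝ≥0∞)
    (h : ℝ → E4 → ℂ) : Prop :=
  AEStronglyMeasurable (Function.uncurry h) ((volume.restrict I).prod volume) ∧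
  ∃ f β z, Pieces hη δ I b C f β z ∧ l2sum z = B ∧
    ∀ᵐ t ∂(volume.restrict I), ∀ᵐ x, HasSum (fun k => f k t x) (h t x)

lemma Decomposes.mono {C' B : ℝ≥0∞} {h : ℝ → E4 → ℂ} (hC : C ≤ C')
    (hd : Decomposes hη δ I b C B h) : Decomposes hη δ I b C' B h := by
  obtain ⟨hm, f, β, z, h1, h2, h3⟩ := hd
  exact ⟨hm, f, β, z, h1.mono hC, h2, h3⟩

lemma Decomposes.conj {B : ℝ≥0∞} {h : ℝ → E4 → ℂ} (hd : Decomposes hη δ I b C B h) :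
    Decomposes hη δ I b C B fun t x => (starRingEnd ℂ) (h t x) := by
  obtain ⟨hm, f, β, z, h1, h2, h3⟩ := hd
  refine ⟨Complex.continuous_conj.comp_aestronglyMeasurable hm, _, β, z, h1.conj, h2, ?_⟩
  filter_upwards [h3] with t ht
  filter_upwards [ht] with x hx
  exact hx.map (starRingEnd ℂ) Complex.continuous_conj

/-- The dyadic norm is kept abstract as `n`, so that X and Y are treated at once. -/
lemma decomposes_of_isBase (hδ : 0 < δ) (hδ' : δ ≤ 1 / 100) (hC : C ≠ ⊤)
    {n : ℤ → (ℝ → E4 → ℂ) → ℝ≥0∞} (hn : ∀ k g g', (∀ᵐ t ∂(volume.restrict I), g t = g' t) →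
      n k g = n k g')
    (hp : ∀ (f : ℤ → ℝ → E4 → ℂ) (z : ℤ → ℝ≥0∞),
      (∀ k, Measurable (Function.uncurry (f k))) →
      (∀ᵐ t ∂(volume.restrict I), ∀ k, conv (lowKer hη (k + 1)) (f k t) = f k t) →
      l2sum z < ⊤ → (∀ k, n k (f k) ≤ z k) → ∃ β, Pieces hη δ I b C f β z)
    {v : ℝ → E4 → ℂ} (hv : IsBase η I v)
    (hfin : (l2sum fun k => n k fun t => lpProj η k (v t)) < ⊤) :
    Decomposes hη δ I b C (l2sum fun k => n k fun t => lpProj η k (v t)) v := by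
  obtain ⟨V, hVm, hV⟩ := hv.meas
  have hV' : ∀ᵐ t ∂(volume.restrict I), v t =ᵐ[volume] fun x => V (t, x) :=
    Measure.ae_ae_of_ae_prod hV
  -- Convolving the strongly measurable representative makes the pieces jointly measurable.
  -- Convolution ignores null sets, so at almost every time they equal the projections of `v` at
  -- every point.
  set f : ℤ → ℝ → E4 → ℂ := fun k t => conv (lpKer hη k) fun x => V (t, x) with hf
  have hfv : ∀ᵐ t ∂(volume.restrict I), ∀ k, f k t = lpProj η k (v t) := by
    filter_upwards [hV'] with t ht k
    rw [lpProj_eq hη, conv_congr_ae ht]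
  have hrepr : ∀ᵐ t ∂(volume.restrict I), ∀ k, conv (lowKer hη (k + 1)) (f k t) = f k t := by
    filter_upwards [hfv, hv.slice] with t ht hs k
    rw [ht, lpProj_eq hη, conv_lowKer_lpKer hη (by omega) hs.1]
  obtain ⟨β, hβ⟩ := hp f (fun k => n k fun t => lpProj η k (v t))
    (fun k => (stronglyMeasurable_conv (f := fun t x => V (t, x)) hVm _).measurable) hrepr hfin
    (fun k => (hn k _ _ (hfv.mono fun t ht => ht k)).le)
  refine ⟨hv.meas, f, β, _, hβ, rfl, ?_⟩
  have h1 : 0 < 1 - 4 * δ := by linarith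
  filter_upwards [hβ.isTame hδ hδ' hC, hfv, hv.slice] with t ht htv hs
  have he : ∀ k, f k t = conv (lpKer hη k) (v t) := fun k => by rw [htv, lpProj_eq hη]
  simp only [he] at ht ⊢
  exact ae_hasSum_conv_lpKer hη (by norm_num) (by rw [lt_div_iff₀ h1]; linarith) hs ht

lemma mixNorm_congr {q p : ℝ} {g g' : ℝ → E4 → ℂ}
    (h : ∀ᵐ t ∂(volume.restrict I), g t =ᵐ[volume] g' t) : mixNorm I q p g = mixNorm I q p g' := by
  refine eLpNorm_congr_ae ?_
  filter_upwards [h] with t ht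
  exact eLpNorm_congr_ae ht

/-- Whole slices are assumed equal, because the inner norms live on single spheres, which are null
sets. -/
lemma mixSphNorm_congr {q p μ : ℝ} {g g' : ℝ → E4 → ℂ}
    (h : ∀ᵐ t ∂(volume.restrict I), g t = g' t) : mixSphNorm I q p μ g = mixSphNorm I q p μ g' := by
  refine eLpNorm_congr_ae ?_
  filter_upwards [h] with t ht
  rw [ht]

variable (hη)

lemma exists_decomposes (hδ : 0 < δ) (hδ' : δ ≤ 1 / 100) :
    ∃ C : ℝ≥0∞, C ≠ ⊤ ∧ ∀ I : Set ℝ,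
      (∀ v, MemX η δ I v → Decomposes hη δ I true C (normX η δ I v) v) ∧
      ∀ F, MemY η δ I F → Decomposes hη δ I false C (normY η δ I F) F := by
  obtain ⟨C₁, hC₁, h₁⟩ := pieces_of_XN hη hδ hδ'
  obtain ⟨C₂, hC₂, h₂⟩ := pieces_of_YN hη hδ hδ'
  refine ⟨C₁ + C₂, ENNReal.add_ne_top.2 ⟨hC₁, hC₂⟩, fun I => ⟨fun v hv => ?_, fun F hF => ?_⟩⟩
  · refine (decomposes_of_isBase (n := fun k g => XN δ I k g) hδ hδ' hC₁ (fun k g g' h => ?_)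
      (h₁ I) hv.1 hv.2).mono le_self_add
    have h' : ∀ᵐ t ∂(volume.restrict I), g t =ᵐ[volume] g' t := h.mono fun t ht => by rw [ht]
    simp only [XN, mixNorm_congr h']
  · refine (decomposes_of_isBase (n := fun k g => YN δ I k g) hδ hδ' hC₂ (fun k g g' h => ?_)
      (h₂ I) hF.1 hF.2).mono le_add_self
    have h' : ∀ᵐ t ∂(volume.restrict I), g t =ᵐ[volume] g' t := h.mono fun t ht => by rw [ht]
    simp only [YN, mixNorm_congr h', mixSphNorm_congr h]

end

section


/-! ### Square sums over dyadic frequencies -/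

lemma l2sum_eq_lnorm (a : ℤ → ℝ≥0∞) : l2sum a = lnorm Measure.count 2 a := by
  unfold l2sum lnorm
  rw [lintegral_count]
  congr 2
  funext k
  rw [← ENNReal.rpow_natCast]
  norm_num

lemma l2sum_mono {a b : ℤ → ℝ≥0∞} (h : ∀ k, a k ≤ b k) : l2sum a ≤ l2sum b := by
  rw [l2sum_eq_lnorm, l2sum_eq_lnorm]
  exact lnorm_mono (by norm_num) h

lemma l2sum_add_le (a b : ℤ → ℝ≥0∞) : l2sum (fun k => a k + b k) ≤ l2sum a + l2sum b := by
  simp only [l2sum_eq_lnorm]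
  exact lnorm_add_le (by norm_num) (measurable_of_countable _).aemeasurable
    (measurable_of_countable _).aemeasurable

lemma l2sum_tsum_le {ι : Type*} [Countable ι] (a : ι → ℤ → ℝ≥0∞) :
    l2sum (fun k => ∑' i, a i k) ≤ ∑' i, l2sum (a i) := by
  simp only [l2sum_eq_lnorm]
  exact lnorm_tsum_le (by norm_num) fun i => (measurable_of_countable _).aemeasurable

lemma l2sum_const_mul {c : ℝ≥0∞} (hc : c ≠ ⊤) (a : ℤ → ℝ≥0∞) :
    l2sum (fun k => c * a k) = c * l2sum a := by
  simp only [l2sum_eq_lnorm]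
  exact lnorm_const_mul two_pos hc _

lemma l2sum_shift (a : ℤ → ℝ≥0∞) (j : ℤ) : l2sum (fun k => a (k + j)) = l2sum a := by
  unfold l2sum
  congr 1
  exact (Equiv.addRight j).tsum_eq fun k => a k ^ 2

lemma tsum_mul_le_l2sum (a b : ℤ → ℝ≥0∞) : ∑' k, a k * b k ≤ l2sum a * l2sum b := by
  have := lnorm_mul_le (μ := Measure.count) (p₁ := 2) (p₂ := 2) one_pos two_pos two_pos
    (by norm_num) (measurable_of_countable a).aemeasurable (measurable_of_countable b).aemeasurable
  rwa [lnorm_one, lintegral_count, ← l2sum_eq_lnorm, ← l2sum_eq_lnorm] at this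

/-- Young's inequality on ℤ: the sum is a superposition of shifts of `a`, each with the same ℓ²
norm. -/
lemma l2sum_geo_le (σ : ℝ) (a : ℤ → ℝ≥0∞) :
    l2sum (fun N => ∑' k, ENNReal.ofReal (dyad (-|k - N|) ^ σ) * a k) ≤ geo σ * l2sum a := by
  have h : ∀ N, ∑' k, ENNReal.ofReal (dyad (-|k - N|) ^ σ) * a k =
      ∑' j, ENNReal.ofReal (dyad (-|j|) ^ σ) * a (N + j) := fun N => by
    rw [← (Equiv.addLeft N).tsum_eq fun k => ENNReal.ofReal (dyad (-|k - N|) ^ σ) * a k]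
    simp
  simp_rw [h]
  refine (l2sum_tsum_le _).trans (le_of_eq ?_)
  simp_rw [l2sum_const_mul ENNReal.ofReal_ne_top, l2sum_shift a, ENNReal.tsum_mul_right]
  rfl

lemma tsum_geo_le (c : ℝ) (a b : ℤ → ℝ≥0∞) :
    ∑' k : ℤ × ℤ, ENNReal.ofReal (dyad (-|k.1 - k.2|) ^ c) * (a k.1 * b k.2) ≤
      geo c * (l2sum a * l2sum b) := by
  rw [ENNReal.tsum_prod' , ENNReal.tsum_comm]
  have h : ∀ N, ∑' k, ENNReal.ofReal (dyad (-|k - N|) ^ c) * (a k * b N) =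
      (∑' k, ENNReal.ofReal (dyad (-|k - N|) ^ c) * a k) * b N := fun N => by
    rw [← ENNReal.tsum_mul_right]
    simp_rw [mul_assoc]
  simp_rw [h]
  refine (tsum_mul_le_l2sum _ _).trans ?_
  rw [← mul_assoc]
  gcongr
  exact l2sum_geo_le c a

/-- Only for N - 3 ≤ k < N does passing to the absolute value lose anything, and then at most twice
3 in the exponent; hence `dyad 6`. -/
lemma dyad_rpow_sub_le {σ : ℝ} (hσ : 0 ≤ σ) {N k : ℤ} (h : N - 3 ≤ k) :
    dyad (N - k) ^ σ ≤ dyad 6 ^ σ * dyad (-|k - N|) ^ σ := by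
  rw [← Real.mul_rpow (dyad_pos _).le (dyad_pos _).le, ← dyad_add]
  refine Real.rpow_le_rpow (dyad_pos _).le (dyad_mono ?_) hσ
  rcases abs_cases (k - N) with ⟨h1, h2⟩ | ⟨h1, h2⟩ <;> omega

/-- Summation of a trilinear expression which decays off the diagonal. -/
lemma l2sum_trilinear_le {σ c : ℝ} (hσ : 0 ≤ σ) {D : ℝ≥0∞} (hD : D ≠ ⊤) {a₁ a₂ a₃ : ℤ → ℝ≥0∞}
    (h₂ : l2sum a₂ < ⊤) (h₃ : l2sum a₃ < ⊤) (hc : 0 < c) :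
    l2sum (fun N => ∑' k : ℤ × ℤ × ℤ, if N - 3 ≤ k.1 then D * (ENNReal.ofReal (dyad (N - k.1) ^ σ) *
      (ENNReal.ofReal (dyad (-|k.2.1 - k.2.2|) ^ c) * (a₁ k.1 * (a₂ k.2.1 * a₃ k.2.2)))) else 0) ≤
      D * (ENNReal.ofReal (dyad 6 ^ σ) * geo σ * geo c) * (l2sum a₁ * l2sum a₂ * l2sum a₃) := by
  set E := ENNReal.ofReal (dyad 6 ^ σ)
  -- The sum over the two lower frequencies is independent of the output and top frequencies, so it
  -- factors out and is bounded once by Cauchy-Schwarz.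
  set Q := ∑' k : ℤ × ℤ, ENNReal.ofReal (dyad (-|k.1 - k.2|) ^ c) * (a₂ k.1 * a₃ k.2)
  have hQ : Q ≤ geo c * (l2sum a₂ * l2sum a₃) := tsum_geo_le c a₂ a₃
  have hQt : Q ≠ ⊤ := (hQ.trans_lt (ENNReal.mul_lt_top (geo_ne_top hc).lt_top
    (ENNReal.mul_lt_top h₂ h₃))).ne
  have h : ∀ N, (∑' k : ℤ × ℤ × ℤ, if N - 3 ≤ k.1 then D * (ENNReal.ofReal (dyad (N - k.1) ^ σ) *
      (ENNReal.ofReal (dyad (-|k.2.1 - k.2.2|) ^ c) * (a₁ k.1 * (a₂ k.2.1 * a₃ k.2.2)))) else 0) ≤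
      (D * E * Q) * ∑' k, ENNReal.ofReal (dyad (-|k - N|) ^ σ) * a₁ k := fun N => by
    rw [ENNReal.tsum_prod', ← ENNReal.tsum_mul_left]
    refine ENNReal.tsum_le_tsum fun k => ?_
    by_cases hk : N - 3 ≤ k
    · simp only [hk, if_true]
      calc _ = ∑' l : ℤ × ℤ, (D * ENNReal.ofReal (dyad (N - k) ^ σ) * a₁ k) *
            (ENNReal.ofReal (dyad (-|l.1 - l.2|) ^ c) * (a₂ l.1 * a₃ l.2)) := by
            congr 1; funext l; ring
        _ = (D * ENNReal.ofReal (dyad (N - k) ^ σ) * a₁ k) * Q := ENNReal.tsum_mul_left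
        _ ≤ (D * (E * ENNReal.ofReal (dyad (-|k - N|) ^ σ)) * a₁ k) * Q := by
            gcongr
            rw [← ENNReal.ofReal_mul (by have := dyad_pos 6; positivity)]
            exact ENNReal.ofReal_le_ofReal (dyad_rpow_sub_le hσ hk)
        _ = _ := by ring
    · simp [hk]
  refine (l2sum_mono h).trans ?_
  rw [l2sum_const_mul (ENNReal.mul_ne_top (ENNReal.mul_ne_top hD ENNReal.ofReal_ne_top) hQt)]
  calc _ ≤ D * E * (geo c * (l2sum a₂ * l2sum a₃)) * (geo σ * l2sum a₁) := by
        gcongr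
        exact l2sum_geo_le σ a₁
    _ = _ := by ring

/-! ### The space `G` -/

variable {η : ℝ → ℝ} {δ : ℝ} {I : Set ℝ}

lemma sn_add_le {p μ : ℝ} (hp : 1 ≤ p) (hμ : 1 ≤ μ) {S T : E4 → ℝ≥0∞} (hS : Measurable S)
    (hT : Measurable T) : sn p μ (fun x => S x + T x) ≤ sn p μ S + sn p μ T := by
  unfold sn
  refine le_trans (lnorm_mono (by linarith) fun r => lnorm_add_le hμ
    (measurable_slice hS r).aemeasurable (measurable_slice hT r).aemeasurable) ?_
  exact lnorm_add_le hp (measurable_lnorm_slice hS μ).aemeasurable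
    (measurable_lnorm_slice hT μ).aemeasurable

lemma measurable_enorm_slice {g : ℝ → E4 → ℂ} (hg : Measurable (Function.uncurry g)) (t : ℝ) :
    Measurable fun x => ‖g t x‖ₑ :=
  (hg.comp (measurable_const.prodMk measurable_id)).enorm

lemma mixNorm_add_le {q p : ℝ} (hq : 1 ≤ q) (hp : 1 ≤ p) {g g' : ℝ → E4 → ℂ}
    (hg : Measurable (Function.uncurry g)) (hg' : Measurable (Function.uncurry g')) :
    mixNorm I q p (g + g') ≤ mixNorm I q p g + mixNorm I q p g' := by
  simp only [mixNorm_eq_lnorm (by linarith : 0 < q) (by linarith : 0 < p)]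
  refine le_trans (lnorm_mono (by linarith) fun t => ?_) (lnorm_add_le hq
    (measurable_lnorm (f := fun t x => ‖g t x‖ₑ) hg.enorm).aemeasurable
    (measurable_lnorm (f := fun t x => ‖g' t x‖ₑ) hg'.enorm).aemeasurable)
  refine le_trans (lnorm_mono (by linarith) fun x => ?_) (lnorm_add_le hp
    (measurable_enorm_slice hg t).aemeasurable (measurable_enorm_slice hg' t).aemeasurable)
  exact enorm_add_le _ _

lemma mixSphNorm_add_le {q p μ : ℝ} (hq : 1 ≤ q) (hp : 1 ≤ p) (hμ : 1 ≤ μ) {g g' : ℝ → E4 → ℂ}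
    (hg : Measurable (Function.uncurry g)) (hg' : Measurable (Function.uncurry g')) :
    mixSphNorm I q p μ (g + g') ≤ mixSphNorm I q p μ g + mixSphNorm I q p μ g' := by
  simp only [mixSphNorm_eq_lnorm (by linarith : 0 < q) (by linarith : 0 < p)
    (by linarith : 0 < μ)]
  refine le_trans (lnorm_mono (by linarith) fun t => ?_) (lnorm_add_le hq
    (measurable_sn (g := fun t x => ‖g t x‖ₑ) hg.enorm).aemeasurable
    (measurable_sn (g := fun t x => ‖g' t x‖ₑ) hg'.enorm).aemeasurable)
  refine le_trans (sn_mono (by linarith) (by linarith) fun x => ?_) (sn_add_le hp hμ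
    (measurable_enorm_slice hg t) (measurable_enorm_slice hg' t))
  exact enorm_add_le _ _

/-- The quantity which is minimized in the definition of the norm of `G_N`. -/
def splitNorm (δ : ℝ) (I : Set ℝ) (k : ℤ) (g₁ g₂ : ℝ → E4 → ℂ) : ℝ≥0∞ :=
  ENNReal.ofReal (dyad k) * mixNorm I 1 2 g₁ +
    ENNReal.ofReal (dyad k ^ (4 / 7 + nu δ)) *
      mixSphNorm I (2 / (1 + 2 * δ)) (14 / (9 + δ)) 2 g₂

lemma GN_le_splitNorm {k : ℤ} {g g₁ g₂ : ℝ → E4 → ℂ} (h : IsSplitting I k g g₁ g₂) :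
    GN δ I k g ≤ splitNorm δ I k g₁ g₂ := iInf₂_le_of_le g₁ g₂ (iInf_le _ h)

/-- `h ∈ G(I)` with norm at most `B`, where the norms are realized by measurable splittings. -/
structure GBound (η : ℝ → ℝ) (δ : ℝ) (I : Set ℝ) (h : ℝ → E4 → ℂ) (B : ℝ≥0∞) : Prop where
  base : IsBase η I h
  lt_top : B < ⊤
  splitting : ∃ z : ℤ → ℝ≥0∞, l2sum z ≤ B ∧ ∀ k, ∃ g₁ g₂ : ℝ → E4 → ℂ,
    Measurable (Function.uncurry g₁) ∧ Measurable (Function.uncurry g₂) ∧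
    IsSplitting I k (fun t => lpProj η k (h t)) g₁ g₂ ∧ splitNorm δ I k g₁ g₂ ≤ z k

lemma GBound.normG_le {h : ℝ → E4 → ℂ} {B : ℝ≥0∞} (hb : GBound η δ I h B) :
    normG η δ I h ≤ B := by
  obtain ⟨z, hz, h⟩ := hb.splitting
  refine (l2sum_mono fun k => ?_).trans hz
  obtain ⟨g₁, g₂, -, -, h1, h2⟩ := h k
  exact (GN_le_splitNorm h1).trans h2

lemma GBound.memG {h : ℝ → E4 → ℂ} {B : ℝ≥0∞} (hb : GBound η δ I h B) : MemG η δ I h :=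
  ⟨hb.base, hb.normG_le.trans_lt hb.lt_top⟩

lemma HasFrequency.add {k : ℤ} {f g : E4 → ℂ} (hf : HasFrequency k f) (hg : HasFrequency k g) :
    HasFrequency k (f + g) := by
  refine ⟨hf.1.add hg.1, fun ξ hξ => ?_⟩
  by_contra hn
  have h1 : ξ ∉ Distribution.dsupport (fourierDist f) := fun h => hn (hf.2 h)
  have h2 : ξ ∉ Distribution.dsupport (fourierDist g) := fun h => hn (hg.2 h)
  rw [Distribution.notMem_dsupport_iff] at h1 h2
  obtain ⟨s, hs, hso, hξs⟩ := h1
  obtain ⟨t, ht, hto, hξt⟩ := h2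
  refine (Distribution.notMem_dsupport_iff ξ).2 ⟨s ∩ t, fun φ hφ => ?_, hso.inter hto,
    ⟨hξs, hξt⟩⟩ hξ
  have e1 : fourierDist f φ = 0 := hs φ (hφ.trans inter_subset_left)
  have e2 : fourierDist g φ = 0 := ht φ (hφ.trans inter_subset_right)
  simp only [fourierDist, Pi.add_apply, add_mul] at e1 e2 ⊢
  rw [integral_add (hf.1.integrable_mul_schwartz _) (hg.1.integrable_mul_schwartz _), e1, e2,
    add_zero]

lemma IsHomogeneous.congr (hη : IsLPCutoff η) {f g : E4 → ℂ} (hf : IsHomogeneous η f)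
    (h : g =ᵐ[volume] f) : IsHomogeneous η g := by
  refine ⟨hf.1.congr h, ?_⟩
  simp only [lpProjLow_eq hη, conv_congr_ae h]
  simpa only [lpProjLow_eq hη] using hf.2

lemma IsHomogeneous.add (hη : IsLPCutoff η) {f g : E4 → ℂ} (hf : IsHomogeneous η f)
    (hg : IsHomogeneous η g) : IsHomogeneous η (f + g) := by
  refine ⟨hf.1.add hg.1, fun φ => ?_⟩
  have := (hf.2 φ).add (hg.2 φ)
  rw [add_zero] at this
  refine this.congr fun k => ?_
  simp only [lpProjLow_eq hη, conv_add hf.1 hg.1, Pi.add_apply, add_mul]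
  rw [integral_add ((hf.1.conv _).integrable_mul_schwartz _)
    ((hg.1.conv _).integrable_mul_schwartz _)]

lemma IsBase.add (hη : IsLPCutoff η) {f g : ℝ → E4 → ℂ} (hf : IsBase η I f) (hg : IsBase η I g) :
    IsBase η I (f + g) := by
  refine ⟨hf.meas.add hg.meas, ?_⟩
  filter_upwards [hf.slice, hg.slice] with t h1 h2
  exact h1.add hη h2

lemma IsBase.neg (hη : IsLPCutoff η) {f : ℝ → E4 → ℂ} (hf : IsBase η I f) :
    IsBase η I (-f) := by
  refine ⟨hf.meas.neg, ?_⟩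
  filter_upwards [hf.slice] with t h
  have e : (-f) t = fun x => (-1 : ℂ) * f t x := by funext x; simp
  rw [e]
  refine ⟨h.1.const_mul _, fun φ => ?_⟩
  have := (h.2 φ).neg
  rw [neg_zero] at this
  refine this.congr fun k => ?_
  simp only [lpProjLow_eq hη, conv_const_mul, mul_assoc]
  rw [integral_const_mul]
  ring

lemma GBound.mono {h : ℝ → E4 → ℂ} {B B' : ℝ≥0∞} (hb : GBound η δ I h B) (hB : B ≤ B')
    (hB' : B' < ⊤) : GBound η δ I h B' := by
  obtain ⟨z, hz, h⟩ := hb.splitting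
  exact ⟨hb.base, hB', z, hz.trans hB, h⟩

lemma GBound.congr (hη : IsLPCutoff η) {f g : ℝ → E4 → ℂ} {B : ℝ≥0∞} (hf : GBound η δ I f B)
    (hg : AEStronglyMeasurable (Function.uncurry g) ((volume.restrict I).prod volume))
    (h : ∀ᵐ t ∂(volume.restrict I), g t =ᵐ[volume] f t) : GBound η δ I g B := by
  refine ⟨⟨hg, ?_⟩, hf.lt_top, ?_⟩
  · filter_upwards [hf.base.slice, h] with t h1 h2
    exact h1.congr hη h2
  · obtain ⟨z, hz, hs⟩ := hf.splitting
    refine ⟨z, hz, fun k => ?_⟩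
    obtain ⟨g₁, g₂, m1, m2, h1, h2⟩ := hs k
    refine ⟨g₁, g₂, m1, m2, ⟨h1.meas₁, h1.meas₂, h1.freq₁, h1.freq₂, ?_⟩, h2⟩
    filter_upwards [h1.add_eq, h] with t ht ht'
    rw [lpProj_eq hη, conv_congr_ae ht', ← lpProj_eq hη]
    exact ht

/-- Explicit measurable splittings are added componentwise, so no near-minimizers of the infimum
have to be selected. -/
lemma GBound.add (hη : IsLPCutoff η) (hδ : 0 < δ) (hδ' : δ ≤ 1 / 100) {f g : ℝ → E4 → ℂ}
    {B B' : ℝ≥0∞} (hf : GBound η δ I f B) (hg : GBound η δ I g B') :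
    GBound η δ I (f + g) (B + B') := by
  refine ⟨hf.base.add hη hg.base, ENNReal.add_lt_top.2 ⟨hf.lt_top, hg.lt_top⟩, ?_⟩
  obtain ⟨z, hz, hs⟩ := hf.splitting
  obtain ⟨z', hz', hs'⟩ := hg.splitting
  refine ⟨fun k => z k + z' k, (l2sum_add_le z z').trans (add_le_add hz hz'), fun k => ?_⟩
  obtain ⟨g₁, g₂, m1, m2, h1, h2⟩ := hs k
  obtain ⟨g₁', g₂', m1', m2', h1', h2'⟩ := hs' k
  refine ⟨g₁ + g₁', g₂ + g₂', m1.add m1', m2.add m2', ⟨h1.meas₁.add h1'.meas₁,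
    h1.meas₂.add h1'.meas₂, ?_, ?_, ?_⟩, ?_⟩
  · filter_upwards [h1.freq₁, h1'.freq₁] with t a b
    exact a.add b
  · filter_upwards [h1.freq₂, h1'.freq₂] with t a b
    exact a.add b
  · filter_upwards [h1.add_eq, h1'.add_eq, hf.base.slice, hg.base.slice] with t a b c d
    filter_upwards [a, b] with x hx hx'
    rw [lpProj_eq hη] at hx hx' ⊢
    simp only [Pi.add_apply]
    rw [conv_add c.1 d.1, Pi.add_apply, hx, hx']
    ring
  · refine le_trans ?_ (add_le_add h2 h2')
    unfold splitNorm
    have a1 := mixNorm_add_le (I := I) (q := 1) (p := 2) le_rfl (by norm_num) m1 m1'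
    have a2 := mixSphNorm_add_le (I := I) (q := 2 / (1 + 2 * δ)) (p := 14 / (9 + δ)) (μ := 2)
      (by rw [le_div_iff₀ (by linarith)]; linarith) (by rw [le_div_iff₀ (by linarith)]; linarith)
      (by norm_num) m2 m2'
    refine (add_le_add (mul_le_mul_right a1 _) (mul_le_mul_right a2 _)).trans (le_of_eq ?_)
    ring

/-! ### Linearity of `X` -/

lemma XN_add_le (hδ : 0 < δ) (hδ' : δ ≤ 1 / 100) (k : ℤ) {g g' : ℝ → E4 → ℂ}
    (hg : Measurable (Function.uncurry g)) (hg' : Measurable (Function.uncurry g')) :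
    XN δ I k (g + g') ≤ XN δ I k g + XN δ I k g' := by
  unfold XN
  have a1 := mixNorm_add_le (I := I) (q := 1 / δ) (p := 2 / (1 - δ))
    (by rw [le_div_iff₀ hδ]; linarith) (by rw [le_div_iff₀ (by linarith)]; linarith) hg hg'
  have a2 := mixNorm_add_le (I := I) (q := 2) (p := 4) (by norm_num) (by norm_num) hg hg'
  refine (add_le_add (mul_le_mul_right a1 _) (mul_le_mul_right a2 _)).trans (le_of_eq ?_)
  ring

lemma XN_congr {k : ℤ} {g g' : ℝ → E4 → ℂ}
    (h : ∀ᵐ t ∂(volume.restrict I), g t =ᵐ[volume] g' t) : XN δ I k g = XN δ I k g' := by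
  simp only [XN, mixNorm_congr h]

lemma XN_neg (k : ℤ) (g : ℝ → E4 → ℂ) : XN δ I k (-g) = XN δ I k g := by
  simp only [XN, mixNorm, Pi.neg_apply, eLpNorm_neg]

lemma IsBase.exists_lpProj (hη : IsLPCutoff η) {v : ℝ → E4 → ℂ} (hv : IsBase η I v) (k : ℤ) :
    ∃ f : ℝ → E4 → ℂ, Measurable (Function.uncurry f) ∧
      ∀ᵐ t ∂(volume.restrict I), lpProj η k (v t) = f t := by
  obtain ⟨V, hVm, hV⟩ := hv.meas
  refine ⟨fun t => conv (lpKer hη k) fun x => V (t, x),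
    (stronglyMeasurable_conv (f := fun t x => V (t, x)) hVm _).measurable, ?_⟩
  have hV' : ∀ᵐ t ∂(volume.restrict I), v t =ᵐ[volume] fun x => V (t, x) :=
    Measure.ae_ae_of_ae_prod hV
  filter_upwards [hV'] with t ht
  rw [lpProj_eq hη, conv_congr_ae ht]

lemma MemX.add (hη : IsLPCutoff η) (hδ : 0 < δ) (hδ' : δ ≤ 1 / 100) {v w : ℝ → E4 → ℂ}
    (hv : MemX η δ I v) (hw : MemX η δ I w) : MemX η δ I (v + w) := by
  refine ⟨hv.1.add hη hw.1, ?_⟩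
  refine lt_of_le_of_lt ?_ (ENNReal.add_lt_top.2 ⟨hv.2, hw.2⟩)
  refine (l2sum_mono fun k => ?_).trans (l2sum_add_le _ _)
  obtain ⟨f, hf, hvf⟩ := hv.1.exists_lpProj hη k
  obtain ⟨g, hg, hwg⟩ := hw.1.exists_lpProj hη k
  rw [XN_congr (g := fun t => lpProj η k (v t)) (hvf.mono fun t ht => ae_of_all _ (congrFun ht)),
    XN_congr (g := fun t => lpProj η k (w t)) (hwg.mono fun t ht => ae_of_all _ (congrFun ht)),
    XN_congr (g := fun t => lpProj η k ((v + w) t)) (g' := f + g)]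
  · exact XN_add_le hδ hδ' k hf hg
  · filter_upwards [hv.1.slice, hw.1.slice, hvf, hwg] with t h1 h2 h3 h4
    refine ae_of_all _ (congrFun ?_)
    rw [Pi.add_apply, Pi.add_apply, ← h3, ← h4]
    simp only [lpProj_eq hη]
    exact conv_add h1.1 h2.1 _

lemma MemX.neg (hη : IsLPCutoff η) {v : ℝ → E4 → ℂ} (hv : MemX η δ I v) : MemX η δ I (-v) := by
  refine ⟨hv.1.neg hη, ?_⟩
  have h : normX η δ I (-v) = normX η δ I v := by
    unfold normX
    congr 1
    funext k
    rw [← XN_neg]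
    congr 1
    funext t
    have e : -v t = fun x => (-1 : ℂ) * v t x := by funext x; simp
    simp only [Pi.neg_apply, lpProj_eq hη]
    rw [e, conv_const_mul]
    funext x
    simp
  rw [h]
  exact hv.2

lemma MemX.sub (hη : IsLPCutoff η) (hδ : 0 < δ) (hδ' : δ ≤ 1 / 100) {v w : ℝ → E4 → ℂ}
    (hv : MemX η δ I v) (hw : MemX η δ I w) : MemX η δ I (v - w) := by
  rw [sub_eq_add_neg]
  exact hv.add hη hδ hδ' (hw.neg hη)

end

/-! ### Hölder estimates for a single product of three pieces -/

section


variable {η : ℝ → ℝ} {δ : ℝ} {I : Set ℝ}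

/-- The space-time norm of one of the two components of `G_N`, without its weight. -/
def topNorm (δ : ℝ) (I : Set ℝ) (b : Bool) (S : ℝ → E4 → ℝ≥0∞) : ℝ≥0∞ :=
  if b then lnorm (volume.restrict I) 1 fun t => lnorm volume 2 (S t)
  else lnorm (volume.restrict I) (2 / (1 + 2 * δ)) fun t => sn (14 / (9 + δ)) 2 (S t)

/-- The exponent of the weight of one of the two components of `G_N`. -/
def topExp (δ : ℝ) (b : Bool) : ℝ := if b then 1 else 4 / 7 + nu δ

lemma topExp_pos (hδ : 0 < δ) (b : Bool) : 0 < topExp δ b := by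
  unfold topExp nu
  split_ifs <;> linarith

lemma measurable_slice_uncurry {S : ℝ → E4 → ℝ≥0∞} (hS : Measurable (Function.uncurry S)) (t : ℝ) :
    Measurable (S t) := hS.comp (measurable_const.prodMk measurable_id)

lemma topNorm_mono_ae (hδ : 0 < δ) (b : Bool) {S T : ℝ → E4 → ℝ≥0∞}
    (h : ∀ᵐ t ∂(volume.restrict I), ∀ x, S t x ≤ T t x) : topNorm δ I b S ≤ topNorm δ I b T := by
  unfold topNorm
  split_ifs
  · exact lnorm_mono_ae (by norm_num) (h.mono fun t ht => lnorm_mono (by norm_num) ht)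
  · exact lnorm_mono_ae (by positivity) (h.mono fun t ht => sn_mono (by positivity) two_pos ht)

lemma sn_tsum_le {ι : Type*} [Countable ι] {p μ : ℝ} (hp : 1 ≤ p) (hμ : 1 ≤ μ)
    {S : ι → E4 → ℝ≥0∞} (hS : ∀ i, Measurable (S i)) :
    sn p μ (fun x => ∑' i, S i x) ≤ ∑' i, sn p μ (S i) := by
  unfold sn
  refine le_trans (lnorm_mono (by linarith) fun r => lnorm_tsum_le hμ
    fun i => (measurable_slice (hS i) r).aemeasurable) ?_
  exact lnorm_tsum_le hp fun i => (measurable_lnorm_slice (hS i) μ).aemeasurable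

lemma topNorm_tsum_le {ι : Type*} [Countable ι] (hδ : 0 < δ) (hδ' : δ ≤ 1 / 100) (b : Bool)
    {S : ι → ℝ → E4 → ℝ≥0∞} (hS : ∀ i, Measurable (Function.uncurry (S i))) :
    topNorm δ I b (fun t x => ∑' i, S i t x) ≤ ∑' i, topNorm δ I b (S i) := by
  unfold topNorm
  cases b
  · refine le_trans (lnorm_mono (by positivity) fun t => sn_tsum_le
      (by rw [le_div_iff₀ (by linarith)]; linarith) (by norm_num)
      fun i => measurable_slice_uncurry (hS i) t) ?_
    exact lnorm_tsum_le (by rw [le_div_iff₀ (by linarith)]; linarith)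
      fun i => (measurable_sn (hS i)).aemeasurable
  · refine le_trans (lnorm_mono (by norm_num) fun t => lnorm_tsum_le (by norm_num)
      fun i => (measurable_slice_uncurry (hS i) t).aemeasurable) ?_
    exact lnorm_tsum_le le_rfl fun i => (measurable_lnorm (hS i)).aemeasurable

/-- Only the L¹ norm of the kernel enters, which for the kernels of P_N is bounded uniformly in N.
-/
lemma topNorm_lconv_le (hδ : 0 < δ) (hδ' : δ ≤ 1 / 100) (b : Bool) {K : E4 → ℝ≥0∞}
    (hK : Measurable K) (hKr : IsRadial K) (hK' : ∫⁻ x, K x ≠ ⊤) (hKt : ∀ x, K x ≠ ⊤)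
    {S : ℝ → E4 → ℝ≥0∞} (hS : Measurable (Function.uncurry S)) :
    topNorm δ I b (fun t => lconv K (S t)) ≤ (∫⁻ x, K x) * topNorm δ I b S := by
  unfold topNorm
  cases b
  · simp only [Bool.false_eq_true, if_false]
    rw [← lnorm_const_mul (by positivity) hK']
    exact lnorm_mono (by positivity) fun t => sn_two_lconv_le
      (by rw [le_div_iff₀ (by linarith)]; linarith) hK hKr hK' hKt (measurable_slice_uncurry hS t)
  · simp only [if_true]
    rw [← lnorm_const_mul one_pos hK']
    exact lnorm_mono (by norm_num) fun t => lnorm_lconv_le (by norm_num) hK hK'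
      (measurable_slice_uncurry hS t)

lemma splitNorm_eq (hδ : 0 < δ) (b : Bool) (k : ℤ) (g : ℝ → E4 → ℂ) :
    splitNorm δ I k (if b then g else 0) (if b then 0 else g) =
      ENNReal.ofReal (dyad k ^ topExp δ b) * topNorm δ I b fun t x => ‖g t x‖ₑ := by
  unfold splitNorm topNorm topExp
  have h2 : 0 < 2 / (1 + 2 * δ) := by positivity
  have h14 : 0 < 14 / (9 + δ) := by positivity
  rw [mixNorm_eq_lnorm one_pos two_pos, mixSphNorm_eq_lnorm h2 h14 two_pos]
  cases b
  · simp [lnorm_zero]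
  · simp [sn, lnorm_zero, h2, h14]

variable {hη : IsLPCutoff η} {b b₂ b₃ : Bool} {C : ℝ≥0∞}
  {f₁ f₂ f₃ : ℤ → ℝ → E4 → ℂ} {β₁ β₂ β₃ : ℤ → ℝ → ℝ≥0∞} {z₁ z₂ z₃ : ℤ → ℝ≥0∞}

/-- Hölder with L²_t L⁴_x for the top piece, L^{1/δ}_t L⁴_x for the second and L^{2/(1-2δ)}_t L^∞_x
for the third. -/
lemma topNorm_true_term_le (hδ : 0 < δ) (hδ' : δ ≤ 1 / 100) (hC : C ≠ ⊤)
    (h₁ : Pieces hη δ I true C f₁ β₁ z₁) (h₂ : Pieces hη δ I b₂ C f₂ β₂ z₂)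
    (h₃ : Pieces hη δ I b₃ C f₃ β₃ z₃) (k l m : ℤ) :
    topNorm δ I true (fun t x => ‖f₁ k t x‖ₑ * (‖f₂ l t x‖ₑ * ‖f₃ m t x‖ₑ)) ≤
      (C * (ENNReal.ofReal (dyad k ^ (-topExp δ true)) * z₁ k)) *
        ((C * (ENNReal.ofReal (dyad l ^ (-(2 * δ))) * z₂ l)) *
          (C * (ENNReal.ofReal (dyad m ^ (2 * δ)) * z₃ m))) := by
  have h0 : 1 - 2 * δ ≠ 0 := by linarith
  have h1 : 0 < 1 - 2 * δ := by linarith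
  have hpt : ∀ᵐ t ∂(volume.restrict I),
      (lnorm volume 2 fun x => ‖f₁ k t x‖ₑ * (‖f₂ l t x‖ₑ * ‖f₃ m t x‖ₑ)) ≤
        (lnorm volume 4 fun x => ‖f₁ k t x‖ₑ) * ((lnorm volume 4 fun x => ‖f₂ l t x‖ₑ) *
          β₃ m t) := by
    filter_upwards [h₃.sup_lt_top hC, h₃.le_sup] with t ht ht'
    calc _ ≤ lnorm volume 2 fun x => β₃ m t * (‖f₁ k t x‖ₑ * ‖f₂ l t x‖ₑ) := by
          refine lnorm_mono (by norm_num) fun x => ?_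
          rw [← mul_assoc, mul_comm (β₃ m t)]
          gcongr
          exact ht' m x
      _ = β₃ m t * lnorm volume 2 fun x => ‖f₁ k t x‖ₑ * ‖f₂ l t x‖ₑ :=
          lnorm_const_mul two_pos (ht m).ne _
      _ ≤ β₃ m t * ((lnorm volume 4 fun x => ‖f₁ k t x‖ₑ) * lnorm volume 4 fun x => ‖f₂ l t x‖ₑ) := by
          gcongr
          exact lnorm_mul_le two_pos (by norm_num) (by norm_num) (by norm_num)
            (h₁.measurable_enorm_slice k t).aemeasurable (h₂.measurable_enorm_slice l t).aemeasurable
      _ = _ := by ring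
  have m1 : AEMeasurable (fun t => lnorm volume 4 fun x => ‖f₁ k t x‖ₑ) (volume.restrict I) :=
    (measurable_lnorm (h₁.measurable_enorm k)).aemeasurable
  have m2 : AEMeasurable (fun t => lnorm volume 4 fun x => ‖f₂ l t x‖ₑ) (volume.restrict I) :=
    (measurable_lnorm (h₂.measurable_enorm l)).aemeasurable
  have m3 : AEMeasurable (β₃ m) (volume.restrict I) := (h₃.meas_sup m).aemeasurable
  simp only [topNorm, if_true]
  refine (lnorm_mono_ae (by norm_num) hpt).trans ?_
  refine (lnorm_mul_le (p₁ := 2) (p₂ := 2) one_pos two_pos two_pos (by norm_num) m1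
    (m2.mul m3)).trans ?_
  refine mul_le_mul' ?_ ?_
  · simpa [topExp] using h₁.topX rfl k
  · refine (lnorm_mul_le (p₁ := 1 / δ) (p₂ := 2 / (1 - 2 * δ)) two_pos (by positivity)
      (by positivity) (by field_simp; ring) m2 m3).trans ?_
    exact mul_le_mul' (h₂.four l) (h₃.sup_mid hδ hδ' m)

/-- Hölder with `topY` for the top piece and L^{1/δ}_t in time for both others, with spatial
exponents 4 and 4/(1 - 4δ). Their product lies in L^{2/(1-2δ)}_x, where the radial and angular
exponents coincide; both balances are exact: (9 + δ)/14 = (2 + 15δ)/14 + (1 - 2δ)/2 and 1/2 = δ + (1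
- 2δ)/2. -/
lemma topNorm_false_term_le (hδ : 0 < δ) (hδ' : δ ≤ 1 / 100) (hC : C ≠ ⊤)
    (h₁ : Pieces hη δ I false C f₁ β₁ z₁) (h₂ : Pieces hη δ I b₂ C f₂ β₂ z₂)
    (h₃ : Pieces hη δ I b₃ C f₃ β₃ z₃) (k l m : ℤ) :
    topNorm δ I false (fun t x => ‖f₁ k t x‖ₑ * (‖f₂ l t x‖ₑ * ‖f₃ m t x‖ₑ)) ≤
      (C * (ENNReal.ofReal (dyad k ^ (-topExp δ false)) * z₁ k)) *
        ((C * (ENNReal.ofReal (dyad l ^ (-(2 * δ))) * z₂ l)) *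
          (C * (ENNReal.ofReal (dyad m ^ (2 * δ)) * z₃ m))) := by
  have h0 : 1 - 2 * δ ≠ 0 := by linarith
  have h1 : 0 < 1 - 2 * δ := by linarith
  have h0' : 1 - 4 * δ ≠ 0 := by linarith
  have h1' : 0 < 1 - 4 * δ := by linarith
  have hpt : ∀ t,
      (sn (14 / (9 + δ)) 2 fun x => ‖f₁ k t x‖ₑ * (‖f₂ l t x‖ₑ * ‖f₃ m t x‖ₑ)) ≤
        (sn (14 / (2 + 15 * δ)) (1 / δ) fun x => ‖f₁ k t x‖ₑ) *
          ((lnorm volume 4 fun x => ‖f₂ l t x‖ₑ) *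
            lnorm volume (4 / (1 - 4 * δ)) fun x => ‖f₃ m t x‖ₑ) := fun t => by
    have s1 := h₁.measurable_enorm_slice k t
    have s2 := h₂.measurable_enorm_slice l t
    have s3 := h₃.measurable_enorm_slice m t
    refine (sn_mul_le (p₁ := 14 / (2 + 15 * δ)) (p₂ := 2 / (1 - 2 * δ)) (μ₁ := 1 / δ)
      (μ₂ := 2 / (1 - 2 * δ)) (by positivity) (by positivity) (by positivity) two_pos
      (by positivity) (by positivity) (by field_simp; ring) (by field_simp; ring) s1
      (s2.mul s3)).trans ?_
    gcongr
    rw [sn_self (by positivity) (s2.mul s3)]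
    exact lnorm_mul_le (by positivity) (by norm_num) (by positivity) (by field_simp; ring)
      s2.aemeasurable s3.aemeasurable
  have m1 : AEMeasurable (fun t => sn (14 / (2 + 15 * δ)) (1 / δ) fun x => ‖f₁ k t x‖ₑ)
      (volume.restrict I) := (measurable_sn (h₁.measurable_enorm k)).aemeasurable
  have m2 : AEMeasurable (fun t => lnorm volume 4 fun x => ‖f₂ l t x‖ₑ) (volume.restrict I) :=
    (measurable_lnorm (h₂.measurable_enorm l)).aemeasurable
  have m3 : AEMeasurable (fun t => lnorm volume (4 / (1 - 4 * δ)) fun x => ‖f₃ m t x‖ₑ)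
      (volume.restrict I) := (measurable_lnorm (h₃.measurable_enorm m)).aemeasurable
  simp only [topNorm, Bool.false_eq_true, if_false]
  refine (lnorm_mono (by positivity) hpt).trans ?_
  refine (lnorm_mul_le (p₁ := 2 / (1 - 2 * δ)) (p₂ := 1 / (2 * δ)) (by positivity)
    (by positivity) (by positivity) (by field_simp; ring) m1 (m2.mul m3)).trans ?_
  refine mul_le_mul' ?_ ?_
  · simpa [topExp] using h₁.topY rfl k
  · refine (lnorm_mul_le (p₁ := 1 / δ) (p₂ := 1 / δ) (by positivity) (by positivity)
      (by positivity) (by field_simp; ring) m2 m3).trans ?_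
    exact mul_le_mul' (h₂.four l) (h₃.low hδ hδ' hC m)

lemma topNorm_term_le_of_le (hδ : 0 < δ) (hδ' : δ ≤ 1 / 100) (hC : C ≠ ⊤)
    (h₁ : Pieces hη δ I b C f₁ β₁ z₁) (h₂ : Pieces hη δ I b₂ C f₂ β₂ z₂)
    (h₃ : Pieces hη δ I b₃ C f₃ β₃ z₃) (N k : ℤ) {l m : ℤ} (hlm : m ≤ l) :
    ENNReal.ofReal (dyad N ^ topExp δ b) *
      topNorm δ I b (fun t x => ‖f₁ k t x‖ₑ * (‖f₂ l t x‖ₑ * ‖f₃ m t x‖ₑ)) ≤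
      C ^ 3 * (ENNReal.ofReal (dyad (N - k) ^ topExp δ b) *
        (ENNReal.ofReal (dyad (-|l - m|) ^ (2 * δ)) * (z₁ k * (z₂ l * z₃ m)))) := by
  have h : topNorm δ I b (fun t x => ‖f₁ k t x‖ₑ * (‖f₂ l t x‖ₑ * ‖f₃ m t x‖ₑ)) ≤
      (C * (ENNReal.ofReal (dyad k ^ (-topExp δ b)) * z₁ k)) *
        ((C * (ENNReal.ofReal (dyad l ^ (-(2 * δ))) * z₂ l)) *
          (C * (ENNReal.ofReal (dyad m ^ (2 * δ)) * z₃ m))) := by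
    cases b
    · exact topNorm_false_term_le hδ hδ' hC h₁ h₂ h₃ k l m
    · exact topNorm_true_term_le hδ hδ' hC h₁ h₂ h₃ k l m
  have e1 : ENNReal.ofReal (dyad (N - k) ^ topExp δ b) =
      ENNReal.ofReal (dyad N ^ topExp δ b) * ENNReal.ofReal (dyad k ^ (-topExp δ b)) := by
    have := dyad_pos N
    rw [← ENNReal.ofReal_mul (by positivity)]
    congr 1
    simp only [dyad_eq_rpow, ← Real.rpow_mul (by norm_num : (0 : ℝ) ≤ 2)]
    rw [← Real.rpow_add two_pos]
    congr 1
    push_cast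
    ring
  have e2 : ENNReal.ofReal (dyad (-|l - m|) ^ (2 * δ)) =
      ENNReal.ofReal (dyad l ^ (-(2 * δ))) * ENNReal.ofReal (dyad m ^ (2 * δ)) := by
    have := dyad_pos l
    rw [← ENNReal.ofReal_mul (by positivity), abs_of_nonneg (by omega)]
    congr 1
    simp only [dyad_eq_rpow, ← Real.rpow_mul (by norm_num : (0 : ℝ) ≤ 2)]
    rw [← Real.rpow_add two_pos]
    congr 1
    push_cast
    ring
  refine (mul_le_mul_right h _).trans (le_of_eq ?_)
  rw [e1, e2]
  ring

/-- The two lower factors play symmetric roles, so the one at the higher frequency may always be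
given the decaying weight. -/
lemma topNorm_term_le (hδ : 0 < δ) (hδ' : δ ≤ 1 / 100) (hC : C ≠ ⊤)
    (h₁ : Pieces hη δ I b C f₁ β₁ z₁) (h₂ : Pieces hη δ I b₂ C f₂ β₂ z₂)
    (h₃ : Pieces hη δ I b₃ C f₃ β₃ z₃) (N k l m : ℤ) :
    ENNReal.ofReal (dyad N ^ topExp δ b) *
      topNorm δ I b (fun t x => ‖f₁ k t x‖ₑ * (‖f₂ l t x‖ₑ * ‖f₃ m t x‖ₑ)) ≤
      C ^ 3 * (ENNReal.ofReal (dyad (N - k) ^ topExp δ b) *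
        (ENNReal.ofReal (dyad (-|l - m|) ^ (2 * δ)) * (z₁ k * (z₂ l * z₃ m)))) := by
  rcases le_total m l with h | h
  · exact topNorm_term_le_of_le hδ hδ' hC h₁ h₂ h₃ N k h
  · have := topNorm_term_le_of_le hδ hδ' hC h₁ h₃ h₂ N k h
    rw [abs_sub_comm, mul_comm (z₂ l)]
    simpa only [mul_comm ‖f₃ m _ _‖ₑ] using this

end

/-! ### Paraproducts -/

section


variable {η : ℝ → ℝ} (hη : IsLPCutoff η)

lemma lowSym_eq_zero_of_lt {k : ℤ} {ξ : E4} (h : 8 / 5 * dyad k / (2 * Real.pi) < ‖ξ‖) :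
    lowSym hη k ξ = 0 := by
  rw [lowSym_apply, lpSymbolLow_eq_zero hη, Complex.ofReal_zero]
  rw [norm_two_pi_smul]
  rw [div_lt_iff₀ (by positivity)] at h
  linarith

lemma spectrumInBall_mul {R : ℝ} {k : ℤ} {g f : E4 → ℂ} (hg : SpectrumInBall R g)
    (hgm : Measurable g) (hfm : Measurable f) {a c : ℝ≥0∞} (ha : a < ⊤) (hc : c < ⊤)
    (hga : ∀ x, ‖g x‖ₑ ≤ a) (hfc : ∀ x, ‖f x‖ₑ ≤ c)
    (hk : conv (lowKer hη (k + 1)) f = f) :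
    SpectrumInBall (R + 8 / 5 * dyad (k + 1) / (2 * Real.pi)) fun x => g x * f x := by
  have hb : ∀ {u : E4 → ℂ} {d : ℝ≥0∞}, d < ⊤ → (∀ x, ‖u x‖ₑ ≤ d) → ∀ x, ‖u x‖ ≤ d.toReal :=
    fun {u d} hd h x => by
      rw [← toReal_enorm]
      exact ENNReal.toReal_mono hd.ne (h x)
  have := hg.mul_conv (isRadial_lowSym hη (k + 1)) (fun ξ => lowSym_eq_zero_of_lt hη)
    hgm.aestronglyMeasurable (hb ha hga) hfm.aestronglyMeasurable (hb hc hfc)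
  change SpectrumInBall _ fun x => g x * conv (lowKer hη (k + 1)) f x at this
  rwa [hk] at this

/-- Each factor has spectrum in a ball of radius (8/5)2^{k+1}, so the product has radius at most 4.8
· 2^{k+1}. The symbol of P_N vanishes up to (5/8)2^N ≥ 5 · 2^{k+1}; this is what fixes the offset 4.
-/
lemma conv_lpKer_mul_eq_zero {N k l m : ℤ} (hl : l ≤ k) (hm : m ≤ k) (hN : k + 4 ≤ N)
    {f g h : E4 → ℂ} (hf : Measurable f) (hg : Measurable g) (hh : Measurable h)
    {a b c : ℝ≥0∞} (ha : a < ⊤) (hb : b < ⊤) (hc : c < ⊤) (hfa : ∀ x, ‖f x‖ₑ ≤ a)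
    (hgb : ∀ x, ‖g x‖ₑ ≤ b) (hhc : ∀ x, ‖h x‖ₑ ≤ c) (hk : conv (lowKer hη (k + 1)) f = f)
    (hl' : conv (lowKer hη (l + 1)) g = g) (hm' : conv (lowKer hη (m + 1)) h = h) :
    conv (lpKer hη N) (fun x => f x * (g x * h x)) = 0 := by
  have s1 := spectrumInBall_mul hη spectrumInBall_one measurable_const hf ENNReal.one_lt_top ha
    (fun x => by simp) hfa hk
  simp only [one_mul] at s1
  have s2 := spectrumInBall_mul hη s1 hf hg ha hb hfa hgb hl'
  have s3 := spectrumInBall_mul hη s2 (hf.mul hg) hh (ENNReal.mul_lt_top ha hb) hc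
    (fun x => by simp only [enorm_mul]; exact mul_le_mul' (hfa x) (hgb x)) hhc hm'
  simp only [mul_assoc] at s3
  refine s3.conv_eq_zero (isRadial_lpSym hη N) fun ξ hξ => lpSym_eq_zero_of_le hη ?_
  have h1 : dyad (l + 1) ≤ dyad (k + 1) := dyad_mono (by omega)
  have h2 : dyad (m + 1) ≤ dyad (k + 1) := dyad_mono (by omega)
  have h3 : dyad (k + 4) ≤ dyad N := dyad_mono hN
  have h4 : dyad (k + 4) = 8 * dyad (k + 1) := by
    rw [show k + 4 = (k + 1) + 3 by ring, dyad_add]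
    norm_num [dyad, mul_comm]
  have h5 := dyad_pos (k + 1)
  rw [norm_two_pi_smul]
  rw [zero_add, ← add_div, ← add_div, le_div_iff₀ (by positivity)] at hξ
  linarith

/-- The terms annihilated by the convolution have to be discarded before taking absolute values.
Absolute convergence permits the exchange of sum and integral. -/
lemma enorm_conv_tsum_le {ι : Type*} [Countable ι] {F : ι → E4 → ℂ} (hF : ∀ i, Measurable (F i))
    (K : 𝓢(E4, ℂ)) (P : Set ι) (hP : ∀ i ∉ P, conv K (F i) = 0) (x : E4)
    (hfin : ∫⁻ y, ‖K (x - y)‖ₑ * ∑' i, ‖F i y‖ₑ < ⊤) :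
    ‖conv K (fun y => ∑' i, F i y) x‖ₑ ≤
      lconv (fun y => ‖K y‖ₑ) (fun y => ∑' i, P.indicator (fun i => ‖F i y‖ₑ) i) x := by
  have hK : Measurable fun y => K (x - y) :=
    (K.continuous.comp (continuous_const.sub continuous_id)).measurable
  have hKF : ∀ i, Measurable fun y => K (x - y) * F i y := fun i => hK.mul (hF i)
  have hsum : conv K (fun y => ∑' i, F i y) x = ∑' i, conv K (F i) x := by
    unfold conv
    rw [← integral_tsum (fun i => (hKF i).aestronglyMeasurable)]
    · congr 1; funext y
      rw [tsum_mul_left]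
    · rw [← lintegral_tsum fun i => (hKF i).enorm.aemeasurable]
      refine ne_of_lt (lt_of_eq_of_lt ?_ hfin)
      refine lintegral_congr fun y => ?_
      rw [← ENNReal.tsum_mul_left]
      simp only [enorm_mul]
  rw [hsum]
  refine enorm_tsum_le_tsum_enorm.trans ?_
  unfold lconv
  have e : ∀ y, ‖K (x - y)‖ₑ * ∑' i, P.indicator (fun i => ‖F i y‖ₑ) i =
      ∑' i, ‖K (x - y)‖ₑ * P.indicator (fun i => ‖F i y‖ₑ) i := fun y => by
    rw [ENNReal.tsum_mul_left]
  have hind : ∀ i, Measurable fun y => P.indicator (fun i => ‖F i y‖ₑ) i := fun i => by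
    by_cases hi : i ∈ P
    · simpa only [indicator_of_mem hi] using (hF i).enorm
    · simp only [indicator_of_notMem hi]; exact measurable_const
  have hm : ∀ i, Measurable fun y => ‖K (x - y)‖ₑ * P.indicator (fun i => ‖F i y‖ₑ) i :=
    fun i => hK.enorm.mul (hind i)
  simp only [e]
  rw [lintegral_tsum fun i => (hm i).aemeasurable]
  refine ENNReal.tsum_le_tsum fun i => ?_
  by_cases hi : i ∈ P
  · simp only [indicator_of_mem hi]
    exact enorm_conv_le_lintegral _ _ _
  · rw [hP i hi]
    simp

/-- The triple series factors, and abc ≤ (a + b + c)³ reduces the product to the cube of a single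
function. -/
lemma isTame_triple {q : ℝ} (hq : 1 ≤ q) {g₁ g₂ g₃ : ℤ → E4 → ℂ}
    (h₁ : IsTame 4 q fun x => ∑' k, ‖g₁ k x‖ₑ) (h₂ : IsTame 4 q fun x => ∑' k, ‖g₂ k x‖ₑ)
    (h₃ : IsTame 4 q fun x => ∑' k, ‖g₃ k x‖ₑ) :
    IsTame (4 / 3) (q / 3) fun x =>
      ∑' k : ℤ × ℤ × ℤ, ‖g₁ k.1 x‖ₑ * (‖g₂ k.2.1 x‖ₑ * ‖g₃ k.2.2 x‖ₑ) := by
  refine (((h₁.add (by norm_num) hq h₂).add (by norm_num) hq h₃).cube (by norm_num)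
    (by linarith)).mono fun x => ?_
  have e : ∑' k : ℤ × ℤ × ℤ, ‖g₁ k.1 x‖ₑ * (‖g₂ k.2.1 x‖ₑ * ‖g₃ k.2.2 x‖ₑ) =
      (∑' k, ‖g₁ k x‖ₑ) * ((∑' k, ‖g₂ k x‖ₑ) * ∑' k, ‖g₃ k x‖ₑ) := by
    rw [ENNReal.tsum_prod']
    simp_rw [ENNReal.tsum_mul_left, ENNReal.tsum_prod', ENNReal.tsum_mul_left,
      ENNReal.tsum_mul_right]
  rw [e]
  set a := ∑' k, ‖g₁ k x‖ₑ
  set b := ∑' k, ‖g₂ k x‖ₑ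
  set c := ∑' k, ‖g₃ k x‖ₑ
  calc a * (b * c) ≤ (a + b + c) * ((a + b + c) * (a + b + c)) := by
        gcongr
        · exact le_self_add.trans le_self_add
        · exact le_add_self.trans le_self_add
        · exact le_add_self
    _ = _ := by ring

/-- A paraproduct: a sum of products of pieces over a set of frequencies. -/
def triSum (R : Set (ℤ × ℤ × ℤ)) (f₁ f₂ f₃ : ℤ → ℝ → E4 → ℂ) (t : ℝ) (x : E4) : ℂ :=
  ∑' k, R.indicator (fun k : ℤ × ℤ × ℤ => f₁ k.1 t x * (f₂ k.2.1 t x * f₃ k.2.2 t x)) k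

lemma measurable_indicator_index {ι α β : Type*} [MeasurableSpace α] [MeasurableSpace β] [Zero β]
    (R : Set ι) {F : ι → α → β} (hF : ∀ i, Measurable (F i)) (i : ι) :
    Measurable fun a => R.indicator (fun i => F i a) i := by
  by_cases hi : i ∈ R
  · simpa only [indicator_of_mem hi] using hF i
  · simp only [indicator_of_notMem hi]; exact measurable_const

variable {hη} {δ : ℝ} {I : Set ℝ} {b b₂ b₃ : Bool} {C : ℝ≥0∞}
  {f₁ f₂ f₃ : ℤ → ℝ → E4 → ℂ} {β₁ β₂ β₃ : ℤ → ℝ → ℝ≥0∞} {z₁ z₂ z₃ : ℤ → ℝ≥0∞}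

lemma hasFrequency_zero (hη : IsLPCutoff η) (k : ℤ) : HasFrequency k (0 : E4 → ℂ) := by
  have h0 : IsTemperedFun (0 : E4 → ℂ) := ⟨0, by simp⟩
  have := hasFrequency_conv hη k h0
  have e : conv (lpKer hη k) (0 : E4 → ℂ) = 0 := by
    funext x
    simp [conv]
  rwa [e] at this

lemma lintegral_lpKer_le (hη : IsLPCutoff η) (k : ℤ) :
    ∫⁻ x, ‖lpKer hη k x‖ₑ ≤ 2 * ∫⁻ x, ‖lowKer hη 0 x‖ₑ := by
  have h : ∀ j, ∫⁻ x, ‖lowKer hη j x‖ₑ = ∫⁻ x, ‖lowKer hη 0 x‖ₑ := fun j => by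
    have := lnorm_lowKer hη one_pos j
    rw [lnorm_one, lnorm_one] at this
    rw [this]
    norm_num
  calc ∫⁻ x, ‖lpKer hη k x‖ₑ ≤ ∫⁻ x, (‖lowKer hη k x‖ₑ + ‖lowKer hη (k - 1) x‖ₑ) := by
        refine lintegral_mono fun x => ?_
        rw [lpKer_eq]
        exact enorm_sub_le
    _ = (∫⁻ x, ‖lowKer hη k x‖ₑ) + ∫⁻ x, ‖lowKer hη (k - 1) x‖ₑ :=
        lintegral_add_left (measurable_enorm_schwartz _) _
    _ = _ := by rw [h k, h (k - 1), two_mul]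

lemma lintegral_schwartz_ne_top (K : 𝓢(E4, ℂ)) : ∫⁻ x, ‖K x‖ₑ ≠ ⊤ := by
  have := lnorm_schwartz_lt_top one_pos K
  rw [lnorm_one] at this
  exact this.ne

/-- The constant in the bound of paraproducts. -/
def triConst (hη : IsLPCutoff η) (δ : ℝ) (b : Bool) (C : ℝ≥0∞) : ℝ≥0∞ :=
  (2 * ∫⁻ x, ‖lowKer hη 0 x‖ₑ) * C ^ 3 *
    (ENNReal.ofReal (dyad 6 ^ topExp δ b) * geo (topExp δ b) * geo (2 * δ))

lemma triConst_ne_top (hδ : 0 < δ) (hC : C ≠ ⊤) : triConst hη δ b C ≠ ⊤ := by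
  have h1 := lintegral_schwartz_ne_top (lowKer hη 0)
  have h2 := geo_ne_top (topExp_pos hδ b)
  have h3 : geo (2 * δ) ≠ ⊤ := geo_ne_top (by positivity)
  have h4 : C ^ 3 ≠ ⊤ := ENNReal.pow_ne_top hC
  exact ENNReal.mul_ne_top (ENNReal.mul_ne_top (ENNReal.mul_ne_top (by norm_num) h1) h4)
    (ENNReal.mul_ne_top (ENNReal.mul_ne_top ENNReal.ofReal_ne_top h2) h3)

/-- The trilinear estimate for paraproducts with highest frequency on the first factor. -/
lemma gBound_triSum (hδ : 0 < δ) (hδ' : δ ≤ 1 / 100) (hC : C ≠ ⊤)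
    (h₁ : Pieces hη δ I b C f₁ β₁ z₁) (h₂ : Pieces hη δ I b₂ C f₂ β₂ z₂)
    (h₃ : Pieces hη δ I b₃ C f₃ β₃ z₃) {R : Set (ℤ × ℤ × ℤ)}
    (hR : ∀ k ∈ R, k.2.1 ≤ k.1 ∧ k.2.2 ≤ k.1) :
    GBound η δ I (triSum R f₁ f₂ f₃)
      (triConst hη δ b C * (l2sum z₁ * l2sum z₂ * l2sum z₃)) := by
  have hq0 : 0 < 1 - 4 * δ := by linarith
  have hq : 1 ≤ 4 / (1 - 4 * δ) := by rw [le_div_iff₀ hq0]; linarith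
  have hq3 : 1 < 4 / (1 - 4 * δ) / 3 := by
    rw [lt_div_iff₀ (by norm_num), lt_div_iff₀ hq0]; linarith
  have hFm : ∀ k : ℤ × ℤ × ℤ, Measurable fun a : ℝ × E4 =>
      f₁ k.1 a.1 a.2 * (f₂ k.2.1 a.1 a.2 * f₃ k.2.2 a.1 a.2) := fun k =>
    (h₁.meas k.1).mul ((h₂.meas k.2.1).mul (h₃.meas k.2.2))
  set F : ℤ × ℤ × ℤ → ℝ → E4 → ℂ := fun k t x =>
    R.indicator (fun k : ℤ × ℤ × ℤ => f₁ k.1 t x * (f₂ k.2.1 t x * f₃ k.2.2 t x)) k with hF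
  have hFm' : ∀ k, Measurable (Function.uncurry (F k)) := measurable_indicator_index R hFm
  have hTm : Measurable (Function.uncurry (triSum R f₁ f₂ f₃)) := Measurable.tsum hFm'
  have hFle : ∀ k t x, ‖F k t x‖ₑ ≤ ‖f₁ k.1 t x‖ₑ * (‖f₂ k.2.1 t x‖ₑ * ‖f₃ k.2.2 t x‖ₑ) :=
    fun k t x => by
      rw [← enorm_mul, ← enorm_mul]
      by_cases hk : k ∈ R
      · simp [hF, hk]
      · simp [hF, hk]
  have htame : ∀ᵐ t ∂(volume.restrict I), IsTame (4 / 3) (4 / (1 - 4 * δ) / 3) fun x =>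
      ∑' k, ‖F k t x‖ₑ := by
    filter_upwards [h₁.isTame hδ hδ' hC, h₂.isTame hδ hδ' hC, h₃.isTame hδ hδ' hC] with t a1 a2 a3
    exact (isTame_triple hq a1 a2 a3).mono fun x => ENNReal.tsum_le_tsum fun k => hFle k t x
  have hslice : ∀ᵐ t ∂(volume.restrict I), IsHomogeneous η (triSum R f₁ f₂ f₃ t) := by
    filter_upwards [htame] with t ht
    exact (ht.mono fun x => enorm_tsum_le_tsum_enorm).isHomogeneous hη (by norm_num) hq3
      (hTm.comp (measurable_const.prodMk measurable_id)).aestronglyMeasurable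
  have hbase : IsBase η I (triSum R f₁ f₂ f₃) := ⟨hTm.aestronglyMeasurable, hslice⟩
  -- The majorant before projection to frequency 2^N: only triples whose top frequency is at least
  -- 2^{N-3} survive P_N.
  set S : ℤ → ℝ → E4 → ℝ≥0∞ := fun N t x =>
    ∑' k, {k : ℤ × ℤ × ℤ | N - 3 ≤ k.1}.indicator (fun k => ‖F k t x‖ₑ) k with hS
  have hSm : ∀ N, Measurable (Function.uncurry (S N)) := fun N =>
    Measurable.tsum (measurable_indicator_index _ fun k => (hFm' k).enorm)
  have hzero : ∀ᵐ t ∂(volume.restrict I), ∀ (N : ℤ) (k : ℤ × ℤ × ℤ), ¬ N - 3 ≤ k.1 →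
      conv (lpKer hη N) (F k t) = 0 := by
    filter_upwards [h₁.le_sup, h₂.le_sup, h₃.le_sup, h₁.sup_lt_top hC, h₂.sup_lt_top hC,
      h₃.sup_lt_top hC, h₁.repr, h₂.repr, h₃.repr] with t a1 a2 a3 c1 c2 c3 d1 d2 d3 N k hk
    by_cases hkR : k ∈ R
    · simp only [hF, indicator_of_mem hkR]
      exact conv_lpKer_mul_eq_zero hη (hR k hkR).1 (hR k hkR).2 (by omega)
        ((h₁.meas k.1).comp (measurable_const.prodMk measurable_id))
        ((h₂.meas k.2.1).comp (measurable_const.prodMk measurable_id))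
        ((h₃.meas k.2.2).comp (measurable_const.prodMk measurable_id))
        (c1 _) (c2 _) (c3 _) (a1 _) (a2 _) (a3 _) (d1 _) (d2 _) (d3 _)
    · simp only [hF, indicator_of_notMem hkR]
      funext x
      simp [conv]
  have hconv : ∀ N, ∀ᵐ t ∂(volume.restrict I), ∀ x,
      ‖conv (lpKer hη N) (triSum R f₁ f₂ f₃ t) x‖ₑ ≤
        lconv (fun y => ‖lpKer hη N y‖ₑ) (S N t) x := fun N => by
    filter_upwards [htame, hzero] with t ht hz x
    exact enorm_conv_tsum_le (F := fun k => F k t)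
      (fun k => (hFm' k).comp (measurable_const.prodMk measurable_id)) (lpKer hη N)
      {k : ℤ × ℤ × ℤ | N - 3 ≤ k.1} (fun k hk => hz N k hk) x
      (lintegral_schwartz_sub_mul_lt_top (by norm_num) hq3 ht _ x)
  set M := 2 * ∫⁻ x, ‖lowKer hη 0 x‖ₑ with hM
  have hMt : M ≠ ⊤ := ENNReal.mul_ne_top (by norm_num) (lintegral_schwartz_ne_top _)
  have hσ := topExp_pos hδ b
  set z : ℤ → ℝ≥0∞ := fun N => ∑' k : ℤ × ℤ × ℤ, if N - 3 ≤ k.1 then (M * C ^ 3) *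
    (ENNReal.ofReal (dyad (N - k.1) ^ topExp δ b) *
      (ENNReal.ofReal (dyad (-|k.2.1 - k.2.2|) ^ (2 * δ)) *
        (z₁ k.1 * (z₂ k.2.1 * z₃ k.2.2)))) else 0 with hz
  have hmain : ∀ N, ENNReal.ofReal (dyad N ^ topExp δ b) *
      topNorm δ I b (fun t x => ‖conv (lpKer hη N) (triSum R f₁ f₂ f₃ t) x‖ₑ) ≤ z N := fun N => by
    have hK := measurable_enorm_schwartz (lpKer hη N)
    have hKr : IsRadial fun y => ‖lpKer hη N y‖ₑ := fun x y h => by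
      simp only [isRadial_lpKer hη N x y h]
    calc _ ≤ ENNReal.ofReal (dyad N ^ topExp δ b) * (M * topNorm δ I b (S N)) := by
          gcongr
          refine (topNorm_mono_ae hδ b (hconv N)).trans ?_
          refine (topNorm_lconv_le hδ hδ' b hK hKr (lintegral_schwartz_ne_top _)
            (fun _ => enorm_ne_top) (hSm N)).trans ?_
          gcongr
          exact lintegral_lpKer_le hη N
      _ ≤ ENNReal.ofReal (dyad N ^ topExp δ b) * (M * ∑' k : ℤ × ℤ × ℤ, topNorm δ I b
            fun t x => {k : ℤ × ℤ × ℤ | N - 3 ≤ k.1}.indicator (fun k => ‖F k t x‖ₑ) k) := by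
          gcongr
          exact topNorm_tsum_le hδ hδ' b (measurable_indicator_index _ fun k => (hFm' k).enorm)
      _ = ∑' k : ℤ × ℤ × ℤ, M * (ENNReal.ofReal (dyad N ^ topExp δ b) * topNorm δ I b
            fun t x => {k : ℤ × ℤ × ℤ | N - 3 ≤ k.1}.indicator (fun k => ‖F k t x‖ₑ) k) := by
          rw [ENNReal.tsum_mul_left, ENNReal.tsum_mul_left]
          ring
      _ ≤ z N := by
          refine ENNReal.tsum_le_tsum fun k => ?_
          by_cases hk : N - 3 ≤ k.1
          · simp only [indicator, mem_ofPred_eq, hk, if_true]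
            rw [mul_assoc M]
            refine mul_le_mul_right ?_ M
            refine le_trans ?_ (topNorm_term_le hδ hδ' hC h₁ h₂ h₃ N k.1 k.2.1 k.2.2)
            gcongr
            exact topNorm_mono_ae hδ b (ae_of_all _ fun t x => hFle k t x)
          · simp only [indicator, mem_ofPred_eq, hk, if_false]
            have e0 : topNorm δ I b (fun _ _ => 0) = 0 := by
              unfold topNorm sn
              cases b <;> simp [lnorm_zero, show 0 < 2 / (1 + 2 * δ) by positivity,
                show 0 < 14 / (9 + δ) by positivity]
            rw [e0, mul_zero, mul_zero]
  refine ⟨hbase, ?_, z, ?_, fun N => ?_⟩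
  · exact ENNReal.mul_lt_top (triConst_ne_top hδ hC).lt_top
      (ENNReal.mul_lt_top (ENNReal.mul_lt_top h₁.fin h₂.fin) h₃.fin)
  · exact l2sum_trilinear_le hσ.le (ENNReal.mul_ne_top hMt (ENNReal.pow_ne_top hC)) h₂.fin h₃.fin
      (by positivity)
  · set g : ℝ → E4 → ℂ := fun t => conv (lpKer hη N) (triSum R f₁ f₂ f₃ t) with hg
    have hgm : Measurable (Function.uncurry g) :=
      (stronglyMeasurable_conv hTm.stronglyMeasurable _).measurable
    have hgf : ∀ᵐ t ∂(volume.restrict I), HasFrequency N (g t) := by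
      filter_upwards [hslice] with t ht
      exact hasFrequency_conv hη N ht.1
    have h0m : Measurable (Function.uncurry (0 : ℝ → E4 → ℂ)) := measurable_const
    have h0f : ∀ᵐ t ∂(volume.restrict I), HasFrequency N ((0 : ℝ → E4 → ℂ) t) :=
      ae_of_all _ fun _ => hasFrequency_zero hη N
    -- The entire projected paraproduct goes into the component of G_N dictated by the space of the
    -- top factor.
    refine ⟨if b then g else 0, if b then 0 else g, ?_, ?_, ?_, ?_⟩
    · cases b <;> simpa
    · cases b <;> simpa
    · cases b
      · refine ⟨h0m.aestronglyMeasurable, hgm.aestronglyMeasurable, h0f, hgf, ?_⟩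
        exact ae_of_all _ fun t => ae_of_all _ fun x => by simp [hg, lpProj_eq hη]
      · refine ⟨hgm.aestronglyMeasurable, h0m.aestronglyMeasurable, hgf, h0f, ?_⟩
        exact ae_of_all _ fun t => ae_of_all _ fun x => by simp [hg, lpProj_eq hη]
    · rw [splitNorm_eq hδ]
      exact hmain N

end

/-! ### The trilinear estimate and the cubic nonlinearity -/

section


variable {η : ℝ → ℝ} {hη : IsLPCutoff η} {δ : ℝ} {I : Set ℝ} {b b₁ b₂ b₃ : Bool} {C : ℝ≥0∞}

/-- Decomposition of a product of three absolutely convergent series according to the largest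
index. -/
lemma mul_tsum_eq_paraproducts {a₁ a₂ a₃ : ℤ → ℂ} (h₁ : Summable fun k => ‖a₁ k‖)
    (h₂ : Summable fun k => ‖a₂ k‖) (h₃ : Summable fun k => ‖a₃ k‖) :
    (∑' k, a₁ k) * ((∑' k, a₂ k) * ∑' k, a₃ k) =
      (∑' k, {k : ℤ × ℤ × ℤ | k.2.1 ≤ k.1 ∧ k.2.2 ≤ k.1}.indicator
        (fun k : ℤ × ℤ × ℤ => a₁ k.1 * (a₂ k.2.1 * a₃ k.2.2)) k) +
      (∑' k, {k : ℤ × ℤ × ℤ | k.2.1 < k.1 ∧ k.2.2 ≤ k.1}.indicator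
        (fun k : ℤ × ℤ × ℤ => a₂ k.1 * (a₁ k.2.1 * a₃ k.2.2)) k) +
      ∑' k, {k : ℤ × ℤ × ℤ | k.2.1 < k.1 ∧ k.2.2 < k.1}.indicator
        (fun k : ℤ × ℤ × ℤ => a₃ k.1 * (a₁ k.2.1 * a₂ k.2.2)) k := by
  set F : ℤ × ℤ × ℤ → ℂ := fun k => a₁ k.1 * (a₂ k.2.1 * a₃ k.2.2) with hF
  have h23 : Summable fun k : ℤ × ℤ => ‖a₂ k.1 * a₃ k.2‖ := h₂.mul_norm h₃
  have hs : Summable F := (h₁.mul_norm h23).of_norm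
  have e2 : ∑' k, {k : ℤ × ℤ × ℤ | k.2.1 < k.1 ∧ k.2.2 ≤ k.1}.indicator
      (fun k : ℤ × ℤ × ℤ => a₂ k.1 * (a₁ k.2.1 * a₃ k.2.2)) k =
      ∑' k, {k : ℤ × ℤ × ℤ | k.1 < k.2.1 ∧ k.2.2 ≤ k.2.1}.indicator F k := by
    let e : ℤ × ℤ × ℤ ≃ ℤ × ℤ × ℤ := ⟨fun k => (k.2.1, k.1, k.2.2), fun k => (k.2.1, k.1, k.2.2),
      fun _ => rfl, fun _ => rfl⟩
    rw [← e.tsum_eq]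
    refine tsum_congr fun k => ?_
    simp only [indicator, mem_ofPred_eq, hF, e, Equiv.coe_fn_mk]
    split_ifs
    · ring
    · rfl
  have e3 : ∑' k, {k : ℤ × ℤ × ℤ | k.2.1 < k.1 ∧ k.2.2 < k.1}.indicator
      (fun k : ℤ × ℤ × ℤ => a₃ k.1 * (a₁ k.2.1 * a₂ k.2.2)) k =
      ∑' k, {k : ℤ × ℤ × ℤ | k.1 < k.2.2 ∧ k.2.1 < k.2.2}.indicator F k := by
    let e : ℤ × ℤ × ℤ ≃ ℤ × ℤ × ℤ := ⟨fun k => (k.2.2, k.1, k.2.1), fun k => (k.2.1, k.2.2, k.1),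
      fun _ => rfl, fun _ => rfl⟩
    rw [← e.tsum_eq]
    refine tsum_congr fun k => ?_
    simp only [indicator, mem_ofPred_eq, hF, e, Equiv.coe_fn_mk]
    split_ifs
    · ring
    · rfl
  rw [e2, e3, tsum_mul_tsum_of_summable_norm h₂ h₃, tsum_mul_tsum_of_summable_norm h₁ h23,
    ← (hs.indicator _).tsum_add (hs.indicator _),
    ← ((hs.indicator _).add (hs.indicator _)).tsum_add (hs.indicator _)]
  -- Ties go to the earlier factor, which is why some inequalities are strict; the three index sets
  -- then partition all triples.
  refine tsum_congr fun k => ?_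
  simp only [indicator, mem_ofPred_eq]
  split_ifs <;> first | omega | simp [hF]

lemma summable_norm_of_tsum_enorm {a : ℤ → ℂ} (h : ∑' k, ‖a k‖ₑ < ⊤) :
    Summable fun k => ‖a k‖ :=
  NNReal.summable_coe.2 (ENNReal.tsum_coe_ne_top_iff_summable.1 h.ne)

lemma Pieces.ae_summable (hδ : 0 < δ) (hδ' : δ ≤ 1 / 100) (hC : C ≠ ⊤) {f : ℤ → ℝ → E4 → ℂ}
    {β : ℤ → ℝ → ℝ≥0∞} {z : ℤ → ℝ≥0∞} (h : Pieces hη δ I b C f β z) :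
    ∀ᵐ t ∂(volume.restrict I), ∀ᵐ x, Summable fun k => ‖f k t x‖ := by
  have hq0 : 0 < 1 - 4 * δ := by linarith
  filter_upwards [h.isTame hδ hδ' hC] with t ht
  filter_upwards [ht.ae_lt_top (by norm_num) (by positivity)] with x hx
  exact summable_norm_of_tsum_enorm hx

/-- The constant in the trilinear estimate. -/
def cubicConst (hη : IsLPCutoff η) (δ : ℝ) (C : ℝ≥0∞) : ℝ≥0∞ :=
  3 * (triConst hη δ true C + triConst hη δ false C)

lemma cubicConst_ne_top (hδ : 0 < δ) (hC : C ≠ ⊤) : cubicConst hη δ C ≠ ⊤ :=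
  ENNReal.mul_ne_top (by norm_num)
    (ENNReal.add_ne_top.2 ⟨triConst_ne_top hδ hC, triConst_ne_top hδ hC⟩)

lemma triConst_le : triConst hη δ b C ≤ triConst hη δ true C + triConst hη δ false C := by
  cases b
  · exact le_add_self
  · exact le_self_add

/-- The product is the sum of three paraproducts, one for each factor in the top position, and each
is an instance of `gBound_triSum`. -/
lemma Decomposes.gBound_mul (hδ : 0 < δ) (hδ' : δ ≤ 1 / 100) (hC : C ≠ ⊤)
    {h₁ h₂ h₃ : ℝ → E4 → ℂ} {B₁ B₂ B₃ : ℝ≥0∞} (d₁ : Decomposes hη δ I b₁ C B₁ h₁)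
    (d₂ : Decomposes hη δ I b₂ C B₂ h₂) (d₃ : Decomposes hη δ I b₃ C B₃ h₃) :
    GBound η δ I (h₁ * h₂ * h₃) (cubicConst hη δ C * (B₁ * B₂ * B₃)) := by
  obtain ⟨m₁, f₁, β₁, z₁, p₁, rfl, s₁⟩ := d₁
  obtain ⟨m₂, f₂, β₂, z₂, p₂, rfl, s₂⟩ := d₂
  obtain ⟨m₃, f₃, β₃, z₃, p₃, rfl, s₃⟩ := d₃
  have g₁ := gBound_triSum hδ hδ' hC p₁ p₂ p₃
    (R := {k : ℤ × ℤ × ℤ | k.2.1 ≤ k.1 ∧ k.2.2 ≤ k.1}) fun k hk => hk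
  have g₂ := gBound_triSum hδ hδ' hC p₂ p₁ p₃
    (R := {k : ℤ × ℤ × ℤ | k.2.1 < k.1 ∧ k.2.2 ≤ k.1}) fun k hk => ⟨hk.1.le, hk.2⟩
  have g₃ := gBound_triSum hδ hδ' hC p₃ p₁ p₂
    (R := {k : ℤ × ℤ × ℤ | k.2.1 < k.1 ∧ k.2.2 < k.1}) fun k hk => ⟨hk.1.le, hk.2.le⟩
  have hlt : cubicConst hη δ C * (l2sum z₁ * l2sum z₂ * l2sum z₃) < ⊤ :=
    ENNReal.mul_lt_top (cubicConst_ne_top hδ hC).lt_top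
      (ENNReal.mul_lt_top (ENNReal.mul_lt_top p₁.fin p₂.fin) p₃.fin)
  refine (((g₁.add hη hδ hδ' g₂).add hη hδ hδ' g₃).congr (g := h₁ * h₂ * h₃) hη
    ((m₁.mul m₂).mul m₃) ?_).mono ?_ hlt
  · filter_upwards [s₁, s₂, s₃, p₁.ae_summable hδ hδ' hC, p₂.ae_summable hδ hδ' hC,
      p₃.ae_summable hδ hδ' hC] with t a1 a2 a3 c1 c2 c3
    filter_upwards [a1, a2, a3, c1, c2, c3] with x a1 a2 a3 c1 c2 c3
    simp only [Pi.mul_apply, Pi.add_apply, triSum]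
    rw [← mul_tsum_eq_paraproducts c1 c2 c3, a1.tsum_eq, a2.tsum_eq, a3.tsum_eq, mul_assoc]
  · set T := triConst hη δ true C + triConst hη δ false C with hT
    have t1 : triConst hη δ b₁ C ≤ T := triConst_le
    have t2 : triConst hη δ b₂ C ≤ T := triConst_le
    have t3 : triConst hη δ b₃ C ≤ T := triConst_le
    calc _ ≤ T * (l2sum z₁ * l2sum z₂ * l2sum z₃) + T * (l2sum z₂ * l2sum z₁ * l2sum z₃) +
          T * (l2sum z₃ * l2sum z₁ * l2sum z₂) := by gcongr
      _ = _ := by rw [cubicConst]; ring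

/-- Finite sums of decomposable functions, with the sum of their norms. -/
inductive SumDecomposes (hη : IsLPCutoff η) (δ : ℝ) (I : Set ℝ) (C : ℝ≥0∞) :
    (ℝ → E4 → ℂ) → ℝ≥0∞ → Prop
  | of {b : Bool} {h : ℝ → E4 → ℂ} {B : ℝ≥0∞} : Decomposes hη δ I b C B h →
      SumDecomposes hη δ I C h B
  | add {h h' : ℝ → E4 → ℂ} {B B' : ℝ≥0∞} : SumDecomposes hη δ I C h B →
      SumDecomposes hη δ I C h' B' → SumDecomposes hη δ I C (h + h') (B + B')

lemma SumDecomposes.star {h : ℝ → E4 → ℂ} {B : ℝ≥0∞} (hd : SumDecomposes hη δ I C h B) :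
    SumDecomposes hη δ I C (star h) B := by
  induction hd with
  | of h => exact .of h.conj
  | add _ _ ih ih' => rw [star_add]; exact .add ih ih'

/-- Both the product and the bound are multilinear, so induction on the three sums reduces to single
summands. Thus mixed arguments from X and Y need no separate case analysis. -/
lemma SumDecomposes.gBound_mul (hδ : 0 < δ) (hδ' : δ ≤ 1 / 100) (hC : C ≠ ⊤)
    {h₁ h₂ h₃ : ℝ → E4 → ℂ} {B₁ B₂ B₃ : ℝ≥0∞} (d₁ : SumDecomposes hη δ I C h₁ B₁)
    (d₂ : SumDecomposes hη δ I C h₂ B₂) (d₃ : SumDecomposes hη δ I C h₃ B₃) :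
    GBound η δ I (h₁ * h₂ * h₃) (cubicConst hη δ C * (B₁ * B₂ * B₃)) := by
  induction d₁ with
  | add _ _ ih ih' =>
    rw [add_mul, add_mul, add_mul, add_mul, mul_add]
    exact ih.add hη hδ hδ' ih'
  | of e₁ =>
    induction d₂ with
    | add _ _ ih ih' =>
      rw [mul_add, add_mul, mul_add, add_mul, mul_add]
      exact ih.add hη hδ hδ' ih'
    | of e₂ =>
      induction d₃ with
      | add _ _ ih ih' =>
        rw [mul_add, mul_add, mul_add]
        exact ih.add hη hδ hδ' ih'
      | of e₃ => exact e₁.gBound_mul hδ hδ' hC e₂ e₃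

lemma cubic_eq (u : ℝ → E4 → ℂ) : cubic u = u * star u * u := by
  funext t x
  simp only [cubic, Pi.mul_apply, Pi.star_apply]
  rw [Complex.star_def, Complex.mul_conj, Complex.normSq_eq_norm_sq]

/-- Telescoping, one factor at a time, so that every term contains the increment. -/
lemma cubic_sub_cubic (u w : ℝ → E4 → ℂ) :
    cubic (u + w) - cubic u = w * star (u + w) * (u + w) + u * star w * (u + w) +
      u * star u * w := by
  rw [cubic_eq, cubic_eq, star_add]
  ring

lemma gBound_cubic_sub (hδ : 0 < δ) (hδ' : δ ≤ 1 / 100) (hC : C ≠ ⊤) {u v w : ℝ → E4 → ℂ}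
    {U V W : ℝ≥0∞} (du : SumDecomposes hη δ I C u U) (dv : SumDecomposes hη δ I C v V)
    (dw : SumDecomposes hη δ I C w W) (h : v = u + w) :
    GBound η δ I (cubic v - cubic u) (cubicConst hη δ C * (W * (V ^ 2 + U * V + U ^ 2))) := by
  subst h
  rw [cubic_sub_cubic]
  have a1 := dw.gBound_mul hδ hδ' hC dv.star dv
  have a2 := du.gBound_mul hδ hδ' hC dw.star dv
  have a3 := du.gBound_mul hδ hδ' hC du.star dw
  convert (a1.add hη hδ hδ' a2).add hη hδ hδ' a3 using 1
  ring

lemma two_mul_le_sq_add_sq (a c : ℝ≥0∞) : 2 * (a * c) ≤ a ^ 2 + c ^ 2 := by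
  rcases eq_or_ne a ⊤ with rfl | ha
  · simp
  rcases eq_or_ne c ⊤ with rfl | hc
  · simp
  lift a to ℝ≥0 using ha
  lift c to ℝ≥0 using hc
  norm_cast
  have := two_mul_le_add_sq (a : ℝ) c
  rw [← NNReal.coe_le_coe]
  push_cast
  linarith

lemma sq_add_le (a c : ℝ≥0∞) : (a + c) ^ 2 ≤ 2 * (a ^ 2 + c ^ 2) := by
  calc (a + c) ^ 2 = a ^ 2 + 2 * (a * c) + c ^ 2 := by ring
    _ ≤ a ^ 2 + (a ^ 2 + c ^ 2) + c ^ 2 := by gcongr; exact two_mul_le_sq_add_sq a c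
    _ = _ := by ring

end

end ForcedNLS

end

theorem corollary4p2 :
    ∃ δ₀ : ℝ, 0 < δ₀ ∧ ∀ δ : ℝ, 0 < δ → δ ≤ δ₀ →
    ∀ η : ℝ → ℝ, ForcedNLS.IsLPCutoff η →
    ∃ C : ℝ≥0, 0 < C ∧ ∀ I : Set ℝ, I.OrdConnected →
      (∀ v F : ℝ → ForcedNLS.E4 → ℂ,
        ForcedNLS.MemX η δ I v → ForcedNLS.MemY η δ I F →
        ForcedNLS.MemG η δ I (ForcedNLS.cubic (v + F)) ∧
        ForcedNLS.normG η δ I (ForcedNLS.cubic (v + F)) ≤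
          C * (ForcedNLS.normX η δ I v ^ 3 + ForcedNLS.normY η δ I F ^ 3)) ∧
      (∀ v₁ v₂ F : ℝ → ForcedNLS.E4 → ℂ,
        ForcedNLS.MemX η δ I v₁ → ForcedNLS.MemX η δ I v₂ → ForcedNLS.MemY η δ I F →
        ForcedNLS.MemG η δ I (ForcedNLS.cubic (v₁ + F) - ForcedNLS.cubic (v₂ + F)) ∧
        ForcedNLS.normG η δ I (ForcedNLS.cubic (v₁ + F) - ForcedNLS.cubic (v₂ + F)) ≤
          C * (ForcedNLS.normX η δ I (v₁ - v₂) *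
            (ForcedNLS.normX η δ I v₁ ^ 2 + ForcedNLS.normX η δ I v₂ ^ 2 +
              ForcedNLS.normY η δ I F ^ 2))) ∧
      (∀ u w F : ℝ → ForcedNLS.E4 → ℂ,
        ForcedNLS.MemX η δ I u → ForcedNLS.MemX η δ I w → ForcedNLS.MemY η δ I F →
        ForcedNLS.MemG η δ I (ForcedNLS.cubic (u + w + F) - ForcedNLS.cubic u) ∧
        ForcedNLS.normG η δ I (ForcedNLS.cubic (u + w + F) - ForcedNLS.cubic u) ≤
          C * (ForcedNLS.normY η δ I F ^ 3 + ForcedNLS.normX η δ I w ^ 3 +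
            ForcedNLS.normY η δ I F * ForcedNLS.normX η δ I u ^ 2 +
            ForcedNLS.normX η δ I w * ForcedNLS.normX η δ I u ^ 2)) := by
  -- A convenient threshold: the exponent inequalities, such as 28 ≤ 4/δ and 2δ ≤ 1/7, hold with
  -- room to spare.
  refine ⟨1 / 100, by norm_num, fun δ hδ hδ' η hη => ?_⟩
  obtain ⟨C, hC, hdec⟩ := ForcedNLS.exists_decomposes hη hδ hδ'
  set K := ForcedNLS.cubicConst hη δ C with hK
  have hKt : K ≠ ⊤ := ForcedNLS.cubicConst_ne_top hδ hC
  -- The three estimates need the factors 4, 8 and 24, so 24 covers all; adding 1 makes the constant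
  -- positive.
  refine ⟨24 * K.toNNReal + 1, by positivity, fun I _ => ?_⟩
  obtain ⟨hX, hY⟩ := hdec I
  have hle : ∀ A : ℝ≥0∞, K * (24 * A) ≤ ((24 * K.toNNReal + 1 : ℝ≥0) : ℝ≥0∞) * A := fun A => by
    push_cast
    rw [ENNReal.coe_toNNReal hKt]
    calc K * (24 * A) = 24 * K * A := by ring
      _ ≤ _ := by gcongr; exact le_self_add
  have hfin : ∀ {h : ℝ → ForcedNLS.E4 → ℂ} {B A : ℝ≥0∞}, ForcedNLS.GBound η δ I h (K * B) →
      B ≤ 24 * A → ForcedNLS.MemG η δ I h ∧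
        ForcedNLS.normG η δ I h ≤ ((24 * K.toNNReal + 1 : ℝ≥0) : ℝ≥0∞) * A := fun {h B A} hg hBA =>
    ⟨hg.memG, hg.normG_le.trans ((mul_le_mul_right hBA K).trans (hle A))⟩
  refine ⟨fun v F hv hF => ?_, fun v₁ v₂ F hv₁ hv₂ hF => ?_, fun u w F hu hw hF => ?_⟩
  · have d := ForcedNLS.SumDecomposes.add (.of (hX v hv)) (.of (hY F hF))
    have g := d.gBound_mul hδ hδ' hC d.star d
    rw [← ForcedNLS.cubic_eq] at g
    refine hfin g ?_
    set x := ForcedNLS.normX η δ I v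
    set y := ForcedNLS.normY η δ I F
    calc (x + y) * (x + y) * (x + y) = (x + y) ^ 3 := by ring
      _ ≤ 4 * (x ^ 3 + y ^ 3) := ForcedNLS.cube_add_le x y
      _ ≤ 24 * (x ^ 3 + y ^ 3) := by gcongr; norm_num
  · have hw := hv₁.sub hη hδ hδ' hv₂
    have d₁ := ForcedNLS.SumDecomposes.add (.of (hX v₁ hv₁)) (.of (hY F hF))
    have d₂ := ForcedNLS.SumDecomposes.add (.of (hX v₂ hv₂)) (.of (hY F hF))
    -- The forcing cancels in the increment `v₁ - v₂`, which is decomposed as one element of X;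
    -- hence its own norm appears as a factor.
    refine hfin (ForcedNLS.gBound_cubic_sub hδ hδ' hC d₂ d₁ (.of (hX _ hw)) (by ring)) ?_
    set x := ForcedNLS.normX η δ I v₁
    set x' := ForcedNLS.normX η δ I v₂
    set y := ForcedNLS.normY η δ I F
    set w := ForcedNLS.normX η δ I (v₁ - v₂)
    have s1 := ForcedNLS.sq_add_le x y
    have s2 := ForcedNLS.sq_add_le x' y
    have s3 := ForcedNLS.two_mul_le_sq_add_sq (x' + y) (x + y)
    have s4 : (x' + y) * (x + y) ≤ (x' + y) ^ 2 + (x + y) ^ 2 :=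
      le_trans (by rw [two_mul]; exact le_self_add) s3
    calc w * ((x + y) ^ 2 + (x' + y) * (x + y) + (x' + y) ^ 2)
        ≤ w * (2 * (x ^ 2 + y ^ 2) + (2 * (x' ^ 2 + y ^ 2) + 2 * (x ^ 2 + y ^ 2)) +
            2 * (x' ^ 2 + y ^ 2)) := by
          gcongr
          exact s4.trans (add_le_add s2 s1)
      _ = w * (4 * x ^ 2 + 4 * x' ^ 2 + 8 * y ^ 2) := by ring
      _ ≤ w * (24 * x ^ 2 + 24 * x' ^ 2 + 24 * y ^ 2) := by gcongr <;> norm_num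
      _ = _ := by ring
  · have du := ForcedNLS.SumDecomposes.of (hX u hu)
    have dg := ForcedNLS.SumDecomposes.add (.of (hX w hw)) (.of (hY F hF))
    rw [add_assoc]
    -- Here the increment is `w + F`, so each term carries a factor `a + y`; the remaining squares
    -- are absorbed into x² and (a + y)².
    refine hfin (ForcedNLS.gBound_cubic_sub hδ hδ' hC du (.add du dg) dg rfl) ?_
    set x := ForcedNLS.normX η δ I u
    set a := ForcedNLS.normX η δ I w
    set y := ForcedNLS.normY η δ I F
    have s1 := ForcedNLS.sq_add_le x (a + y)
    have s2 := ForcedNLS.cube_add_le a y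
    calc (a + y) * ((x + (a + y)) ^ 2 + x * (x + (a + y)) + x ^ 2)
        ≤ (a + y) * ((x + (a + y)) ^ 2 + (x + (a + y)) * (x + (a + y)) + (x + (a + y)) ^ 2) := by
          gcongr
          · exact le_self_add
          · exact le_self_add
      _ = 3 * (a + y) * (x + (a + y)) ^ 2 := by ring
      _ ≤ 3 * (a + y) * (2 * (x ^ 2 + (a + y) ^ 2)) := by gcongr
      _ = 6 * ((a + y) * x ^ 2) + 6 * (a + y) ^ 3 := by ring
      _ ≤ 24 * ((a + y) * x ^ 2) + 6 * (4 * (a ^ 3 + y ^ 3)) := by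
          gcongr
          norm_num
      _ = _ := by ring
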